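/- **Theorem (an analogue of the Alexander theorem for knotoids).** Every (multi-)knotoid diagram in $\mathbb{R}^2$ is isotopic to the closure of a labeled braidoid diagram. Here diagrams are piecewise linear. A *multi-knotoid diagram* in $\mathbb{R}^2$ is a union of one oriented open polygonal curve, running from its *leg* to its *head*, and finitely many (possibly no) oriented closed polygonal curves, in general position: the only intersections are finitely many transversal double points in the interiors of edges, each with over/under-data, and the two endpoints are not on other edges. It is a *knotoid diagram* if there are no closed curves. Two diagrams are *isotopic* if they are related by a finite sequence of the following moves and their inverses: subdividing an edge (which does not change the diagram as a decorated planar set); $\Delta$-moves, which replace an edge $[a,b]$ by $[a,c]\cup[c,b]$, where the triangle $abc$ contains no endpoint of the diagram other than possibly $a$ or $b$, and the move passes entirely over or entirely under all arcs meeting the triangle; and swing moves, where an edge containing an endpoint sweeps a triangle free of other arcs, its other vertex being fixed. A *braidoid diagram* is a finite system of polygonal strands in $[0,1]\times[0,1]$ (coordinates $(x,t)$, the $t$-axis directed downward), each strictly descending, in general position with over/under-data at crossings. For some $n\ge 0$ and equidistant $x_1<\dots<x_n$, the strands start at a point called the leg and at the top ends $(x_i,0)$, and terminate at a point called the head and at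 the bottom ends $(x_i,1)$; neither the leg nor the head has $x$-coordinate equal to some $x_i$. It is *labeled* if each pair of corresponding ends $(x_i,0),(x_i,1)$ carries a label $o$ or $u$. Its *closure* is obtained by joining, for each $i$, $(x_i,1)$ to $(x_i,0)$ by an arc with tilted extremes that runs upward along the right-hand side of the line $x=x_i$ at a distance $\varepsilon>0$ from it, entirely over (label $o$) or entirely under (label $u$) the rest of the diagram. Here $\varepsilon$ is arbitrarily small: for every multi-knotoid diagram $K$ there is a labeled braidoid diagram $B$ such that for all sufficiently small $\varepsilon>0$ the closure of $B$ at distance $\varepsilon$ is a multi-knotoid diagram isotopic to $K$. -/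

import Mathlib

open Filter Topology

namespace PLKnotoid

/-- Points of the plane, with coordinates `(x, t)`; the `t`-axis points downward. -/
abbrev Pt : Type := ℝ × ℝ

/-- An oriented straight edge, running from `e.1` to `e.2`. -/
abbrev Edge : Type := Pt × Pt

/-- The closed straight segment carried by an edge. -/
def Edge.closedSeg (e : Edge) : Set Pt := segment ℝ e.1 e.2

/-- The open straight segment carried by an edge. -/
def Edge.openSeg (e : Edge) : Set Pt := openSegment ℝ e.1 e.2

/-- The determinant of the direction vectors of two edges; it vanishes iff they are parallel. -/
def Edge.det (e f : Edge) : ℝ :=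
  (e.2.1 - e.1.1) * (f.2.2 - f.1.2) - (e.2.2 - e.1.2) * (f.2.1 - f.1.1)

/-- Two different edges meet at a point interior to both. -/
def Edge.Crosses (e f : Edge) : Prop := e ≠ f ∧ (e.openSeg ∩ f.openSeg).Nonempty

/-- The solid (possibly degenerate) triangle with the given corners. -/
def triangle (a b c : Pt) : Set Pt := convexHull ℝ {a, b, c}

/-- `E` is a finite system of oriented polygonal curves in general position. The curves are the
components of the directed graph with edge set `E`: at most one edge leaves and at most one edge
enters each vertex, so they are simple paths, which start at the points of `init` and stop at the
points of `term`, and cycles. Curves meet only in finitely many transversal double points interior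
to edges (the crossings), and `passesOver e f` says that `e` passes over `f` at the crossing of `e`
and `f`. -/
structure IsCurveSystem (E : Set Edge) (init term : Set Pt) (passesOver : Edge → Edge → Prop) :
    Prop where
  finite : E.Finite
  nondegenerate : ∀ e ∈ E, e.1 ≠ e.2
  out_unique : ∀ e ∈ E, ∀ f ∈ E, e.1 = f.1 → e = f
  in_unique : ∀ e ∈ E, ∀ f ∈ E, e.2 = f.2 → e = f
  init_eq : {p | (∃ e ∈ E, e.1 = p) ∧ ¬ ∃ e ∈ E, e.2 = p} = init
  term_eq : {p | (∃ e ∈ E, e.2 = p) ∧ ¬ ∃ e ∈ E, e.1 = p} = term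
  vertex_off_edge : ∀ e ∈ E, ∀ f ∈ E, ∀ p, (p = e.1 ∨ p = e.2) → p ∈ f.closedSeg →
    p = f.1 ∨ p = f.2
  transversal : ∀ e ∈ E, ∀ f ∈ E, e.Crosses f → e.det f ≠ 0
  no_triple_point : ∀ e ∈ E, ∀ f ∈ E, ∀ g ∈ E, e ≠ f → e ≠ g → f ≠ g →
    e.openSeg ∩ f.openSeg ∩ g.openSeg = ∅
  passesOver_crosses : ∀ e f, passesOver e f → e ∈ E ∧ f ∈ E ∧ e.Crosses f
  passesOver_iff_not : ∀ e ∈ E, ∀ f ∈ E, e.Crosses f → (passesOver e f ↔ ¬ passesOver f e)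

/-- The data of a diagram: oriented edges, the two endpoints, and the over/under-data. -/
@[ext] structure DiagramData where
  edges : Set Edge
  leg : Pt
  head : Pt
  passesOver : Edge → Edge → Prop

/-- A piecewise-linear oriented (multi-)knotoid diagram in the plane: one open polygonal curve,
from the leg to the head, and finitely many (possibly no) closed polygonal curves. -/
@[ext] structure MultiKnotoidDiagram extends DiagramData where
  isCurveSystem : IsCurveSystem edges {leg} {head} passesOver

namespace MultiKnotoidDiagram

/-- `D₂` arises from `D₁` by inserting a vertex `c` in the interior of an edge `(a, b)`. The curves
and the crossings are unchanged, and the crossings of `(a, b)` keep their over/under-data. -/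
def Subdivision (D₁ D₂ : MultiKnotoidDiagram) : Prop :=
  ∃ a b c : Pt, (a, b) ∈ D₁.edges ∧ c ∈ openSegment ℝ a b ∧
    D₂.edges = (D₁.edges \ {(a, b)}) ∪ {(a, c), (c, b)} ∧
    D₂.leg = D₁.leg ∧ D₂.head = D₁.head ∧
    (∀ e ∈ D₁.edges \ {(a, b)}, ∀ f ∈ D₁.edges \ {(a, b)},
      (D₂.passesOver e f ↔ D₁.passesOver e f)) ∧
    (∀ e ∈ ({(a, c), (c, b)} : Set Edge), ∀ f ∈ D₁.edges \ {(a, b)},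
      (D₂.passesOver e f → D₁.passesOver (a, b) f) ∧ (D₂.passesOver f e → D₁.passesOver f (a, b)))

/-- The move from `D₁` to `D₂` replaces an edge `(a, b)` by `(a, c)` and `(c, b)`. The triangle
`a b c` contains no endpoint of the diagram (except that an end of the replaced edge may be one),
and the move passes entirely over or entirely under the arcs that meet the triangle. -/
def DeltaMove (D₁ D₂ : MultiKnotoidDiagram) : Prop :=
  ∃ a b c : Pt, (a, b) ∈ D₁.edges ∧
    D₂.edges = (D₁.edges \ {(a, b)}) ∪ {(a, c), (c, b)} ∧
    D₂.leg = D₁.leg ∧ D₂.head = D₁.head ∧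
    (∀ p, (p = D₁.leg ∨ p = D₁.head) → p ∈ triangle a b c → p = a ∨ p = b) ∧
    (∀ e ∈ D₁.edges \ {(a, b)}, ∀ f ∈ D₁.edges \ {(a, b)},
      (D₂.passesOver e f ↔ D₁.passesOver e f)) ∧
    ((∀ f, ¬ D₁.passesOver f (a, b) ∧ ¬ D₂.passesOver f (a, c) ∧ ¬ D₂.passesOver f (c, b)) ∨
      (∀ f, ¬ D₁.passesOver (a, b) f ∧ ¬ D₂.passesOver (a, c) f ∧ ¬ D₂.passesOver (c, b) f))

/-- The edge `(l, b)` at the leg `l` sweeps the triangle `l m b`, which is free of other arcs, and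
the leg moves from `l` to `m`. -/
def LegSwing (D₁ D₂ : MultiKnotoidDiagram) : Prop :=
  ∃ m b : Pt, (D₁.leg, b) ∈ D₁.edges ∧
    D₂.edges = (D₁.edges \ {(D₁.leg, b)}) ∪ {(m, b)} ∧
    D₂.leg = m ∧ D₂.head = D₁.head ∧
    (∀ f ∈ D₁.edges \ {(D₁.leg, b)}, f.closedSeg ∩ triangle D₁.leg m b ⊆ {b}) ∧
    (∀ e f, D₂.passesOver e f ↔ D₁.passesOver e f)

/-- The edge `(b, h)` at the head `h` sweeps the triangle `h m b`, which is free of other arcs, and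
the head moves from `h` to `m`. -/
def HeadSwing (D₁ D₂ : MultiKnotoidDiagram) : Prop :=
  ∃ m b : Pt, (b, D₁.head) ∈ D₁.edges ∧
    D₂.edges = (D₁.edges \ {(b, D₁.head)}) ∪ {(b, m)} ∧
    D₂.leg = D₁.leg ∧ D₂.head = m ∧
    (∀ f ∈ D₁.edges \ {(b, D₁.head)}, f.closedSeg ∩ triangle D₁.head m b ⊆ {b}) ∧
    (∀ e f, D₂.passesOver e f ↔ D₁.passesOver e f)

/-- The elementary isotopy moves. -/
def Move (D₁ D₂ : MultiKnotoidDiagram) : Prop :=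
  Subdivision D₁ D₂ ∨ DeltaMove D₁ D₂ ∨ LegSwing D₁ D₂ ∨ HeadSwing D₁ D₂

/-- Isotopy of (multi-)knotoid diagrams: the equivalence relation generated by the moves. -/
def Isotopic : MultiKnotoidDiagram → MultiKnotoidDiagram → Prop := Relation.EqvGen Move

end MultiKnotoidDiagram

/-- The labels of pairs of corresponding ends: `o` for overpassing, `u` for underpassing. -/
inductive Label where
  | o
  | u

/-- The horizontal position of the `i`-th of `n` equidistant pairs of corresponding ends. -/
def endX (firstEnd spacing : ℝ) {n : ℕ} (i : Fin n) : ℝ := firstEnd + (i : ℕ) * spacing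

/-- A piecewise-linear braidoid diagram in the unit square: descending polygonal strands which
start at the leg and at the `n` top ends, and stop at the head and at the `n` bottom ends. As all
edges descend there are no closed curves; the strands between a top and a bottom end are the
classical strands, the one or two strands that contain the leg or the head are the free strands.
Top and bottom ends are vertically aligned in pairs and equidistant, and no end is vertically
aligned with the leg or the head. -/
structure BraidoidDiagram extends DiagramData where
  n : ℕ
  firstEnd : ℝ
  spacing : ℝ
  spacing_pos : 0 < spacing
  isCurveSystem : IsCurveSystem edges
    ({leg} ∪ Set.range (fun i : Fin n => ((endX firstEnd spacing i, 0) : Pt)))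
    ({head} ∪ Set.range (fun i : Fin n => ((endX firstEnd spacing i, 1) : Pt)))
    passesOver
  mem_square : ∀ e ∈ edges, ∀ p, (p = e.1 ∨ p = e.2) → p ∈ Set.Icc (0 : ℝ) 1 ×ˢ Set.Icc (0 : ℝ) 1
  descending : ∀ e ∈ edges, e.1.2 < e.2.2
  leg_not_aligned : ∀ i : Fin n, leg.1 ≠ endX firstEnd spacing i
  head_not_aligned : ∀ i : Fin n, head.1 ≠ endX firstEnd spacing i

/-- A braidoid diagram with a label for every pair of corresponding ends. -/
structure LabeledBraidoidDiagram extends BraidoidDiagram where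
  label : Fin n → Label

/-- The arc that joins the bottom end `(x, 1)` to the top end `(x, 0)`: it runs upward along the
vertical line through these ends, at distance `ε` on its right, and has tilted extremes. -/
def joiningArc (x ε : ℝ) : Set Edge :=
  {((x, 1), (x + ε, 1 + ε)), ((x + ε, 1 + ε), (x + ε, -ε)), ((x + ε, -ε), (x, 0))}

namespace LabeledBraidoidDiagram

/-- The edges of the arc that joins the `i`-th pair of corresponding ends. -/
def arc (B : LabeledBraidoidDiagram) (ε : ℝ) (i : Fin B.n) : Set Edge :=
  joiningArc (endX B.firstEnd B.spacing i) ε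

/-- The closure of a labeled braidoid diagram with joining arcs at distance `ε`: the arcs labeled
`o` run over, and the arcs labeled `u` run under the rest of the diagram. The closure is meant for
all sufficiently small `ε > 0`, for which the joining arcs are pairwise disjoint. -/
def closure (B : LabeledBraidoidDiagram) (ε : ℝ) : DiagramData where
  edges := B.edges ∪ ⋃ i, B.arc ε i
  leg := B.leg
  head := B.head
  passesOver e f := B.passesOver e f ∨ (e.Crosses f ∧
    ((∃ i, B.label i = Label.o ∧ e ∈ B.arc ε i ∧ f ∈ B.edges) ∨
     (∃ i, B.label i = Label.u ∧ f ∈ B.arc ε i ∧ e ∈ B.edges)))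

end LabeledBraidoidDiagram

end PLKnotoid

/-!
The proof is a piecewise linear braiding algorithm. The `t`-axis points downward, so the edges that
obstruct a braidoid diagram are those along which `t` does not increase, the upward edges.

All isotopies are composed of few building blocks. An edge is pure of type `o` or `u` if it only
passes over, respectively under, other edges. A pure edge `(a, b)` can be replaced by `(a, v)` and
`(v, b)`, running over or under everything, if `v` is in sufficiently general position and the
triangle `a b v` contains no endpoint (`exists_insert`); transversality is automatic, because a
crossing of two edges whose ends lie off each other is transversal. An edge can be subdivided at a
point that is not a crossing. Finally, a continuous family of injective plane maps which are affine
on every edge is realized by an isotopy (`isotopic_family`): after subdivision, consecutive edges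
are pure and of opposite types, and then a small motion of one vertex is an insertion followed by
an inverse insertion, or a swing.

After a shear no edge is vertical. An upward edge is subdivided into short pure edges, and
such a piece `(P, Q)` is replaced by a staircase (`exists_stair`): a descending edge, an upward
vertical edge, and a descending edge, all of the type of the piece. The vertical line is chosen
generically, so that it meets vertices and crossings only on the vertical edge, which is called a
riser. Once all edges are descending or risers (`exists_normal`), the
risers are the only obstruction, and each has a label, its type. The use of vertical edges on
distinct lines is what makes the two labels work simultaneously: the joining arc that is pulled out
of a riser runs in a thin strip beside its own line, so it meets no other riser, and crosses only
descending edges.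

Piecewise linear changes of the `x`-coordinate make the risers equidistant, and a
homothety moves the diagram into the open unit square (`exists_equidistant_square`). For small `ε`
four insertions turn a riser into a finger, which descends vertically to the bottom, returns
along the joining arc, and descends vertically to the top of the remaining strand
(`exists_finger`). This works for all risers independently (`exists_fingers`). Removing the joining
arcs from the result leaves a labeled braidoid diagram which does not depend on `ε`
(`IsFramed.braid`), and adding them back gives its closure (`Fingers.eq_closure`).
-/

namespace PLKnotoid

/-! ### Segments in coordinates -/

/-- The cross product of two plane vectors. -/
def cr (u v : Pt) : ℝ := u.1 * v.2 - u.2 * v.1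

theorem mem_seg_iff {a b z : Pt} : z ∈ segment ℝ a b ↔
    ∃ s : ℝ, 0 ≤ s ∧ s ≤ 1 ∧ z.1 = a.1 + s * (b.1 - a.1) ∧ z.2 = a.2 + s * (b.2 - a.2) := by
  rw [segment_eq_image']
  constructor
  · rintro ⟨s, ⟨h0, h1⟩, rfl⟩
    exact ⟨s, h0, h1, by simp, by simp⟩
  · rintro ⟨s, h0, h1, e1, e2⟩
    exact ⟨s, ⟨h0, h1⟩, by ext <;> simp [e1, e2]⟩

theorem mem_oseg_iff {a b z : Pt} : z ∈ openSegment ℝ a b ↔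
    ∃ s : ℝ, 0 < s ∧ s < 1 ∧ z.1 = a.1 + s * (b.1 - a.1) ∧ z.2 = a.2 + s * (b.2 - a.2) := by
  rw [openSegment_eq_image']
  constructor
  · rintro ⟨s, ⟨h0, h1⟩, rfl⟩
    exact ⟨s, h0, h1, by simp, by simp⟩
  · rintro ⟨s, h0, h1, e1, e2⟩
    exact ⟨s, ⟨h0, h1⟩, by ext <;> simp [e1, e2]⟩

theorem oseg_subset_seg {a b z : Pt} (h : z ∈ openSegment ℝ a b) : z ∈ segment ℝ a b :=
  openSegment_subset_segment ℝ a b h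

theorem oseg_ne {a b z : Pt} (hab : a ≠ b) (h : z ∈ openSegment ℝ a b) : z ≠ a ∧ z ≠ b := by
  obtain ⟨s, h0, h1, e1, e2⟩ := mem_oseg_iff.1 h
  constructor <;> rintro rfl <;> apply hab
  · ext
    · have : s * (b.1 - z.1) = 0 := by linarith
      rcases mul_eq_zero.1 this with h | h <;> linarith
    · have : s * (b.2 - z.2) = 0 := by linarith
      rcases mul_eq_zero.1 this with h | h <;> linarith
  · ext
    · have : (1 - s) * (z.1 - a.1) = 0 := by linarith
      rcases mul_eq_zero.1 this with h | h <;> linarith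
    · have : (1 - s) * (z.2 - a.2) = 0 := by linarith
      rcases mul_eq_zero.1 this with h | h <;> linarith

theorem mem_oseg_of_seg {a b z : Pt} (h : z ∈ segment ℝ a b) (ha : z ≠ a) (hb : z ≠ b) :
    z ∈ openSegment ℝ a b :=
  mem_openSegment_of_ne_left_right ha.symm hb.symm h

/-- Segments that overlap along a line have an end of one in the interior of the other, or they
have the same ends. -/
theorem collinear_overlap_aux {a b c d : Pt} {u w k : ℝ} (hk : 0 < k)
    (hu0 : 0 < u) (hu1 : u < 1) (hw0 : 0 < w) (hw1 : w < 1)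
    (hd : d = c + k • (b - a)) (hz : a + u • (b - a) = c + w • (d - c)) :
    a ∈ openSegment ℝ c d ∨ b ∈ openSegment ℝ c d ∨ c ∈ openSegment ℝ a b ∨
      d ∈ openSegment ℝ a b ∨ (a = c ∧ b = d) := by
  have hdc : d - c = k • (b - a) := by rw [hd]; simp
  have hc1 : c.1 = a.1 + (u - w * k) * (b.1 - a.1) := by
    have := congrArg Prod.fst hz; rw [hdc] at this; simp at this; linarith
  have hc2 : c.2 = a.2 + (u - w * k) * (b.2 - a.2) := by
    have := congrArg Prod.snd hz; rw [hdc] at this; simp at this; linarith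
  have hd1 : d.1 = c.1 + k * (b.1 - a.1) := by rw [hd]; simp
  have hd2 : d.2 = c.2 + k * (b.2 - a.2) := by rw [hd]; simp
  have hwk : 0 < w * k := mul_pos hw0 hk
  have hwk' : 0 < (1 - w) * k := mul_pos (by linarith) hk
  by_cases h1 : 0 < u - w * k
  · right; right; left
    exact mem_oseg_iff.2 ⟨u - w * k, h1, by linarith, hc1, hc2⟩
  by_cases h2 : u + (1 - w) * k < 1
  · right; right; right; left
    exact mem_oseg_iff.2 ⟨u + (1 - w) * k, by linarith, h2, by rw [hd1, hc1]; ring,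
      by rw [hd2, hc2]; ring⟩
  by_cases h3 : u - w * k < 0
  · left
    refine mem_oseg_iff.2 ⟨(w * k - u) / k, div_pos (by linarith) hk, ?_, ?_, ?_⟩
    · rw [div_lt_one hk]; nlinarith
    · rw [hd1, hc1]; field_simp; ring
    · rw [hd2, hc2]; field_simp; ring
  by_cases h4 : 1 < u + (1 - w) * k
  · right; left
    refine mem_oseg_iff.2 ⟨(1 - (u - w * k)) / k, div_pos (by linarith) hk, ?_, ?_, ?_⟩
    · rw [div_lt_one hk]; nlinarith
    · rw [hd1, hc1]; field_simp; ring
    · rw [hd2, hc2]; field_simp; ring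
  · right; right; right; right
    have e1 : u - w * k = 0 := by linarith
    have e2 : k = 1 := by linarith
    rw [e1] at hc1 hc2
    refine ⟨by ext <;> linarith, ?_⟩
    rw [e2] at hd1 hd2
    ext <;> linarith

theorem collinear_overlap {a b c d z : Pt} (hab : a ≠ b) (hcd : c ≠ d)
    (hz : z ∈ openSegment ℝ a b) (hz' : z ∈ openSegment ℝ c d) (hdet : cr (b - a) (d - c) = 0) :
    a ∈ openSegment ℝ c d ∨ b ∈ openSegment ℝ c d ∨ c ∈ openSegment ℝ a b ∨
      d ∈ openSegment ℝ a b ∨ (a = c ∧ b = d) ∨ (a = d ∧ b = c) := by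
  rw [openSegment_eq_image'] at hz hz'
  obtain ⟨u, ⟨hu0, hu1⟩, rfl⟩ := hz
  obtain ⟨w, ⟨hw0, hw1⟩, hw⟩ := hz'
  simp only at hw
  have key : ∃ k : ℝ, d - c = k • (b - a) := by
    simp only [cr, Prod.fst_sub, Prod.snd_sub] at hdet
    by_cases h : b.1 - a.1 = 0
    · have h2 : b.2 - a.2 ≠ 0 := by
        intro h2; apply hab; ext <;> linarith
      refine ⟨(d.2 - c.2) / (b.2 - a.2), ?_⟩
      have : d.1 - c.1 = 0 := by
        rw [h] at hdet
        have : (b.2 - a.2) * (d.1 - c.1) = 0 := by linarith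
        exact (mul_eq_zero.1 this).resolve_left h2
      ext
      · simp [h, this]
      · simp; field_simp
    · refine ⟨(d.1 - c.1) / (b.1 - a.1), ?_⟩
      ext
      · simp; field_simp
      · simp; field_simp; linarith
  obtain ⟨k, hk⟩ := key
  have hk0 : k ≠ 0 := by
    rintro rfl
    simp at hk
    exact hcd (sub_eq_zero.1 hk).symm
  rcases lt_or_gt_of_ne hk0 with hk' | hk'
  · have := collinear_overlap_aux (a := a) (b := b) (c := d) (d := c) (u := u) (w := 1 - w)
      (k := -k) (by linarith) hu0 hu1 (by linarith) (by linarith)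
      (by rw [neg_smul, ← hk]; abel)
      (by rw [← hw]; module)
    rw [openSegment_symm ℝ d c] at this
    tauto
  · have := collinear_overlap_aux (a := a) (b := b) (c := c) (d := d) (u := u) (w := w)
      (k := k) hk' hu0 hu1 hw0 hw1 (by rw [← hk]; abel) hw.symm
    tauto

/-- Two segments with a common end `w` meet only there, unless one contains the other. -/
theorem seg_inter_of_common_end {w p q z : Pt} (hp : p ∉ segment ℝ w q) (hq : q ∉ segment ℝ w p)
    (hz : z ∈ segment ℝ w p) (hz' : z ∈ segment ℝ w q) : z = w := by
  obtain ⟨s, hs0, hs1, e1, e2⟩ := mem_seg_iff.1 hz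
  obtain ⟨r, hr0, hr1, f1, f2⟩ := mem_seg_iff.1 hz'
  by_contra hne
  have hs : 0 < s := by
    rcases hs0.eq_or_lt with h | h
    · subst h; exact (hne (by ext <;> simp [e1, e2])).elim
    · exact h
  have hr : 0 < r := by
    rcases hr0.eq_or_lt with h | h
    · subst h; exact (hne (by ext <;> simp [f1, f2])).elim
    · exact h
  rcases le_total s r with h | h
  · apply hq
    refine mem_seg_iff.2 ⟨s / r, by positivity, (div_le_one hr).2 h, ?_, ?_⟩ <;> field_simp <;>
      linarith
  · apply hp
    refine mem_seg_iff.2 ⟨r / s, by positivity, (div_le_one hs).2 h, ?_, ?_⟩ <;> field_simp <;>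
      linarith

/-- Sign criterion for two segments to cross transversally. -/
theorem transversal_iff_signs {a b c d : Pt} :
    ((openSegment ℝ a b ∩ openSegment ℝ c d).Nonempty ∧ cr (b - a) (d - c) ≠ 0) ↔
      cr (b - a) (c - a) * cr (b - a) (d - a) < 0 ∧
      cr (d - c) (a - c) * cr (d - c) (b - c) < 0 := by
  constructor
  · rintro ⟨⟨z, h1, h2⟩, hdet⟩
    obtain ⟨u, hu0, hu1, e1, e2⟩ := mem_oseg_iff.1 h1
    obtain ⟨w, hw0, hw1, f1, f2⟩ := mem_oseg_iff.1 h2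
    have hpos : 0 < cr (b - a) (d - c) ^ 2 := by positivity
    have c1 : a.1 = c.1 + w * (d.1 - c.1) - u * (b.1 - a.1) := by linarith
    have c2 : a.2 = c.2 + w * (d.2 - c.2) - u * (b.2 - a.2) := by linarith
    have i1 : cr (b - a) (c - a) = -w * cr (b - a) (d - c) := by
      simp only [cr, Prod.fst_sub, Prod.snd_sub]
      linear_combination (b.2 - a.2) * c1 - (b.1 - a.1) * c2
    have i2 : cr (b - a) (d - a) = (1 - w) * cr (b - a) (d - c) := by
      simp only [cr, Prod.fst_sub, Prod.snd_sub]
      linear_combination (b.2 - a.2) * c1 - (b.1 - a.1) * c2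
    have i3 : cr (d - c) (a - c) = u * cr (b - a) (d - c) := by
      simp only [cr, Prod.fst_sub, Prod.snd_sub]
      linear_combination -(d.2 - c.2) * c1 + (d.1 - c.1) * c2
    have i4 : cr (d - c) (b - c) = -(1 - u) * cr (b - a) (d - c) := by
      simp only [cr, Prod.fst_sub, Prod.snd_sub]
      linear_combination -(d.2 - c.2) * c1 + (d.1 - c.1) * c2
    rw [i1, i2, i3, i4]
    constructor
    · have := mul_pos (mul_pos hw0 (sub_pos.2 hw1)) hpos
      nlinarith
    · have := mul_pos (mul_pos hu0 (sub_pos.2 hu1)) hpos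
      nlinarith
  · rintro ⟨h1, h2⟩
    set p := cr (b - a) (c - a) with hp
    set q := cr (b - a) (d - a) with hq
    set r := cr (d - c) (a - c) with hr
    set s := cr (d - c) (b - c) with hs
    have hD : cr (b - a) (d - c) = q - p := by
      simp only [hp, hq, cr, Prod.fst_sub, Prod.snd_sub]; ring
    have hD' : r - s = q - p := by
      simp only [hp, hq, hr, hs, cr, Prod.fst_sub, Prod.snd_sub]; ring
    have hpq : q - p ≠ 0 := by
      intro h
      have : q = p := by linarith
      rw [this] at h1; nlinarith [mul_self_nonneg p]
    have between : ∀ x y : ℝ, x * y < 0 → 0 < x / (x - y) ∧ x / (x - y) < 1 := by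
      intro x y hxy
      rcases lt_or_ge x 0 with hx | hx
      · have hy : 0 < y := by by_contra h; nlinarith
        exact ⟨div_pos_of_neg_of_neg hx (by linarith),
          (div_lt_one_of_neg (by linarith)).2 (by linarith)⟩
      · have hx' : 0 < x := by
          rcases hx.eq_or_lt with h | h
          · rw [← h] at hxy; simp at hxy
          · exact h
        have hy : y < 0 := by by_contra h; nlinarith
        exact ⟨div_pos hx' (by linarith), (div_lt_one (by linarith)).2 (by linarith)⟩
    have b1 := between p q h1
    have b2 := between r s h2
    refine ⟨⟨a + (r / (r - s)) • (b - a), ?_, ?_⟩, by rw [hD]; exact hpq⟩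
    · exact mem_oseg_iff.2 ⟨r / (r - s), b2.1, b2.2, by simp, by simp⟩
    · have hpq' : p - q ≠ 0 := by intro h; apply hpq; linarith
      have hps : p / (p - q) = - (p / (q - p)) := by
        rw [← neg_sub q p, div_neg]
      refine mem_oseg_iff.2 ⟨p / (p - q), b1.1, b1.2, ?_, ?_⟩
      · rw [hps, hD']
        simp only [Prod.fst_add, Prod.smul_fst, Prod.fst_sub, smul_eq_mul]
        field_simp
        simp only [hp, hq, hr, cr, Prod.fst_sub, Prod.snd_sub]
        ring
      · rw [hps, hD']
        simp only [Prod.snd_add, Prod.smul_snd, Prod.snd_sub, smul_eq_mul]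
        field_simp
        simp only [hp, hq, hr, cr, Prod.fst_sub, Prod.snd_sub]
        ring

theorem cr_eq_zero_of_mem_seg {a b z : Pt} (h : z ∈ segment ℝ a b) : cr (b - a) (z - a) = 0 := by
  obtain ⟨s, -, -, e1, e2⟩ := mem_seg_iff.1 h
  simp only [cr, Prod.fst_sub, Prod.snd_sub, e1, e2]; ring

/-- If `z ≠ a` lies on the segment `a v`, then `v` lies on the line through `a` and `z`. -/
theorem cr_eq_zero_of_mem_seg' {a v z : Pt} (h : z ∈ segment ℝ a v) :
    cr (z - a) (v - a) = 0 := by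
  obtain ⟨s, -, -, e1, e2⟩ := mem_seg_iff.1 h
  simp only [cr, Prod.fst_sub, Prod.snd_sub, e1, e2]; ring

/-! ### Edge sets in general position -/

/-- The vertices of an edge set. -/
def verts (E : Set Edge) : Set Pt := {p | ∃ e ∈ E, p = e.1 ∨ p = e.2}

/-- The crossing points of an edge set. -/
def crossPts (E : Set Edge) : Set Pt :=
  {z | ∃ e ∈ E, ∃ f ∈ E, e ≠ f ∧ z ∈ e.openSeg ∧ z ∈ f.openSeg}

theorem fst_mem_verts {E : Set Edge} {e : Edge} (h : e ∈ E) : e.1 ∈ verts E := ⟨e, h, Or.inl rfl⟩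

theorem snd_mem_verts {E : Set Edge} {e : Edge} (h : e ∈ E) : e.2 ∈ verts E := ⟨e, h, Or.inr rfl⟩

theorem verts_finite {E : Set Edge} (h : E.Finite) : (verts E).Finite := by
  refine ((h.image Prod.fst).union (h.image Prod.snd)).subset ?_
  rintro p ⟨e, he, rfl | rfl⟩
  · exact Or.inl ⟨e, he, rfl⟩
  · exact Or.inr ⟨e, he, rfl⟩

theorem Edge.Crosses.symm {e f : Edge} (h : e.Crosses f) : f.Crosses e :=
  ⟨h.1.symm, by rw [Set.inter_comm]; exact h.2⟩

/-- Transversality need not be checked: it follows from `vertex_off_edge` and the absence of closed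
curves with two edges. -/
theorem transversal_of_off {E : Set Edge} (nondeg : ∀ e ∈ E, e.1 ≠ e.2)
    (noswap : ∀ e ∈ E, (e.2, e.1) ∉ E)
    (off : ∀ e ∈ E, ∀ f ∈ E, ∀ p, (p = e.1 ∨ p = e.2) → p ∈ f.closedSeg → p = f.1 ∨ p = f.2) :
    ∀ e ∈ E, ∀ f ∈ E, e.Crosses f → e.det f ≠ 0 := by
  rintro e he f hf ⟨hne, z, hz1, hz2⟩ hdet
  have hab := nondeg e he
  have hcd := nondeg f hf
  rcases collinear_overlap hab hcd hz1 hz2 hdet with h | h | h | h | h | h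
  · have := off e he f hf e.1 (Or.inl rfl) (oseg_subset_seg h)
    have := oseg_ne hcd h; tauto
  · have := off e he f hf e.2 (Or.inr rfl) (oseg_subset_seg h)
    have := oseg_ne hcd h; tauto
  · have := off f hf e he f.1 (Or.inl rfl) (oseg_subset_seg h)
    have := oseg_ne hab h; tauto
  · have := off f hf e he f.2 (Or.inr rfl) (oseg_subset_seg h)
    have := oseg_ne hab h; tauto
  · exact hne (Prod.ext h.1 h.2)
  · apply noswap e he
    have : ((e.2, e.1) : Edge) = f := Prod.ext h.2 h.1
    rwa [this]

namespace IsCurveSystem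

variable {E : Set Edge} {I T : Set Pt} {R : Edge → Edge → Prop}

theorem no_swap (h : IsCurveSystem E I T R) : ∀ e ∈ E, (e.2, e.1) ∉ E := by
  intro e he hs
  have hne := h.nondegenerate e he
  refine h.transversal e he _ hs ⟨?_, ?_⟩ ?_
  · intro heq
    exact hne (congrArg Prod.fst heq)
  · refine ⟨e.1 + (1 / 2 : ℝ) • (e.2 - e.1), ?_, ?_⟩
    · exact mem_oseg_iff.2 ⟨1 / 2, by norm_num, by norm_num, by simp, by simp⟩
    · exact mem_oseg_iff.2 ⟨1 / 2, by norm_num, by norm_num, by simp; ring, by simp; ring⟩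
  · simp only [Edge.det]; ring

/-- Consecutive edges meet only in their common vertex. -/
theorem consecutive_inter (h : IsCurveSystem E I T R) {e f : Edge} (he : e ∈ E) (hf : f ∈ E)
    (hef : e.2 = f.1) {z : Pt} (hz : z ∈ e.closedSeg) (hz' : z ∈ f.closedSeg) : z = e.2 := by
  have h1 : e.1 ∉ segment ℝ e.2 f.2 := by
    intro hm
    have hm' : e.1 ∈ f.closedSeg := by rw [Edge.closedSeg, ← hef]; exact hm
    rcases h.vertex_off_edge e he f hf e.1 (Or.inl rfl) hm' with h1 | h1
    · exact h.nondegenerate e he (h1.trans hef.symm)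
    · apply h.no_swap e he
      have : ((e.2, e.1) : Edge) = f := Prod.ext hef h1
      rwa [this]
  have h2 : f.2 ∉ segment ℝ e.2 e.1 := by
    intro hm
    have hm' : f.2 ∈ e.closedSeg := by rw [Edge.closedSeg, segment_symm]; exact hm
    rcases h.vertex_off_edge f hf e he f.2 (Or.inr rfl) hm' with h1 | h1
    · apply h.no_swap e he
      have : ((e.2, e.1) : Edge) = f := Prod.ext hef h1.symm
      rwa [this]
    · exact h.nondegenerate f hf (hef.symm.trans h1.symm)
  apply seg_inter_of_common_end h1 h2
  · rw [segment_symm]; exact hz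
  · rw [hef]; exact hz'

/-- Different edges with a common vertex do not cross. -/
theorem not_crosses_of_common (h : IsCurveSystem E I T R) {e f : Edge} (he : e ∈ E) (hf : f ∈ E)
    (hef : e.1 = f.1 ∨ e.1 = f.2 ∨ e.2 = f.1 ∨ e.2 = f.2) : ¬ e.Crosses f := by
  rintro ⟨hne, z, hz, hz'⟩
  rcases hef with h1 | h1 | h1 | h1
  · exact hne (h.out_unique e he f hf h1)
  · have := h.consecutive_inter hf he h1.symm (oseg_subset_seg hz') (oseg_subset_seg hz)
    exact (oseg_ne (h.nondegenerate f hf) hz').2 this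
  · have := h.consecutive_inter he hf h1 (oseg_subset_seg hz) (oseg_subset_seg hz')
    exact (oseg_ne (h.nondegenerate e he) hz).2 this
  · exact hne (h.in_unique e he f hf h1)

/-- Two different edges that meet cross or have a common vertex. -/
theorem crosses_or_common (h : IsCurveSystem E I T R) {e f : Edge} (he : e ∈ E) (hf : f ∈ E)
    (hne : e ≠ f) {z : Pt} (hz : z ∈ e.closedSeg) (hz' : z ∈ f.closedSeg) :
    e.Crosses f ∨ (e.1 = f.1 ∨ e.1 = f.2 ∨ e.2 = f.1 ∨ e.2 = f.2) := by
  by_cases h1 : z = e.1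
  · have := h.vertex_off_edge e he f hf e.1 (Or.inl rfl) (h1 ▸ hz'); tauto
  by_cases h2 : z = e.2
  · have := h.vertex_off_edge e he f hf e.2 (Or.inr rfl) (h2 ▸ hz'); tauto
  by_cases h3 : z = f.1
  · have := h.vertex_off_edge f hf e he f.1 (Or.inl rfl) (h3 ▸ hz); tauto
  by_cases h4 : z = f.2
  · have := h.vertex_off_edge f hf e he f.2 (Or.inr rfl) (h4 ▸ hz); tauto
  exact Or.inl ⟨hne, z, mem_oseg_of_seg hz h1 h2, mem_oseg_of_seg hz' h3 h4⟩

/-- Two crossing edges have exactly one common point. -/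
theorem cross_unique (h : IsCurveSystem E I T R) {e f : Edge} (he : e ∈ E) (hf : f ∈ E)
    (hne : e ≠ f) {z w : Pt} (hz : z ∈ e.openSeg) (hz' : z ∈ f.openSeg)
    (hw : w ∈ e.openSeg) (hw' : w ∈ f.openSeg) : z = w := by
  have hdet := h.transversal e he f hf ⟨hne, z, hz, hz'⟩
  obtain ⟨s, -, -, e1, e2⟩ := mem_oseg_iff.1 hz
  obtain ⟨r, -, -, f1, f2⟩ := mem_oseg_iff.1 hz'
  obtain ⟨s', -, -, e1', e2'⟩ := mem_oseg_iff.1 hw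
  obtain ⟨r', -, -, f1', f2'⟩ := mem_oseg_iff.1 hw'
  have k : (s - s') * e.det f = 0 := by
    simp only [Edge.det]
    have g1 : (s - s') * (e.2.1 - e.1.1) = (r - r') * (f.2.1 - f.1.1) := by linarith
    have g2 : (s - s') * (e.2.2 - e.1.2) = (r - r') * (f.2.2 - f.1.2) := by linarith
    linear_combination (f.2.2 - f.1.2) * g1 - (f.2.1 - f.1.1) * g2
  have : s = s' := by
    have := (mul_eq_zero.1 k).resolve_right hdet
    linarith
  subst this
  ext <;> linarith

theorem crossPts_finite (h : IsCurveSystem E I T R) : (crossPts E).Finite := by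
  have : crossPts E ⊆ ⋃ e ∈ E, ⋃ f ∈ E, {z | e ≠ f ∧ z ∈ e.openSeg ∧ z ∈ f.openSeg} := by
    rintro z ⟨e, he, f, hf, hz⟩
    simp only [Set.mem_iUnion]
    exact ⟨e, he, f, hf, hz⟩
  refine Set.Finite.subset (h.finite.biUnion fun e he => h.finite.biUnion fun f hf => ?_) this
  apply Set.Subsingleton.finite
  rintro z ⟨hne, hz, hz'⟩ w ⟨-, hw, hw'⟩
  exact h.cross_unique he hf hne hz hz' hw hw'

end IsCurveSystem

end PLKnotoid

namespace PLKnotoid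

/-! ### Inserting a vertex into an edge -/

/-- The edge set that arises when `(a, b)` is replaced by `(a, v)` and `(v, b)`. -/
def insertEdges (E : Set Edge) (a b v : Pt) : Set Edge := (E \ {(a, b)}) ∪ {(a, v), (v, b)}

/-- Replacing the edge `(a, b)` by `(a, v)` and `(v, b)` keeps general position. -/
structure Insertable (E : Set Edge) (a b v : Pt) : Prop where
  mem : (a, b) ∈ E
  ne_left : v ≠ a
  ne_right : v ≠ b
  off : ∀ f ∈ E, f ≠ (a, b) → v ∉ f.closedSeg
  left : ∀ s ∈ verts E, s ∈ segment ℝ a v → s = a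
  right : ∀ s ∈ verts E, s ∈ segment ℝ v b → s = b
  triple_left : ∀ f ∈ E, ∀ g ∈ E, f ≠ (a, b) → g ≠ (a, b) → f ≠ g → ∀ z,
    z ∈ openSegment ℝ a v → z ∈ f.openSeg → z ∉ g.openSeg
  triple_right : ∀ f ∈ E, ∀ g ∈ E, f ≠ (a, b) → g ≠ (a, b) → f ≠ g → ∀ z,
    z ∈ openSegment ℝ v b → z ∈ f.openSeg → z ∉ g.openSeg

section Insert

variable {E : Set Edge} {a b v : Pt}

theorem left_mem_insertEdges : ((a, v) : Edge) ∈ insertEdges E a b v := Or.inr (Or.inl rfl)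

theorem right_mem_insertEdges : ((v, b) : Edge) ∈ insertEdges E a b v := Or.inr (Or.inr rfl)

theorem rest_mem_insertEdges {e : Edge} (h : e ∈ E) (h' : e ≠ (a, b)) :
    e ∈ insertEdges E a b v := Or.inl ⟨h, h'⟩

theorem mem_insertEdges {e : Edge} : e ∈ insertEdges E a b v ↔
    (e ∈ E ∧ e ≠ (a, b)) ∨ e = (a, v) ∨ e = (v, b) := Iff.rfl

namespace Insertable

theorem notMem_verts (h : Insertable E a b v) : v ∉ verts E := by
  rintro ⟨e, he, hv⟩
  by_cases hab : e = (a, b)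
  · subst hab
    rcases hv with hv | hv
    · exact h.ne_left hv
    · exact h.ne_right hv
  · apply h.off e he hab
    rcases hv with hv | hv
    · rw [hv]; exact left_mem_segment ℝ _ _
    · rw [hv]; exact right_mem_segment ℝ _ _

theorem left_notMem (h : Insertable E a b v) : ((a, v) : Edge) ∉ E :=
  fun hm => h.notMem_verts (snd_mem_verts hm)

theorem right_notMem (h : Insertable E a b v) : ((v, b) : Edge) ∉ E :=
  fun hm => h.notMem_verts (fst_mem_verts hm)

theorem verts_subset (h : Insertable E a b v) {p : Pt} (hp : p ∈ verts (insertEdges E a b v)) :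
    p ∈ verts E ∨ p = v := by
  obtain ⟨e, he, hpe⟩ := hp
  rcases mem_insertEdges.1 he with ⟨he, -⟩ | rfl | rfl
  · exact Or.inl ⟨e, he, hpe⟩
  · rcases hpe with rfl | rfl
    · exact Or.inl (fst_mem_verts h.mem)
    · exact Or.inr rfl
  · rcases hpe with rfl | rfl
    · exact Or.inr rfl
    · exact Or.inl (snd_mem_verts h.mem)

theorem new_disjoint (h : Insertable E a b v) (hab : a ≠ b) {z : Pt}
    (hz : z ∈ openSegment ℝ a v) : z ∉ openSegment ℝ v b := by
  intro hz'
  have h1 : a ∉ segment ℝ v b := fun hm => hab (h.right a (fst_mem_verts h.mem) hm)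
  have h2 : b ∉ segment ℝ v a := fun hm =>
    hab (h.left b (snd_mem_verts h.mem) (by rwa [segment_symm])).symm
  have := seg_inter_of_common_end h1 h2 (by rw [segment_symm]; exact oseg_subset_seg hz)
    (oseg_subset_seg hz')
  exact (oseg_ne h.ne_right hz').1 this

end Insertable

/-- A new edge of an insertion. -/
def IsNew (a b v : Pt) (e : Edge) : Prop := e = (a, v) ∨ e = (v, b)

theorem mem_insertEdges' {e : Edge} : e ∈ insertEdges E a b v ↔
    (e ∈ E ∧ e ≠ (a, b)) ∨ IsNew a b v e := Iff.rfl

theorem Insertable.new_notMem (h : Insertable E a b v) {e : Edge} (he : IsNew a b v e) :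
    e ∉ E := by
  rcases he with rfl | rfl
  · exact h.left_notMem
  · exact h.right_notMem

theorem Insertable.new_new_disjoint (h : Insertable E a b v) (hab : a ≠ b) {e f : Edge}
    (he : IsNew a b v e) (hf : IsNew a b v f) (hef : e ≠ f) {z : Pt} (hz : z ∈ e.openSeg) :
    z ∉ f.openSeg := by
  rcases he with rfl | rfl <;> rcases hf with rfl | rfl
  · exact (hef rfl).elim
  · exact h.new_disjoint hab hz
  · exact fun hz' => h.new_disjoint hab hz' hz
  · exact (hef rfl).elim

theorem Insertable.triple (h : Insertable E a b v) {e f g : Edge} (he : IsNew a b v e)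
    (hf : f ∈ E) (hg : g ∈ E) (hfa : f ≠ (a, b)) (hga : g ≠ (a, b)) (hfg : f ≠ g) {z : Pt}
    (hz : z ∈ e.openSeg) (hz' : z ∈ f.openSeg) : z ∉ g.openSeg := by
  rcases he with rfl | rfl
  · exact h.triple_left f hf g hg hfa hga hfg z hz hz'
  · exact h.triple_right f hf g hg hfa hga hfg z hz hz'

/-- The over/under-data after an insertion: unchanged between old edges, given by `Q` for the new
edges. -/
def insertOver (E : Set Edge) (a b v : Pt) (R Q : Edge → Edge → Prop) (e f : Edge) : Prop :=
  e ∈ insertEdges E a b v ∧ f ∈ insertEdges E a b v ∧ e.Crosses f ∧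
    ((e ∈ E ∧ f ∈ E ∧ R e f) ∨ (¬ (e ∈ E ∧ f ∈ E) ∧ Q e f))

theorem Insertable.isCurveSystem {l h : Pt} {R Q : Edge → Edge → Prop}
    (hI : Insertable E a b v) (hD : IsCurveSystem E {l} {h} R)
    (hQ : ∀ e ∈ insertEdges E a b v, ∀ f ∈ insertEdges E a b v, e.Crosses f →
      ¬ (e ∈ E ∧ f ∈ E) → (Q e f ↔ ¬ Q f e)) :
    IsCurveSystem (insertEdges E a b v) {l} {h} (insertOver E a b v R Q) := by
  have hab : a ≠ b := hD.nondegenerate _ hI.mem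
  have hvE := hI.notMem_verts
  have nondeg : ∀ e ∈ insertEdges E a b v, e.1 ≠ e.2 := by
    intro e he
    rcases mem_insertEdges.1 he with ⟨he, -⟩ | rfl | rfl
    · exact hD.nondegenerate e he
    · exact hI.ne_left.symm
    · exact hI.ne_right
  have off : ∀ e ∈ insertEdges E a b v, ∀ f ∈ insertEdges E a b v, ∀ p,
      (p = e.1 ∨ p = e.2) → p ∈ f.closedSeg → p = f.1 ∨ p = f.2 := by
    intro e he f hf p hp hpf
    rcases hI.verts_subset ⟨e, he, hp⟩ with hpE | rfl
    · rcases mem_insertEdges.1 hf with ⟨hf, -⟩ | rfl | rfl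
      · obtain ⟨e', he', hp'⟩ := hpE
        exact hD.vertex_off_edge e' he' f hf p hp' hpf
      · exact Or.inl (hI.left p hpE hpf)
      · exact Or.inr (hI.right p hpE hpf)
    · rcases mem_insertEdges.1 hf with ⟨hf, hfab⟩ | rfl | rfl
      · exact (hI.off f hf hfab hpf).elim
      · exact Or.inr rfl
      · exact Or.inl rfl
  have noswap : ∀ e ∈ insertEdges E a b v, (e.2, e.1) ∉ insertEdges E a b v := by
    intro e he hs
    rcases mem_insertEdges.1 he with ⟨he, -⟩ | rfl | rfl
    · rcases mem_insertEdges.1 hs with ⟨hs, -⟩ | h1 | h1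
      · exact hD.no_swap e he hs
      · have h2 : e.1 = v := congrArg Prod.snd h1
        exact hvE (h2 ▸ fst_mem_verts he)
      · have h2 : e.2 = v := congrArg Prod.fst h1
        exact hvE (h2 ▸ snd_mem_verts he)
    · rcases mem_insertEdges.1 hs with ⟨hs, -⟩ | h1 | h1
      · exact hvE (fst_mem_verts hs)
      · exact hI.ne_left (congrArg Prod.fst h1)
      · exact hab (congrArg Prod.snd h1)
    · rcases mem_insertEdges.1 hs with ⟨hs, -⟩ | h1 | h1
      · exact hvE (snd_mem_verts hs)
      · exact hab (congrArg Prod.fst h1).symm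
      · exact hI.ne_right (congrArg Prod.snd h1)
  have hout : {p | ∃ e ∈ insertEdges E a b v, e.1 = p} = insert v {p | ∃ e ∈ E, e.1 = p} := by
    ext p
    constructor
    · rintro ⟨e, he, rfl⟩
      rcases mem_insertEdges.1 he with ⟨he, -⟩ | rfl | rfl
      · exact Or.inr ⟨e, he, rfl⟩
      · exact Or.inr ⟨_, hI.mem, rfl⟩
      · exact Or.inl rfl
    · rintro (rfl | ⟨e, he, rfl⟩)
      · exact ⟨_, right_mem_insertEdges, rfl⟩
      · by_cases h : e = (a, b)
        · subst h; exact ⟨_, left_mem_insertEdges, rfl⟩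
        · exact ⟨e, rest_mem_insertEdges he h, rfl⟩
  have hin : {p | ∃ e ∈ insertEdges E a b v, e.2 = p} = insert v {p | ∃ e ∈ E, e.2 = p} := by
    ext p
    constructor
    · rintro ⟨e, he, rfl⟩
      rcases mem_insertEdges.1 he with ⟨he, -⟩ | rfl | rfl
      · exact Or.inr ⟨e, he, rfl⟩
      · exact Or.inl rfl
      · exact Or.inr ⟨_, hI.mem, rfl⟩
    · rintro (rfl | ⟨e, he, rfl⟩)
      · exact ⟨_, left_mem_insertEdges, rfl⟩
      · by_cases h : e = (a, b)
        · subst h; exact ⟨_, right_mem_insertEdges, rfl⟩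
        · exact ⟨e, rest_mem_insertEdges he h, rfl⟩
  have hv1 : ¬ ∃ e ∈ E, e.1 = v := by
    rintro ⟨e, he, h⟩; exact hvE (h ▸ fst_mem_verts he)
  have hv2 : ¬ ∃ e ∈ E, e.2 = v := by
    rintro ⟨e, he, h⟩; exact hvE (h ▸ snd_mem_verts he)
  refine
    { finite := ((hD.finite.subset Set.sdiff_subset).union (Set.toFinite _))
      nondegenerate := nondeg
      out_unique := ?_
      in_unique := ?_
      init_eq := ?_
      term_eq := ?_
      vertex_off_edge := off
      transversal := transversal_of_off nondeg noswap off
      no_triple_point := ?_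
      passesOver_crosses := fun e f h => ⟨h.1, h.2.1, h.2.2.1⟩
      passesOver_iff_not := ?_ }
  · intro e he f hf hef
    rcases mem_insertEdges.1 he with ⟨he, hea⟩ | rfl | rfl <;>
      rcases mem_insertEdges.1 hf with ⟨hf, hfa⟩ | rfl | rfl
    · exact hD.out_unique e he f hf hef
    · exact (hea (hD.out_unique e he _ hI.mem hef)).elim
    · exact (hv1 ⟨e, he, hef⟩).elim
    · exact (hfa (hD.out_unique f hf _ hI.mem hef.symm)).elim
    · rfl
    · exact (hI.ne_left hef.symm).elim
    · exact (hv1 ⟨f, hf, hef.symm⟩).elim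
    · exact (hI.ne_left hef).elim
    · rfl
  · intro e he f hf hef
    rcases mem_insertEdges.1 he with ⟨he, hea⟩ | rfl | rfl <;>
      rcases mem_insertEdges.1 hf with ⟨hf, hfa⟩ | rfl | rfl
    · exact hD.in_unique e he f hf hef
    · exact (hv2 ⟨e, he, hef⟩).elim
    · exact (hea (hD.in_unique e he _ hI.mem hef)).elim
    · exact (hv2 ⟨f, hf, hef.symm⟩).elim
    · rfl
    · exact (hI.ne_right hef).elim
    · exact (hfa (hD.in_unique f hf _ hI.mem hef.symm)).elim
    · exact (hI.ne_right hef.symm).elim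
    · rfl
  · rw [← hD.init_eq]
    ext p
    have h1 : (∃ e ∈ insertEdges E a b v, e.1 = p) ↔ (p = v ∨ ∃ e ∈ E, e.1 = p) :=
      Set.ext_iff.1 hout p
    have h2 : (∃ e ∈ insertEdges E a b v, e.2 = p) ↔ (p = v ∨ ∃ e ∈ E, e.2 = p) :=
      Set.ext_iff.1 hin p
    simp only [Set.mem_ofPred_eq, h1, h2]
    constructor
    · rintro ⟨rfl | h, h'⟩ <;> tauto
    · rintro ⟨h, h'⟩
      have : p ≠ v := by rintro rfl; exact hv1 h
      exact ⟨Or.inr h, fun h3 => h3.elim this h'⟩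
  · rw [← hD.term_eq]
    ext p
    have h1 : (∃ e ∈ insertEdges E a b v, e.1 = p) ↔ (p = v ∨ ∃ e ∈ E, e.1 = p) :=
      Set.ext_iff.1 hout p
    have h2 : (∃ e ∈ insertEdges E a b v, e.2 = p) ↔ (p = v ∨ ∃ e ∈ E, e.2 = p) :=
      Set.ext_iff.1 hin p
    simp only [Set.mem_ofPred_eq, h1, h2]
    constructor
    · rintro ⟨rfl | h, h'⟩ <;> tauto
    · rintro ⟨h, h'⟩
      have : p ≠ v := by rintro rfl; exact hv2 h
      exact ⟨Or.inr h, fun h3 => h3.elim this h'⟩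
  · intro e he f hf g hg hef heg hfg
    rw [Set.eq_empty_iff_forall_notMem]
    rintro z ⟨⟨h1, h2⟩, h3⟩
    have nn := fun {e f : Edge} => hI.new_new_disjoint hab (e := e) (f := f)
    rcases mem_insertEdges'.1 he with ⟨he, hea⟩ | he <;>
      rcases mem_insertEdges'.1 hf with ⟨hf, hfa⟩ | hf <;>
      rcases mem_insertEdges'.1 hg with ⟨hg, hga⟩ | hg
    · have := hD.no_triple_point e he f hf g hg hef heg hfg
      exact Set.eq_empty_iff_forall_notMem.1 this z ⟨⟨h1, h2⟩, h3⟩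
    · exact hI.triple hg he hf hea hfa hef h3 h1 h2
    · exact hI.triple hf he hg hea hga heg h2 h1 h3
    · exact nn hf hg hfg h2 h3
    · exact hI.triple he hf hg hfa hga hfg h1 h2 h3
    · exact nn he hg heg h1 h3
    · exact nn he hf hef h1 h2
    · exact nn he hf hef h1 h2
  · intro e he f hf hc
    by_cases hE : e ∈ E ∧ f ∈ E
    · have h1 := hD.passesOver_iff_not e hE.1 f hE.2 hc
      have h2 : insertOver E a b v R Q e f ↔ R e f :=
        ⟨fun h => h.2.2.2.elim (fun h => h.2.2) fun h => (h.1 hE).elim,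
          fun h => ⟨he, hf, hc, Or.inl ⟨hE.1, hE.2, h⟩⟩⟩
      have h3 : insertOver E a b v R Q f e ↔ R f e :=
        ⟨fun h => h.2.2.2.elim (fun h => h.2.2) fun h => (h.1 hE.symm).elim,
          fun h => ⟨hf, he, hc.symm, Or.inl ⟨hE.2, hE.1, h⟩⟩⟩
      rw [h2, h3, h1]
    · have h1 := hQ e he f hf hc hE
      have hE' : ¬ (f ∈ E ∧ e ∈ E) := fun h => hE h.symm
      have h2 : insertOver E a b v R Q e f ↔ Q e f :=
        ⟨fun h => h.2.2.2.elim (fun h => (hE ⟨h.1, h.2.1⟩).elim) fun h => h.2,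
          fun h => ⟨he, hf, hc, Or.inr ⟨hE, h⟩⟩⟩
      have h3 : insertOver E a b v R Q f e ↔ Q f e :=
        ⟨fun h => h.2.2.2.elim (fun h => (hE' ⟨h.1, h.2.1⟩).elim) fun h => h.2,
          fun h => ⟨hf, he, hc.symm, Or.inr ⟨hE', h⟩⟩⟩
      rw [h2, h3, h1]

end Insert

/-! ### Pure edges and the two ways to insert a vertex -/

/-- The opposite label. -/
def Label.flip : Label → Label
  | .o => .u
  | .u => .o

@[simp] theorem Label.flip_flip (τ : Label) : τ.flip.flip = τ := by cases τ <;> rfl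

/-- `e` only passes over other edges (type `o`), or only passes under other edges (type `u`). -/
def Pure (R : Edge → Edge → Prop) : Label → Edge → Prop
  | .o, e => ∀ f, ¬ R f e
  | .u, e => ∀ f, ¬ R e f

/-- `e` is on the side of `f` prescribed by the label: over `f` for `o`, under `f` for `u`. -/
def Side (R : Edge → Edge → Prop) : Label → Edge → Edge → Prop
  | .o, e, f => R e f
  | .u, e, f => R f e

namespace MultiKnotoidDiagram

variable {D : MultiKnotoidDiagram}

theorem pure_iff {τ : Label} {e : Edge} (he : e ∈ D.edges) :
    Pure D.passesOver τ e ↔ ∀ f ∈ D.edges, e.Crosses f → Side D.passesOver τ e f := by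
  have hc := D.isCurveSystem
  cases τ
  · constructor
    · intro h f hf hef
      exact (hc.passesOver_iff_not e he f hf hef).2 (h f)
    · intro h f hfe
      obtain ⟨hf, -, hcr⟩ := hc.passesOver_crosses _ _ hfe
      have := h f hf hcr.symm
      exact (hc.passesOver_iff_not e he f hf hcr.symm).1 this hfe
  · constructor
    · intro h f hf hef
      exact (hc.passesOver_iff_not f hf e he hef.symm).2 (h f)
    · intro h f hfe
      obtain ⟨-, hf, hcr⟩ := hc.passesOver_crosses _ _ hfe
      have := h f hf hcr
      exact (hc.passesOver_iff_not f hf e he hcr.symm).1 this hfe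

theorem pure_of_not_crosses {τ : Label} {e : Edge} (h : ∀ f ∈ D.edges, ¬ e.Crosses f) :
    Pure D.passesOver τ e := by
  have hc := D.isCurveSystem
  cases τ
  · intro f hf
    obtain ⟨hf, -, hcr⟩ := hc.passesOver_crosses _ _ hf
    exact h f hf hcr.symm
  · intro f hf
    obtain ⟨-, hf, hcr⟩ := hc.passesOver_crosses _ _ hf
    exact h f hf hcr

/-- A crossing between pure edges of the same type is impossible. -/
theorem not_crosses_of_pure {τ : Label} {e f : Edge} (he : e ∈ D.edges) (hf : f ∈ D.edges)
    (h1 : Pure D.passesOver τ e) (h2 : Pure D.passesOver τ f) : ¬ e.Crosses f := by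
  intro hc
  have := (pure_iff he).1 h1 f hf hc
  cases τ
  · exact h2 e this
  · exact h2 e this

theorem Isotopic.refl (D : MultiKnotoidDiagram) : Isotopic D D := Relation.EqvGen.refl D

theorem Isotopic.symm {D₁ D₂ : MultiKnotoidDiagram} (h : Isotopic D₁ D₂) : Isotopic D₂ D₁ :=
  Relation.EqvGen.symm _ _ h

theorem Isotopic.trans {D₁ D₂ D₃ : MultiKnotoidDiagram} (h : Isotopic D₁ D₂)
    (h' : Isotopic D₂ D₃) : Isotopic D₁ D₃ := Relation.EqvGen.trans _ _ _ h h'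

theorem Isotopic.of_delta {D₁ D₂ : MultiKnotoidDiagram} (h : DeltaMove D₁ D₂) : Isotopic D₁ D₂ :=
  Relation.EqvGen.rel _ _ (Or.inr (Or.inl h))

/-- The `Δ`-condition is the purity of the three edges. -/
theorem deltaMove_of_pure {D₁ D₂ : MultiKnotoidDiagram} (τ : Label) {a b c : Pt}
    (hab : (a, b) ∈ D₁.edges) (hE : D₂.edges = insertEdges D₁.edges a b c)
    (hl : D₂.leg = D₁.leg) (hh : D₂.head = D₁.head)
    (htri : ∀ p, (p = D₁.leg ∨ p = D₁.head) → p ∈ triangle a b c → p = a ∨ p = b)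
    (hrest : ∀ e ∈ D₁.edges \ {(a, b)}, ∀ f ∈ D₁.edges \ {(a, b)},
      (D₂.passesOver e f ↔ D₁.passesOver e f))
    (h1 : Pure D₁.passesOver τ (a, b)) (h2 : Pure D₂.passesOver τ (a, c))
    (h3 : Pure D₂.passesOver τ (c, b)) : DeltaMove D₁ D₂ := by
  refine ⟨a, b, c, hab, hE, hl, hh, htri, hrest, ?_⟩
  cases τ
  · exact Or.inl fun f => ⟨h1 f, h2 f, h3 f⟩
  · exact Or.inr fun f => ⟨h1 f, h2 f, h3 f⟩

/-- A vertex can be inserted into a pure edge if the swept triangle contains no endpoint; the new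
edges are pure of the same type. -/
theorem exists_insert (τ : Label) {a b v : Pt} (hI : Insertable D.edges a b v)
    (hp : Pure D.passesOver τ (a, b))
    (htri : ∀ p, (p = D.leg ∨ p = D.head) → p ∈ triangle a b v → p = a ∨ p = b) :
    ∃ D' : MultiKnotoidDiagram, Isotopic D D' ∧ D'.edges = insertEdges D.edges a b v ∧
      D'.leg = D.leg ∧ D'.head = D.head ∧
      (∀ e ∈ D.edges, ∀ f ∈ D.edges, e ≠ (a, b) → f ≠ (a, b) →
        (D'.passesOver e f ↔ D.passesOver e f)) ∧
      Pure D'.passesOver τ (a, v) ∧ Pure D'.passesOver τ (v, b) := by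
  have hab : a ≠ b := D.isCurveSystem.nondegenerate _ hI.mem
  let Q : Edge → Edge → Prop := fun e f => match τ with
    | .o => IsNew a b v e
    | .u => IsNew a b v f
  have key : ∀ e ∈ insertEdges D.edges a b v, ∀ f ∈ insertEdges D.edges a b v, e.Crosses f →
      ¬ (e ∈ D.edges ∧ f ∈ D.edges) → (IsNew a b v e ↔ ¬ IsNew a b v f) := by
    intro e he f hf hc hn
    constructor
    · rintro h1 h2
      obtain ⟨hne, z, hz, hz'⟩ := hc
      exact hI.new_new_disjoint hab h1 h2 hne hz hz'
    · intro h2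
      rcases mem_insertEdges'.1 he with ⟨he, -⟩ | he
      · rcases mem_insertEdges'.1 hf with ⟨hf, -⟩ | hf
        · exact (hn ⟨he, hf⟩).elim
        · exact (h2 hf).elim
      · exact he
  have hQ : ∀ e ∈ insertEdges D.edges a b v, ∀ f ∈ insertEdges D.edges a b v, e.Crosses f →
      ¬ (e ∈ D.edges ∧ f ∈ D.edges) → (Q e f ↔ ¬ Q f e) := by
    intro e he f hf hc hn
    cases τ
    · exact key e he f hf hc hn
    · have := key f hf e he hc.symm (fun h => hn ⟨h.2, h.1⟩)
      exact this
  let D' : MultiKnotoidDiagram :=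
    { edges := insertEdges D.edges a b v
      leg := D.leg
      head := D.head
      passesOver := insertOver D.edges a b v D.passesOver Q
      isCurveSystem := hI.isCurveSystem D.isCurveSystem hQ }
  have pure_new : ∀ e, IsNew a b v e → Pure D'.passesOver τ e := by
    intro e he
    cases τ
    · rintro f ⟨hf1, hf2, hc, ⟨-, h, -⟩ | ⟨h1, h2⟩⟩
      · exact hI.new_notMem he h
      · exact (key _ hf1 _ hf2 hc h1).1 h2 he
    · rintro f ⟨hf1, hf2, hc, ⟨h, -, -⟩ | ⟨h1, h2⟩⟩
      · exact hI.new_notMem he h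
      · exact (key _ hf1 _ hf2 hc h1).1 he h2
  have hrest : ∀ e ∈ D.edges, ∀ f ∈ D.edges, e ≠ (a, b) → f ≠ (a, b) →
        (D'.passesOver e f ↔ D.passesOver e f) := by
    intro e he f hf hea hfa
    constructor
    · rintro ⟨-, -, -, ⟨-, -, h⟩ | ⟨h, -⟩⟩
      · exact h
      · exact (h ⟨he, hf⟩).elim
    · intro h
      exact ⟨rest_mem_insertEdges he hea, rest_mem_insertEdges hf hfa,
        (D.isCurveSystem.passesOver_crosses _ _ h).2.2, Or.inl ⟨he, hf, h⟩⟩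
  refine ⟨D', Isotopic.of_delta ?_, rfl, rfl, rfl, hrest, pure_new _ (Or.inl rfl),
    pure_new _ (Or.inr rfl)⟩
  exact deltaMove_of_pure τ hI.mem rfl rfl rfl htri
    (fun e he f hf => hrest e he.1 f hf.1 he.2 hf.2) hp (pure_new _ (Or.inl rfl))
    (pure_new _ (Or.inr rfl))

end MultiKnotoidDiagram

theorem oseg_left_subset {a b c z : Pt} (hc : c ∈ openSegment ℝ a b)
    (hz : z ∈ openSegment ℝ a c) : z ∈ openSegment ℝ a b := by
  obtain ⟨s, h0, h1, e1, e2⟩ := mem_oseg_iff.1 hc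
  obtain ⟨r, g0, g1, f1, f2⟩ := mem_oseg_iff.1 hz
  exact mem_oseg_iff.2 ⟨r * s, by positivity, by nlinarith, by rw [f1, e1]; ring,
    by rw [f2, e2]; ring⟩

theorem oseg_right_subset {a b c z : Pt} (hc : c ∈ openSegment ℝ a b)
    (hz : z ∈ openSegment ℝ c b) : z ∈ openSegment ℝ a b := by
  rw [openSegment_symm] at hc hz ⊢
  exact oseg_left_subset hc hz

theorem seg_left_subset {a b c z : Pt} (hc : c ∈ segment ℝ a b)
    (hz : z ∈ segment ℝ a c) : z ∈ segment ℝ a b :=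
  (convex_segment a b).segment_subset (left_mem_segment ℝ a b) hc hz

theorem seg_right_subset {a b c z : Pt} (hc : c ∈ segment ℝ a b)
    (hz : z ∈ segment ℝ c b) : z ∈ segment ℝ a b :=
  (convex_segment a b).segment_subset hc (right_mem_segment ℝ a b) hz

theorem right_notMem_seg_left {a b c : Pt} (hab : a ≠ b) (hc : c ∈ openSegment ℝ a b) :
    b ∉ segment ℝ a c := by
  intro h
  obtain ⟨s, h0, h1, e1, e2⟩ := mem_oseg_iff.1 hc
  obtain ⟨r, g0, g1, f1, f2⟩ := mem_seg_iff.1 h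
  have hrs : 0 < 1 - r * s := by nlinarith
  apply hab
  have k1 : (1 - r * s) * (b.1 - a.1) = 0 := by rw [e1] at f1; linarith
  have k2 : (1 - r * s) * (b.2 - a.2) = 0 := by rw [e2] at f2; linarith
  ext
  · linarith [(mul_eq_zero.1 k1).resolve_left hrs.ne']
  · linarith [(mul_eq_zero.1 k2).resolve_left hrs.ne']

theorem left_notMem_seg_right {a b c : Pt} (hab : a ≠ b) (hc : c ∈ openSegment ℝ a b) :
    a ∉ segment ℝ c b := by
  rw [segment_symm]
  exact right_notMem_seg_left hab.symm (by rwa [openSegment_symm])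

namespace MultiKnotoidDiagram

variable {D : MultiKnotoidDiagram}

theorem insertable_of_cut {a b c : Pt} (hab : (a, b) ∈ D.edges) (hc : c ∈ openSegment ℝ a b)
    (hoff : c ∉ crossPts D.edges) : Insertable D.edges a b c := by
  have hD := D.isCurveSystem
  have hne : a ≠ b := hD.nondegenerate _ hab
  have hcs := oseg_subset_seg hc
  have hcne := oseg_ne hne hc
  refine ⟨hab, hcne.1, hcne.2, ?_, ?_, ?_, ?_, ?_⟩
  · intro f hf hfa hcf
    have h1 : c ≠ f.1 := by
      intro h
      have := hD.vertex_off_edge f hf (a, b) hab f.1 (Or.inl rfl) (h ▸ hcs)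
      rw [← h] at this; tauto
    have h2 : c ≠ f.2 := by
      intro h
      have := hD.vertex_off_edge f hf (a, b) hab f.2 (Or.inr rfl) (h ▸ hcs)
      rw [← h] at this; tauto
    exact hoff ⟨(a, b), hab, f, hf, hfa.symm, hc, mem_oseg_of_seg hcf h1 h2⟩
  · rintro s ⟨e, he, hs⟩ hsm
    rcases hD.vertex_off_edge e he (a, b) hab s hs (seg_left_subset hcs hsm) with h | h
    · exact h
    · exact (right_notMem_seg_left hne hc (by have h' : s = b := h; rwa [← h'])).elim
  · rintro s ⟨e, he, hs⟩ hsm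
    rcases hD.vertex_off_edge e he (a, b) hab s hs (seg_right_subset hcs hsm) with h | h
    · exact (left_notMem_seg_right hne hc (by have h' : s = a := h; rwa [← h'])).elim
    · exact h
  · intro f hf g hg hfa hga hfg z hz h1 h2
    have := hD.no_triple_point (a, b) hab f hf g hg hfa.symm hga.symm hfg
    exact Set.eq_empty_iff_forall_notMem.1 this z ⟨⟨oseg_left_subset hc hz, h1⟩, h2⟩
  · intro f hf g hg hfa hga hfg z hz h1 h2
    have := hD.no_triple_point (a, b) hab f hf g hg hfa.symm hga.symm hfg
    exact Set.eq_empty_iff_forall_notMem.1 this z ⟨⟨oseg_right_subset hc hz, h1⟩, h2⟩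

/-- `D'` arises from `D` by making the point `c` of the edge `(a, b)` a vertex. -/
structure IsCut (D D' : MultiKnotoidDiagram) (a b c : Pt) : Prop where
  mem : (a, b) ∈ D.edges
  inside : c ∈ openSegment ℝ a b
  off : c ∉ crossPts D.edges
  edges_eq : D'.edges = insertEdges D.edges a b c
  leg_eq : D'.leg = D.leg
  head_eq : D'.head = D.head
  rest : ∀ e ∈ D.edges, ∀ f ∈ D.edges, e ≠ (a, b) → f ≠ (a, b) →
    (D'.passesOver e f ↔ D.passesOver e f)
  new : ∀ τ e, IsNew a b c e → ∀ f, Side D'.passesOver τ e f →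
    f ∈ D.edges ∧ f ≠ (a, b) ∧ Side D.passesOver τ (a, b) f

theorem exists_isCut {a b c : Pt} (hab : (a, b) ∈ D.edges) (hc : c ∈ openSegment ℝ a b)
    (hoff : c ∉ crossPts D.edges) : ∃ D', IsCut D D' a b c := by
  classical
  have hI := insertable_of_cut hab hc hoff
  have hD := D.isCurveSystem
  have hne : a ≠ b := hD.nondegenerate _ hab
  let par : Edge → Edge := fun e => if IsNew a b c e then (a, b) else e
  let Q : Edge → Edge → Prop := fun e f => D.passesOver (par e) (par f)
  have par_new : ∀ e, IsNew a b c e → par e = (a, b) := fun e he => if_pos he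
  have par_old : ∀ e ∈ D.edges, par e = e := fun e he =>
    if_neg fun h => hI.new_notMem h he
  have sub : ∀ e, IsNew a b c e → ∀ z, z ∈ e.openSeg → z ∈ openSegment ℝ a b := by
    rintro e (rfl | rfl) z hz
    · exact oseg_left_subset hc hz
    · exact oseg_right_subset hc hz
  have key : ∀ e ∈ insertEdges D.edges a b c, ∀ f ∈ insertEdges D.edges a b c, e.Crosses f →
      ¬ (e ∈ D.edges ∧ f ∈ D.edges) →
      (IsNew a b c e ∧ f ∈ D.edges ∧ f ≠ (a, b)) ∨ (IsNew a b c f ∧ e ∈ D.edges ∧ e ≠ (a, b)) := by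
    intro e he f hf hc hn
    rcases mem_insertEdges'.1 he with ⟨he, hea⟩ | he <;>
      rcases mem_insertEdges'.1 hf with ⟨hf, hfa⟩ | hf
    · exact (hn ⟨he, hf⟩).elim
    · exact Or.inr ⟨hf, he, hea⟩
    · exact Or.inl ⟨he, hf, hfa⟩
    · obtain ⟨hef, z, hz, hz'⟩ := hc
      exact (hI.new_new_disjoint hne he hf hef hz hz').elim
  have hQ : ∀ e ∈ insertEdges D.edges a b c, ∀ f ∈ insertEdges D.edges a b c, e.Crosses f →
      ¬ (e ∈ D.edges ∧ f ∈ D.edges) → (Q e f ↔ ¬ Q f e) := by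
    intro e he f hf hcr hn
    obtain ⟨-, z, hz, hz'⟩ := id hcr
    rcases key e he f hf hcr hn with ⟨h1, h2, h3⟩ | ⟨h1, h2, h3⟩
    · simp only [Q, par_new e h1, par_old f h2]
      exact hD.passesOver_iff_not _ hab f h2 ⟨h3.symm, z, sub e h1 z hz, hz'⟩
    · simp only [Q, par_new f h1, par_old e h2]
      exact hD.passesOver_iff_not e h2 _ hab ⟨h3, z, hz, sub f h1 z hz'⟩
  let D' : MultiKnotoidDiagram :=
    { edges := insertEdges D.edges a b c
      leg := D.leg
      head := D.head
      passesOver := insertOver D.edges a b c D.passesOver Q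
      isCurveSystem := hI.isCurveSystem D.isCurveSystem hQ }
  refine ⟨D', hab, hc, hoff, rfl, rfl, rfl, ?_, ?_⟩
  · intro e he f hf hea hfa
    constructor
    · rintro ⟨-, -, -, ⟨-, -, h⟩ | ⟨h, -⟩⟩
      · exact h
      · exact (h ⟨he, hf⟩).elim
    · intro h
      exact ⟨rest_mem_insertEdges he hea, rest_mem_insertEdges hf hfa,
        (D.isCurveSystem.passesOver_crosses _ _ h).2.2, Or.inl ⟨he, hf, h⟩⟩
  · intro τ e he f h
    cases τ
    · obtain ⟨h1, h2, h3, ⟨h4, -⟩ | ⟨h4, h5⟩⟩ := h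
      · exact (hI.new_notMem he h4).elim
      · rcases key _ h1 _ h2 h3 h4 with ⟨-, g2, g3⟩ | ⟨-, g2, -⟩
        · refine ⟨g2, g3, ?_⟩
          simp only [Q, par_new e he, par_old f g2] at h5
          exact h5
        · exact (hI.new_notMem he g2).elim
    · obtain ⟨h1, h2, h3, ⟨-, h4, -⟩ | ⟨h4, h5⟩⟩ := h
      · exact (hI.new_notMem he h4).elim
      · rcases key _ h1 _ h2 h3 h4 with ⟨-, g2, -⟩ | ⟨-, g2, g3⟩
        · exact (hI.new_notMem he g2).elim
        · refine ⟨g2, g3, ?_⟩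
          simp only [Q, par_new e he, par_old f g2] at h5
          exact h5

/-- The crossing points of the edge `e` at which it is on the side `τ`. -/
def sidePts (D : MultiKnotoidDiagram) (τ : Label) (e : Edge) : Set Pt :=
  {z | ∃ f, Side D.passesOver τ e f ∧ z ∈ e.openSeg ∧ z ∈ f.openSeg}

theorem side_mem {τ : Label} {e f : Edge} (h : Side D.passesOver τ e f) :
    e ∈ D.edges ∧ f ∈ D.edges ∧ e.Crosses f := by
  have hc := D.isCurveSystem
  cases τ
  · exact hc.passesOver_crosses _ _ h
  · obtain ⟨h1, h2, h3⟩ := hc.passesOver_crosses _ _ h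
    exact ⟨h2, h1, h3.symm⟩

theorem side_or {τ : Label} {e f : Edge} (he : e ∈ D.edges) (hf : f ∈ D.edges)
    (h : e.Crosses f) : Side D.passesOver τ e f ∨ Side D.passesOver τ.flip e f := by
  have := D.isCurveSystem.passesOver_iff_not e he f hf h
  cases τ <;> simp only [Side, Label.flip] <;> tauto

theorem not_side_and {τ : Label} {e f : Edge} (h : Side D.passesOver τ e f) :
    ¬ Side D.passesOver τ.flip e f := by
  obtain ⟨he, hf, hc⟩ := side_mem h
  have := D.isCurveSystem.passesOver_iff_not e he f hf hc
  cases τ <;> simp only [Side, Label.flip] at h ⊢ <;> tauto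

theorem side_comm {R : Edge → Edge → Prop} {τ : Label} {e f : Edge} :
    Side R τ e f ↔ Side R τ.flip f e := by cases τ <;> exact Iff.rfl

theorem pure_iff_side {R : Edge → Edge → Prop} {τ : Label} {e : Edge} :
    Pure R τ e ↔ ∀ f, ¬ Side R τ.flip e f := by
  cases τ <;> exact Iff.rfl

theorem pure_iff_sidePts {τ : Label} {e : Edge} :
    Pure D.passesOver τ e ↔ D.sidePts τ.flip e = ∅ := by
  rw [pure_iff_side, Set.eq_empty_iff_forall_notMem]
  constructor
  · rintro h z ⟨f, hf, -⟩
    exact h f hf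
  · intro h f hf
    obtain ⟨-, z, hz⟩ := (side_mem hf).2.2
    exact h z ⟨f, hf, hz⟩

theorem sidePts_subset_crossPts {τ : Label} {e : Edge} : D.sidePts τ e ⊆ crossPts D.edges := by
  rintro z ⟨f, hf, hz⟩
  obtain ⟨h1, h2, h3⟩ := side_mem hf
  exact ⟨e, h1, f, h2, h3.1, hz⟩

namespace IsCut

variable {D' : MultiKnotoidDiagram} {a b c : Pt}

theorem insertable (h : IsCut D D' a b c) : Insertable D.edges a b c :=
  insertable_of_cut h.mem h.inside h.off

theorem subdivision (h : IsCut D D' a b c) : Subdivision D D' := by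
  refine ⟨a, b, c, h.mem, h.inside, h.edges_eq, h.leg_eq, h.head_eq,
    fun e he f hf => h.rest e he.1 f hf.1 he.2 hf.2, fun e he f hf => ⟨?_, ?_⟩⟩
  · exact fun h' => (h.new .o e he f h').2.2
  · exact fun h' => (h.new .u e he f h').2.2

theorem isotopic (h : IsCut D D' a b c) : Isotopic D D' :=
  Relation.EqvGen.rel _ _ (Or.inl h.subdivision)

theorem openSeg_subset (h : IsCut D D' a b c) {e : Edge} (he : IsNew a b c e) {z : Pt}
    (hz : z ∈ e.openSeg) : z ∈ openSegment ℝ a b := by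
  rcases he with rfl | rfl
  · exact oseg_left_subset h.inside hz
  · exact oseg_right_subset h.inside hz

/-- Every edge of the subdivided diagram lies on an edge of the original one. -/
theorem exists_parent (h : IsCut D D' a b c) {e : Edge} (he : e ∈ D'.edges) :
    ∃ e₀ ∈ D.edges, (∀ z ∈ e.openSeg, z ∈ e₀.openSeg) ∧ (e = e₀ ∧ e ≠ (a, b) ∨
      e₀ = (a, b) ∧ IsNew a b c e) := by
  rw [h.edges_eq] at he
  rcases mem_insertEdges'.1 he with ⟨he, hea⟩ | he
  · exact ⟨e, he, fun z hz => hz, Or.inl ⟨rfl, hea⟩⟩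
  · exact ⟨(a, b), h.mem, fun z hz => h.openSeg_subset he hz, Or.inr ⟨rfl, he⟩⟩

theorem crossPts_subset (h : IsCut D D' a b c) : crossPts D'.edges ⊆ crossPts D.edges := by
  have hne : a ≠ b := D.isCurveSystem.nondegenerate _ h.mem
  rintro z ⟨e, he, f, hf, hef, hz, hz'⟩
  obtain ⟨e₀, he₀, he₁, he₂⟩ := h.exists_parent he
  obtain ⟨f₀, hf₀, hf₁, hf₂⟩ := h.exists_parent hf
  refine ⟨e₀, he₀, f₀, hf₀, ?_, he₁ z hz, hf₁ z hz'⟩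
  rintro rfl
  rcases he₂ with ⟨rfl, h1⟩ | ⟨rfl, h1⟩ <;> rcases hf₂ with ⟨rfl, h2⟩ | ⟨h3, h2⟩
  · exact hef rfl
  · exact h1 h3
  · exact h2 rfl
  · exact h.insertable.new_new_disjoint hne h1 h2 hef hz hz'

theorem sidePts_new (h : IsCut D D' a b c) {e : Edge} (he : IsNew a b c e) (τ : Label) :
    D'.sidePts τ e ⊆ D.sidePts τ (a, b) := by
  rintro z ⟨f, hf, hz, hz'⟩
  exact ⟨f, (h.new τ e he f hf).2.2, h.openSeg_subset he hz, hz'⟩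

theorem sidePts_old (h : IsCut D D' a b c) {e : Edge} (he : e ∈ D.edges) (hea : e ≠ (a, b))
    (τ : Label) : D'.sidePts τ e ⊆ D.sidePts τ e := by
  rintro z ⟨f, hf, hz, hz'⟩
  obtain ⟨-, hfE, -⟩ := side_mem hf
  obtain ⟨f₀, hf₀, hf₁, ⟨rfl, h1⟩ | ⟨rfl, h1⟩⟩ := h.exists_parent hfE
  · refine ⟨f, ?_, hz, hz'⟩
    cases τ
    · exact (h.rest e he f hf₀ hea h1).1 hf
    · exact (h.rest f hf₀ e he h1 hea).1 hf
  · have h2 := (h.new τ.flip f h1 e (side_comm.1 hf)).2.2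
    exact ⟨(a, b), side_comm.2 h2, hz, hf₁ z hz'⟩

end IsCut

end MultiKnotoidDiagram

/-! ### Generic points -/

/-- A point off all lines through two different points of `X`. -/
def Generic (X : Set Pt) (v : Pt) : Prop := ∀ x ∈ X, ∀ y ∈ X, x ≠ y → cr (y - x) (v - x) ≠ 0

theorem dense_off_line {x y : Pt} (hxy : x ≠ y) : Dense {v : Pt | cr (y - x) (v - x) ≠ 0} := by
  rw [Metric.dense_iff]
  intro p r hr
  by_cases h : cr (y - x) (p - x) = 0
  · set n : Pt := (-(y.2 - x.2), y.1 - x.1) with hn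
    obtain ⟨k, hk0, hk⟩ : ∃ k : ℝ, 0 < k ∧ ‖k • n‖ < r := by
      refine ⟨r / (2 * (‖n‖ + 1)), by positivity, ?_⟩
      rw [norm_smul, Real.norm_of_nonneg (by positivity)]
      rw [div_mul_eq_mul_div, div_lt_iff₀ (by positivity)]
      nlinarith [norm_nonneg n]
    refine ⟨p + k • n, by simpa [Metric.mem_ball, dist_eq_norm] using hk, ?_⟩
    have e : cr (y - x) (p + k • n - x)
        = cr (y - x) (p - x) + k * ((y.1 - x.1) ^ 2 + (y.2 - x.2) ^ 2) := by
      simp [cr, hn]; ring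
    show cr (y - x) (p + k • n - x) ≠ 0
    rw [e, h, zero_add]
    have : 0 < (y.1 - x.1) ^ 2 + (y.2 - x.2) ^ 2 := by
      by_cases h1 : y.1 - x.1 = 0
      · have h2 : y.2 - x.2 ≠ 0 := by intro h2; apply hxy; ext <;> linarith
        positivity
      · positivity
    positivity
  · exact ⟨p, Metric.mem_ball_self hr, h⟩

/-- Finitely many lines do not cover a nonempty open set. -/
theorem exists_off_lines {L : Set (Pt × Pt)} (hL : L.Finite) {O : Set Pt} (hO : IsOpen O)
    (hne : O.Nonempty) : ∃ v ∈ O, ∀ l ∈ L, l.1 ≠ l.2 → cr (l.2 - l.1) (v - l.1) ≠ 0 := by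
  have hd : Dense (⋂ l ∈ L, {v : Pt | l.1 ≠ l.2 → cr (l.2 - l.1) (v - l.1) ≠ 0}) := by
    apply dense_biInter_of_isOpen
    · intro l _
      by_cases h : l.1 = l.2
      · simp [h]
      · simp only [ne_eq, h, not_false_eq_true, forall_const]
        apply isOpen_ne_fun
        · unfold cr; fun_prop
        · fun_prop
    · exact hL.countable
    · intro l _
      by_cases h : l.1 = l.2
      · simp [h]
      · simpa [h] using dense_off_line h
  obtain ⟨v, hv, hv'⟩ := hd.inter_open_nonempty O hO hne
  refine ⟨v, hv, fun l hl => ?_⟩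
  simp only [Set.mem_iInter] at hv'
  exact hv' l hl

theorem exists_generic {X : Set Pt} (hX : X.Finite) {O : Set Pt} (hO : IsOpen O)
    (hne : O.Nonempty) : ∃ v ∈ O, Generic X v := by
  obtain ⟨v, hv, h⟩ := exists_off_lines (hX.prod hX) hO hne
  exact ⟨v, hv, fun x hx y hy hxy => h (x, y) ⟨hx, hy⟩ hxy⟩

/-- A generic point avoids segments between points of `X`. -/
theorem Generic.notMem_seg {X : Set Pt} {v x y : Pt} (h : Generic X v) (hx : x ∈ X) (hy : y ∈ X)
    (hxy : x ≠ y) : v ∉ segment ℝ x y :=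
  fun hm => h x hx y hy hxy (cr_eq_zero_of_mem_seg hm)

/-- A segment from a point `x` of `X` to a generic point contains no other point of `X`. -/
theorem Generic.eq_of_mem_seg {X : Set Pt} {v x z : Pt} (h : Generic X v) (hx : x ∈ X)
    (hz : z ∈ X) (hm : z ∈ segment ℝ x v) : z = x := by
  by_contra hne
  exact h x hx z hz (Ne.symm hne) (cr_eq_zero_of_mem_seg' hm)

theorem MultiKnotoidDiagram.insertable_of_generic {D : MultiKnotoidDiagram} {a b v : Pt}
    {X : Set Pt} (hab : (a, b) ∈ D.edges) (hX : verts D.edges ⊆ X) (hX' : crossPts D.edges ⊆ X)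
    (hv : Generic X v) : Insertable D.edges a b v := by
  have hD := D.isCurveSystem
  have hne : a ≠ b := hD.nondegenerate _ hab
  have ha := hX (fst_mem_verts hab)
  have hb := hX (snd_mem_verts hab)
  refine ⟨hab, ?_, ?_, ?_, ?_, ?_, ?_, ?_⟩
  · rintro rfl
    exact hv.notMem_seg ha hb hne (left_mem_segment ℝ _ _)
  · rintro rfl
    exact hv.notMem_seg ha hb hne (right_mem_segment ℝ _ _)
  · intro f hf _ hm
    exact hv.notMem_seg (hX (fst_mem_verts hf)) (hX (snd_mem_verts hf)) (hD.nondegenerate f hf) hm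
  · intro s hs hm
    exact hv.eq_of_mem_seg ha (hX hs) hm
  · intro s hs hm
    rw [segment_symm] at hm
    exact hv.eq_of_mem_seg hb (hX hs) hm
  · intro f hf g hg _ _ hfg z hz h1 h2
    have hzX := hX' ⟨f, hf, g, hg, hfg, h1, h2⟩
    have := hv.eq_of_mem_seg ha hzX (oseg_subset_seg hz)
    subst this
    have := hD.vertex_off_edge _ hab f hf z (Or.inl rfl) (oseg_subset_seg h1)
    have := oseg_ne (hD.nondegenerate f hf) h1
    tauto
  · intro f hf g hg _ _ hfg z hz h1 h2
    have hzX := hX' ⟨f, hf, g, hg, hfg, h1, h2⟩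
    rw [openSegment_symm] at hz
    have := hv.eq_of_mem_seg hb hzX (oseg_subset_seg hz)
    subst this
    have := hD.vertex_off_edge _ hab f hf z (Or.inr rfl) (oseg_subset_seg h1)
    have := oseg_ne (hD.nondegenerate f hf) h1
    tauto

end PLKnotoid

namespace PLKnotoid

/-! ### Fine subdivisions -/

namespace MultiKnotoidDiagram

variable {D : MultiKnotoidDiagram}

/-- One subdivision step. -/
def Cut (D D' : MultiKnotoidDiagram) : Prop := ∃ a b c, IsCut D D' a b c

/-- `D'` arises from `D` by finitely many subdivisions. -/
def Refines (D D' : MultiKnotoidDiagram) : Prop := Relation.ReflTransGen Cut D D'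

theorem Refines.isotopic {D' : MultiKnotoidDiagram} (h : Refines D D') : Isotopic D D' := by
  induction h with
  | refl => exact Isotopic.refl D
  | tail _ h ih =>
    obtain ⟨a, b, c, h⟩ := h
    exact ih.trans h.isotopic

theorem Refines.leg_eq {D' : MultiKnotoidDiagram} (h : Refines D D') : D'.leg = D.leg := by
  induction h with
  | refl => rfl
  | tail _ h ih =>
    obtain ⟨a, b, c, h⟩ := h
    exact h.leg_eq.trans ih

theorem Refines.head_eq {D' : MultiKnotoidDiagram} (h : Refines D D') : D'.head = D.head := by
  induction h with
  | refl => rfl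
  | tail _ h ih =>
    obtain ⟨a, b, c, h⟩ := h
    exact h.head_eq.trans ih

theorem Refines.crossPts_subset {D' : MultiKnotoidDiagram} (h : Refines D D') :
    crossPts D'.edges ⊆ crossPts D.edges := by
  induction h with
  | refl => exact subset_rfl
  | tail _ h ih =>
    obtain ⟨a, b, c, h⟩ := h
    exact h.crossPts_subset.trans ih

/-- `D'` arises from `D` by subdividing the edge `(a, b)` into the edges `G`, which are shorter than
`r` and whose new ends avoid `A`. -/
structure EdgeMesh (D D' : MultiKnotoidDiagram) (a b : Pt) (A : Set Pt) (r : ℝ) (G : Set Edge) :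
    Prop where
  refines : Refines D D'
  edges_eq : D'.edges = (D.edges \ {(a, b)}) ∪ G
  direction : ∀ g ∈ G, ∃ k : ℝ, 0 < k ∧ g.2 - g.1 = k • (b - a)
  closed_sub : ∀ g ∈ G, g.closedSeg ⊆ segment ℝ a b
  open_sub : ∀ g ∈ G, g.openSeg ⊆ openSegment ℝ a b
  sep : ∀ g ∈ G, ∀ g' ∈ G, g ≠ g' → ∀ z ∈ g.openSeg, z ∉ g'.closedSeg
  short : ∀ g ∈ G, dist g.1 g.2 < r
  ends : ∀ g ∈ G, ∀ p, (p = g.1 ∨ p = g.2) → p = a ∨ p = b ∨ p ∉ A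
  side_new : ∀ τ, ∀ g ∈ G, D'.sidePts τ g ⊆ D.sidePts τ (a, b)
  side_old : ∀ τ, ∀ f ∈ D.edges, f ≠ (a, b) → D'.sidePts τ f ⊆ D.sidePts τ f

theorem exists_edgeMesh_aux {A : Set Pt} (hA : A.Finite) {r : ℝ} (n : ℕ) :
    ∀ (D : MultiKnotoidDiagram) (a b : Pt), (a, b) ∈ D.edges → crossPts D.edges ⊆ A →
      dist a b < r * (3 / 2) ^ n → ∃ D' G, EdgeMesh D D' a b A r G := by
  induction n with
  | zero =>
    intro D a b hab hcA hr
    refine ⟨D, {(a, b)}, Relation.ReflTransGen.refl, ?_, ?_, ?_, ?_, ?_, ?_, ?_, ?_, ?_⟩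
    · rw [Set.sdiff_union_self, Set.union_eq_self_of_subset_right]
      simpa using hab
    · rintro g rfl; exact ⟨1, one_pos, by simp⟩
    · rintro g rfl; exact subset_rfl
    · rintro g rfl; exact subset_rfl
    · rintro g rfl g' rfl h; exact (h rfl).elim
    · rintro g rfl; simpa using hr
    · rintro g rfl p hp; tauto
    · rintro τ g rfl; exact subset_rfl
    · intro τ f _ _; exact subset_rfl
  | succ n ih =>
    intro D a b hab hcA hr
    have hne : a ≠ b := D.isCurveSystem.nondegenerate _ hab
    obtain ⟨s, hs0, hs1, hsA⟩ : ∃ s : ℝ, 1 / 3 < s ∧ s < 2 / 3 ∧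
        AffineMap.lineMap a b s ∉ A := by
      have hinj : Function.Injective (AffineMap.lineMap a b : ℝ → Pt) :=
        AffineMap.lineMap_injective ℝ hne
      have hfin : ((AffineMap.lineMap a b : ℝ → Pt) ⁻¹' A).Finite := hA.preimage hinj.injOn
      have hinf : (Set.Ioo (1 / 3 : ℝ) (2 / 3)).Infinite := Set.Ioo_infinite (by norm_num)
      obtain ⟨s, hs, hs'⟩ := (hinf.sdiff hfin).nonempty
      exact ⟨s, hs.1, hs.2, hs'⟩
    set c : Pt := AffineMap.lineMap a b s with hc
    have hcm : c ∈ openSegment ℝ a b := by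
      rw [openSegment_eq_image_lineMap]
      exact ⟨s, ⟨by linarith, by linarith⟩, rfl⟩
    have hac : a ≠ c := (oseg_ne hne hcm).1.symm
    have hcb : c ≠ b := (oseg_ne hne hcm).2
    obtain ⟨D₁, h₁⟩ := exists_isCut hab hcm (fun h => hsA (hcA h))
    have hI := h₁.insertable
    have k1 : (a, c) ∈ D₁.edges := by rw [h₁.edges_eq]; exact left_mem_insertEdges
    have hpow : r * (3 / 2) ^ (n + 1) = r * (3 / 2) ^ n * (3 / 2) := by ring
    have d1 : dist a c < r * (3 / 2) ^ n := by
      rw [hc, dist_left_lineMap, Real.norm_of_nonneg (by linarith)]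
      nlinarith [dist_nonneg (x := a) (y := b)]
    have d2 : dist c b < r * (3 / 2) ^ n := by
      rw [hc, dist_lineMap_right, Real.norm_of_nonneg (by linarith)]
      nlinarith [dist_nonneg (x := a) (y := b)]
    obtain ⟨D₂, G₁, m₁⟩ := ih D₁ a c k1 (h₁.crossPts_subset.trans hcA) d1
    have k2 : (c, b) ∈ D₂.edges := by
      rw [m₁.edges_eq, h₁.edges_eq]
      refine Or.inl ⟨right_mem_insertEdges, ?_⟩
      intro h
      exact hac (congrArg Prod.fst h).symm
    obtain ⟨D₃, G₂, m₂⟩ := ih D₂ c b k2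
      ((m₁.refines.crossPts_subset.trans h₁.crossPts_subset).trans hcA) d2
    have hcs := oseg_subset_seg hcm
    have g1cb : ∀ g ∈ G₁, g ≠ (c, b) := by
      rintro g hg rfl
      exact right_notMem_seg_left hne hcm (m₁.closed_sub _ hg (right_mem_segment ℝ _ _))
    have inter : ∀ z, z ∈ segment ℝ a c → z ∈ segment ℝ c b → z = c := by
      intro z hz hz'
      refine seg_inter_of_common_end (p := a) (q := b) (left_notMem_seg_right hne hcm) ?_ ?_ hz'
      · rw [segment_symm]; exact right_notMem_seg_left hne hcm
      · rwa [segment_symm]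
    have dir1 : c - a = s • (b - a) := by
      rw [hc, AffineMap.lineMap_apply]; simp
    have dir2 : b - c = (1 - s) • (b - a) := by
      rw [hc, AffineMap.lineMap_apply, sub_smul, one_smul]; simp; abel
    have newL : IsNew a b c (a, c) := Or.inl rfl
    have newR : IsNew a b c (c, b) := Or.inr rfl
    have hcb_ne : ((c, b) : Edge) ≠ (a, c) := fun h => hac (congrArg Prod.fst h).symm
    have k3 : (c, b) ∈ D₁.edges := by rw [h₁.edges_eq]; exact right_mem_insertEdges
    refine ⟨D₃, G₁ ∪ G₂, ?_, ?_, ?_, ?_, ?_, ?_, ?_, ?_, ?_, ?_⟩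
    · exact ((Relation.ReflTransGen.single ⟨a, b, c, h₁⟩).trans m₁.refines).trans m₂.refines
    · rw [m₂.edges_eq, m₁.edges_eq, h₁.edges_eq, ← Set.union_assoc]
      congr 1
      ext e
      simp only [Set.mem_sdiff, Set.mem_union, Set.mem_singleton_iff, mem_insertEdges]
      constructor
      · rintro ⟨⟨h1, h3⟩ | h1, h4⟩
        · rcases h1 with h1 | h1 | h1
          · exact Or.inl h1
          · exact (h3 h1).elim
          · exact (h4 h1).elim
        · exact Or.inr h1
      · rintro (⟨h1, h2⟩ | h1)
        · refine ⟨Or.inl ⟨Or.inl ⟨h1, h2⟩, ?_⟩, ?_⟩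
          · rintro rfl; exact hI.left_notMem h1
          · rintro rfl; exact hI.right_notMem h1
        · exact ⟨Or.inr h1, g1cb e h1⟩
    · rintro g (hg | hg)
      · obtain ⟨k, hk, e⟩ := m₁.direction g hg
        exact ⟨k * s, by positivity, by rw [e, dir1, smul_smul]⟩
      · obtain ⟨k, hk, e⟩ := m₂.direction g hg
        exact ⟨k * (1 - s), mul_pos hk (by linarith), by rw [e, dir2, smul_smul]⟩
    · rintro g (hg | hg) z hz
      · exact seg_left_subset hcs (m₁.closed_sub g hg hz)
      · exact seg_right_subset hcs (m₂.closed_sub g hg hz)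
    · rintro g (hg | hg) z hz
      · exact oseg_left_subset hcm (m₁.open_sub g hg hz)
      · exact oseg_right_subset hcm (m₂.open_sub g hg hz)
    · rintro g (hg | hg) g' (hg' | hg') hgg z hz hz'
      · exact m₁.sep g hg g' hg' hgg z hz hz'
      · have h1 := m₁.open_sub g hg hz
        exact (oseg_ne hac h1).2 (inter z (oseg_subset_seg h1) (m₂.closed_sub g' hg' hz'))
      · have h1 := m₂.open_sub g hg hz
        exact (oseg_ne hcb h1).1 (inter z (m₁.closed_sub g' hg' hz') (oseg_subset_seg h1))
      · exact m₂.sep g hg g' hg' hgg z hz hz'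
    · rintro g (hg | hg)
      · exact m₁.short g hg
      · exact m₂.short g hg
    · rintro g (hg | hg) p hp
      · rcases m₁.ends g hg p hp with h | h | h
        · exact Or.inl h
        · exact Or.inr (Or.inr (h ▸ hsA))
        · exact Or.inr (Or.inr h)
      · rcases m₂.ends g hg p hp with h | h | h
        · exact Or.inr (Or.inr (h ▸ hsA))
        · exact Or.inr (Or.inl h)
        · exact Or.inr (Or.inr h)
    · rintro τ g (hg | hg)
      · have hgD₂ : g ∈ D₂.edges := by rw [m₁.edges_eq]; exact Or.inr hg
        exact ((m₂.side_old τ g hgD₂ (g1cb g hg)).trans (m₁.side_new τ g hg)).trans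
          (h₁.sidePts_new newL τ)
      · exact ((m₂.side_new τ g hg).trans (m₁.side_old τ _ k3 hcb_ne)).trans
          (h₁.sidePts_new newR τ)
    · intro τ f hf hfa
      have hf1 : f ∈ D₁.edges := by rw [h₁.edges_eq]; exact rest_mem_insertEdges hf hfa
      have hfac : f ≠ (a, c) := by rintro rfl; exact hI.left_notMem hf
      have hfcb : f ≠ (c, b) := by rintro rfl; exact hI.right_notMem hf
      have hf2 : f ∈ D₂.edges := by rw [m₁.edges_eq]; exact Or.inl ⟨hf1, hfac⟩
      exact ((m₂.side_old τ f hf2 hfcb).trans (m₁.side_old τ f hf1 hfac)).trans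
        (h₁.sidePts_old hf hfa τ)

theorem exists_edgeMesh {a b : Pt} (hab : (a, b) ∈ D.edges) {A : Set Pt} (hA : A.Finite)
    (hcA : crossPts D.edges ⊆ A) {r : ℝ} (hr : 0 < r) : ∃ D' G, EdgeMesh D D' a b A r G := by
  obtain ⟨n, hn⟩ := pow_unbounded_of_one_lt (dist a b / r) (by norm_num : (1 : ℝ) < 3 / 2)
  refine exists_edgeMesh_aux hA n D a b hab hcA ?_
  rw [div_lt_iff₀ hr] at hn
  linarith

/-- Every diagram can be subdivided into edges shorter than `r`. -/
theorem exists_mesh (D : MultiKnotoidDiagram) {r : ℝ} (hr : 0 < r) :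
    ∃ D', Refines D D' ∧ ∀ e ∈ D'.edges, dist e.1 e.2 < r := by
  induction hn : {e ∈ D.edges | r ≤ dist e.1 e.2}.ncard using Nat.strong_induction_on
    generalizing D with
  | _ n ih =>
    by_cases h : ∀ e ∈ D.edges, dist e.1 e.2 < r
    · exact ⟨D, Relation.ReflTransGen.refl, h⟩
    · push Not at h
      obtain ⟨⟨a, b⟩, he, hlong⟩ := h
      obtain ⟨D₁, G, m⟩ := exists_edgeMesh he D.isCurveSystem.crossPts_finite subset_rfl hr
      have hlt : {e ∈ D₁.edges | r ≤ dist e.1 e.2}.ncard < n := by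
        rw [← hn]
        apply Set.ncard_lt_ncard
        · refine ⟨?_, ?_⟩
          · rintro e ⟨he, hr'⟩
            rw [m.edges_eq] at he
            rcases he with he | he
            · exact ⟨he.1, hr'⟩
            · exact (not_lt.2 hr' (m.short e he)).elim
          · intro hsub
            have := (hsub ⟨he, hlong⟩).1
            rw [m.edges_eq] at this
            rcases this with h | h
            · exact h.2 rfl
            · exact not_lt.2 hlong (m.short _ h)
        · exact D.isCurveSystem.finite.subset fun e he => he.1
      obtain ⟨D₂, h₂, h₂'⟩ := ih _ hlt D₁ rfl
      exact ⟨D₂, m.refines.trans h₂, h₂'⟩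

/-- Edges with crossings are isolated along the curves: of two consecutive edges one can be called
over and the other one under, and the edges at the endpoints have no crossings. -/
structure Fine (D : MultiKnotoidDiagram) : Prop where
  consecutive : ∀ e ∈ D.edges, ∀ f ∈ D.edges, e.2 = f.1 →
    ∃ σ, Pure D.passesOver σ e ∧ Pure D.passesOver σ.flip f
  leg : ∀ e ∈ D.edges, e.1 = D.leg → ∀ f ∈ D.edges, ¬ e.Crosses f
  head : ∀ e ∈ D.edges, e.2 = D.head → ∀ f ∈ D.edges, ¬ e.Crosses f

/-- The points of a finite set are more than some `r > 0` apart. -/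
theorem exists_separation {X : Set Pt} (hX : X.Finite) :
    ∃ r > 0, ∀ x ∈ X, ∀ y ∈ X, dist x y < r → x = y := by
  have hf : ((fun q : Pt × Pt => dist q.1 q.2) '' ((X ×ˢ X) ∩ {q | q.1 ≠ q.2})).Finite :=
    ((hX.prod hX).inter_of_left _).image _
  have h0 : ∀ d ∈ ((fun q : Pt × Pt => dist q.1 q.2) '' ((X ×ˢ X) ∩ {q | q.1 ≠ q.2})), 0 < d := by
    rintro d ⟨q, ⟨-, hq⟩, rfl⟩
    exact dist_pos.2 hq
  have : ∀ᶠ r in 𝓝[>] (0 : ℝ),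
      ∀ d ∈ ((fun q : Pt × Pt => dist q.1 q.2) '' ((X ×ˢ X) ∩ {q | q.1 ≠ q.2})), r < d := by
    rw [Set.Finite.eventually_all hf]
    intro d hd
    exact nhdsWithin_le_nhds (eventually_lt_nhds (h0 d hd))
  obtain ⟨r, hr, hr'⟩ := (this.and self_mem_nhdsWithin).exists
  refine ⟨r, hr', fun x hx y hy hxy => ?_⟩
  by_contra hne
  exact absurd (hr _ ⟨(x, y), ⟨⟨hx, hy⟩, hne⟩, rfl⟩) (not_lt.2 hxy.le)

theorem dist_le_of_mem_seg {a b z : Pt} (h : z ∈ segment ℝ a b) :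
    dist a z ≤ dist a b ∧ dist z b ≤ dist a b := by
  rw [segment_eq_image_lineMap] at h
  obtain ⟨s, ⟨h0, h1⟩, rfl⟩ := h
  rw [dist_left_lineMap, dist_lineMap_right, Real.norm_of_nonneg h0,
    Real.norm_of_nonneg (by linarith)]
  constructor <;> nlinarith [dist_nonneg (x := a) (y := b)]

/-- A diagram has a fine subdivision: it suffices to make the edges short in comparison with the
distances between crossing points and endpoints, a set which subdivisions do not enlarge. -/
theorem exists_fine (D : MultiKnotoidDiagram) : ∃ D', Refines D D' ∧ Fine D' := by
  have hX : (crossPts D.edges ∪ {D.leg, D.head}).Finite :=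
    D.isCurveSystem.crossPts_finite.union (Set.toFinite _)
  obtain ⟨r, hr, hsep⟩ := exists_separation hX
  obtain ⟨D', href, hshort⟩ := exists_mesh D (half_pos hr)
  have hD' := D'.isCurveSystem
  have hcp : ∀ z ∈ crossPts D'.edges, z ∈ crossPts D.edges ∪ {D.leg, D.head} :=
    fun z hz => Or.inl (href.crossPts_subset hz)
  have key : ∀ e ∈ D'.edges, (∃ f ∈ D'.edges, e.Crosses f) →
      ∃ σ, Pure D'.passesOver σ e := by
    rintro e he ⟨f, hf, hef⟩
    have huniq : ∀ g ∈ D'.edges, e.Crosses g → g = f := by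
      rintro g hg ⟨heg, z, hz, hz'⟩
      obtain ⟨hne, w, hw, hw'⟩ := hef
      have hzw : z = w := by
        apply hsep z (hcp z ⟨e, he, g, hg, heg, hz, hz'⟩) w (hcp w ⟨e, he, f, hf, hne, hw, hw'⟩)
        have h1 := dist_le_of_mem_seg (oseg_subset_seg hz)
        have h2 := dist_le_of_mem_seg (oseg_subset_seg hw)
        have := dist_triangle_left z w e.1
        linarith [hshort e he]
      subst hzw
      by_contra hgf
      exact Set.eq_empty_iff_forall_notMem.1
        (hD'.no_triple_point e he g hg f hf heg hne hgf) z ⟨⟨hz, hz'⟩, hw'⟩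
    rcases side_or (D := D') (τ := .o) he hf hef with h | h
    · exact ⟨.o, (pure_iff he).2 fun g hg hc => by rw [huniq g hg hc]; exact h⟩
    · exact ⟨.u, (pure_iff he).2 fun g hg hc => by rw [huniq g hg hc]; exact h⟩
  refine ⟨D', href, ?_, ?_, ?_⟩
  · intro e he f hf hef
    by_cases h1 : ∃ g ∈ D'.edges, e.Crosses g
    · by_cases h2 : ∃ g ∈ D'.edges, f.Crosses g
      · exfalso
        obtain ⟨g, hg, heg, z, hz, hz'⟩ := h1
        obtain ⟨k, hk, hfk, w, hw, hw'⟩ := h2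
        have hzw : z = w := by
          apply hsep z (hcp z ⟨e, he, g, hg, heg, hz, hz'⟩) w (hcp w ⟨f, hf, k, hk, hfk, hw, hw'⟩)
          have h1 := (dist_le_of_mem_seg (oseg_subset_seg hz)).2
          have h2 := (dist_le_of_mem_seg (oseg_subset_seg hw)).1
          rw [← hef] at h2
          have h3 := hshort f hf
          rw [← hef] at h3
          have := dist_triangle z e.2 w
          linarith [hshort e he]
        subst hzw
        have := hD'.consecutive_inter he hf hef (oseg_subset_seg hz) (oseg_subset_seg hw)
        exact (oseg_ne (hD'.nondegenerate e he) hz).2 this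
      · obtain ⟨σ, hσ⟩ := key e he h1
        push Not at h2
        exact ⟨σ, hσ, pure_of_not_crosses h2⟩
    · push Not at h1
      by_cases h2 : ∃ g ∈ D'.edges, f.Crosses g
      · obtain ⟨σ, hσ⟩ := key f hf h2
        exact ⟨σ.flip, pure_of_not_crosses h1, by simpa using hσ⟩
      · push Not at h2
        exact ⟨.o, pure_of_not_crosses h1, pure_of_not_crosses h2⟩
  · rintro e he hl f hf ⟨hef, z, hz, hz'⟩
    have := hsep z (hcp z ⟨e, he, f, hf, hef, hz, hz'⟩) D.leg (Or.inr (Or.inl rfl)) (by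
      rw [← href.leg_eq, ← hl, dist_comm]
      linarith [(dist_le_of_mem_seg (oseg_subset_seg hz)).1, hshort e he])
    rw [← href.leg_eq, ← hl] at this
    exact (oseg_ne (hD'.nondegenerate e he) hz).1 this
  · rintro e he hl f hf ⟨hef, z, hz, hz'⟩
    have := hsep z (hcp z ⟨e, he, f, hf, hef, hz, hz'⟩) D.head (Or.inr (Or.inr rfl)) (by
      rw [← href.head_eq, ← hl]
      linarith [(dist_le_of_mem_seg (oseg_subset_seg hz)).2, hshort e he])
    rw [← href.head_eq, ← hl] at this
    exact (oseg_ne (hD'.nondegenerate e he) hz).2 this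

end MultiKnotoidDiagram

end PLKnotoid

namespace PLKnotoid

/-! ### Incidences are closed conditions -/

theorem mem_triangle_iff {a b c z : Pt} :
    z ∈ triangle a b c ↔ ∃ m ∈ segment ℝ b c, z ∈ segment ℝ a m := by
  rw [triangle, convexHull_insert (Set.insert_nonempty _ _), convexHull_pair,
    mem_convexJoin]
  simp

theorem triangle_swap_right (a b c : Pt) : triangle a b c = triangle a c b := by
  rw [triangle, triangle, Set.pair_comm]

theorem triangle_swap_left (a b c : Pt) : triangle a b c = triangle b a c := by
  rw [triangle, triangle, Set.insert_comm]

theorem triangle_rotate (a b c : Pt) : triangle a b c = triangle c a b := by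
  rw [triangle_swap_right, triangle_swap_left]

theorem triangle_seg (a b : Pt) : triangle a b b = segment ℝ a b := by
  rw [triangle, Set.pair_eq_singleton, convexHull_pair]

theorem triangle_seg' (a b : Pt) : triangle a a b = segment ℝ a b := by
  rw [triangle_rotate, triangle_seg, segment_symm]

theorem triangle_subset_of_convex {s : Set Pt} (hs : Convex ℝ s) {a b c : Pt} (ha : a ∈ s)
    (hb : b ∈ s) (hc : c ∈ s) : triangle a b c ⊆ s := by
  apply convexHull_min _ hs
  rintro p (rfl | rfl | rfl) <;> assumption

/-- The triples of triangles with a common point form a closed set. -/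
theorem isClosed_triangles_meet : IsClosed {y : Fin 9 → Pt |
    ∃ z, z ∈ triangle (y 0) (y 1) (y 2) ∧ z ∈ triangle (y 3) (y 4) (y 5) ∧
      z ∈ triangle (y 6) (y 7) (y 8)} := by
  let F : Pt → Pt → Pt → ℝ → ℝ → Pt := fun a b c s t => a + t • ((b + s • (c - b)) - a)
  have hF : ∀ a b c z, z ∈ triangle a b c ↔
      ∃ s t : unitInterval, F a b c s t = z := by
    intro a b c z
    rw [mem_triangle_iff]
    simp only [segment_eq_image', Set.mem_image]
    constructor
    · rintro ⟨m, ⟨s, hs, rfl⟩, t, ht, rfl⟩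
      exact ⟨⟨s, hs⟩, ⟨t, ht⟩, rfl⟩
    · rintro ⟨s, t, rfl⟩
      exact ⟨_, ⟨s, s.2, rfl⟩, t, t.2, rfl⟩
  have hcl : IsClosed {q : (Fin 9 → Pt) × (Fin 6 → unitInterval) |
      F (q.1 0) (q.1 1) (q.1 2) (q.2 0) (q.2 1) = F (q.1 3) (q.1 4) (q.1 5) (q.2 2) (q.2 3) ∧
      F (q.1 0) (q.1 1) (q.1 2) (q.2 0) (q.2 1) = F (q.1 6) (q.1 7) (q.1 8) (q.2 4) (q.2 5)} := by
    apply IsClosed.inter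
    · apply isClosed_eq <;> fun_prop
    · apply isClosed_eq <;> fun_prop
  have hpr := isClosedMap_fst_of_compactSpace _ hcl
  convert hpr using 1
  ext y
  simp only [Set.mem_image, hF]
  constructor
  · rintro ⟨z, ⟨s0, s1, h0⟩, ⟨s2, s3, h1⟩, ⟨s4, s5, h2⟩⟩
    exact ⟨(y, ![s0, s1, s2, s3, s4, s5]), ⟨h0.trans h1.symm, h0.trans h2.symm⟩, rfl⟩
  · rintro ⟨⟨y', s⟩, ⟨h1, h2⟩, rfl⟩
    exact ⟨_, ⟨s 0, s 1, rfl⟩, ⟨s 2, s 3, h1.symm⟩, ⟨s 4, s 5, h2.symm⟩⟩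

theorem eventually_near {k : ℕ} {C : Set (Fin k → Pt)} (hC : IsClosed C) {w : Fin k → Pt}
    (hw : w ∉ C) : ∀ᶠ η in 𝓝[>] (0 : ℝ), ∀ y : Fin k → Pt, (∀ i, dist (y i) (w i) < η) → y ∉ C := by
  obtain ⟨η₀, h0, hη⟩ := Metric.isOpen_iff.1 hC.isOpen_compl w hw
  filter_upwards [Ioo_mem_nhdsGT h0] with η hη' y hy
  apply hη
  rw [Metric.mem_ball, dist_pi_lt_iff h0]
  exact fun i => (hy i).trans hη'.2

theorem near_triangles {a b c d e f g h k : Pt}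
    (H : ∀ z, z ∈ triangle a b c → z ∈ triangle d e f → z ∉ triangle g h k) :
    ∀ᶠ η in 𝓝[>] (0 : ℝ), ∀ a' b' c' d' e' f' g' h' k' : Pt,
      dist a' a < η → dist b' b < η → dist c' c < η → dist d' d < η → dist e' e < η →
      dist f' f < η → dist g' g < η → dist h' h < η → dist k' k < η →
      ∀ z, z ∈ triangle a' b' c' → z ∈ triangle d' e' f' → z ∉ triangle g' h' k' := by
  have := eventually_near isClosed_triangles_meet (w := ![a, b, c, d, e, f, g, h, k])
    (by rintro ⟨z, h1, h2, h3⟩; exact H z h1 h2 h3)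
  filter_upwards [this] with η hη a' b' c' d' e' f' g' h' k' h0 h1 h2 h3 h4 h5 h6 h7 h8 z z1 z2 z3
  refine hη ![a', b', c', d', e', f', g', h', k'] ?_ ⟨z, z1, z2, z3⟩
  intro i
  fin_cases i <;> assumption

theorem near_seg3 {a b c d e f : Pt}
    (H : ∀ z, z ∈ segment ℝ a b → z ∈ segment ℝ c d → z ∉ segment ℝ e f) :
    ∀ᶠ η in 𝓝[>] (0 : ℝ), ∀ a' b' c' d' e' f' : Pt,
      dist a' a < η → dist b' b < η → dist c' c < η → dist d' d < η → dist e' e < η →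
      dist f' f < η →
      ∀ z, z ∈ segment ℝ a' b' → z ∈ segment ℝ c' d' → z ∉ segment ℝ e' f' := by
  have := near_triangles (a := a) (b := b) (c := b) (d := c) (e := d) (f := d) (g := e) (h := f)
    (k := f) (by simpa only [triangle_seg] using H)
  filter_upwards [this] with η hη a' b' c' d' e' f' h1 h2 h3 h4 h5 h6
  simpa only [triangle_seg] using hη a' b' b' c' d' d' e' f' f' h1 h2 h2 h3 h4 h4 h5 h6 h6

theorem near_tri_seg {a b c d e : Pt} (H : ∀ z, z ∈ triangle a b c → z ∉ segment ℝ d e) :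
    ∀ᶠ η in 𝓝[>] (0 : ℝ), ∀ a' b' c' d' e' : Pt,
      dist a' a < η → dist b' b < η → dist c' c < η → dist d' d < η → dist e' e < η →
      ∀ z, z ∈ triangle a' b' c' → z ∉ segment ℝ d' e' := by
  have := near_triangles (a := a) (b := b) (c := c) (d := d) (e := e) (f := e) (g := d) (h := e)
    (k := e) (by
      intro z h1 h2
      rw [triangle_seg] at h2 ⊢
      exact (H z h1 h2).elim)
  filter_upwards [this] with η hη a' b' c' d' e' h1 h2 h3 h4 h5 z z1 z2
  have := hη a' b' c' d' e' e' d' e' e' h1 h2 h3 h4 h5 h5 h4 h5 h5 z z1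
  rw [triangle_seg] at this
  exact this z2 z2

theorem near_seg_seg {a b c d : Pt} (H : ∀ z, z ∈ segment ℝ a b → z ∉ segment ℝ c d) :
    ∀ᶠ η in 𝓝[>] (0 : ℝ), ∀ a' b' c' d' : Pt,
      dist a' a < η → dist b' b < η → dist c' c < η → dist d' d < η →
      ∀ z, z ∈ segment ℝ a' b' → z ∉ segment ℝ c' d' := by
  have := near_tri_seg (a := a) (b := b) (c := b) (d := c) (e := d)
    (by simpa only [triangle_seg] using H)
  filter_upwards [this] with η hη a' b' c' d' h1 h2 h3 h4
  simpa only [triangle_seg] using hη a' b' b' c' d' h1 h2 h2 h3 h4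

theorem near_tri_pt {a b c x : Pt} (H : x ∉ triangle a b c) :
    ∀ᶠ η in 𝓝[>] (0 : ℝ), ∀ a' b' c' x' : Pt,
      dist a' a < η → dist b' b < η → dist c' c < η → dist x' x < η → x' ∉ triangle a' b' c' := by
  have := near_tri_seg (a := a) (b := b) (c := c) (d := x) (e := x)
    (by intro z hz hz'; simp only [segment_same, Set.mem_singleton_iff] at hz'; exact H (hz' ▸ hz))
  filter_upwards [this] with η hη a' b' c' x' h1 h2 h3 h4 hm
  exact hη a' b' c' x' x' h1 h2 h3 h4 h4 x' hm (left_mem_segment ℝ _ _)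

theorem near_seg_pt {a b x : Pt} (H : x ∉ segment ℝ a b) :
    ∀ᶠ η in 𝓝[>] (0 : ℝ), ∀ a' b' x' : Pt,
      dist a' a < η → dist b' b < η → dist x' x < η → x' ∉ segment ℝ a' b' := by
  have := near_tri_pt (a := a) (b := b) (c := b) (x := x) (by rwa [triangle_seg])
  filter_upwards [this] with η hη a' b' x' h1 h2 h3
  simpa only [triangle_seg] using hη a' b' b' x' h1 h2 h2 h3

theorem near_cross {a b c d : Pt} (H : (openSegment ℝ a b ∩ openSegment ℝ c d).Nonempty)
    (hdet : cr (b - a) (d - c) ≠ 0) :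
    ∀ᶠ η in 𝓝[>] (0 : ℝ), ∀ a' b' c' d' : Pt,
      dist a' a < η → dist b' b < η → dist c' c < η → dist d' d < η →
      (openSegment ℝ a' b' ∩ openSegment ℝ c' d').Nonempty := by
  let S : Set (Fin 4 → Pt) :=
    {y | cr (y 1 - y 0) (y 2 - y 0) * cr (y 1 - y 0) (y 3 - y 0) < 0} ∩
      {y | cr (y 3 - y 2) (y 0 - y 2) * cr (y 3 - y 2) (y 1 - y 2) < 0}
  have hS : IsOpen S := by
    apply IsOpen.inter
    · apply isOpen_lt
      · unfold cr; fun_prop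
      · fun_prop
    · apply isOpen_lt
      · unfold cr; fun_prop
      · fun_prop
  have := eventually_near hS.isClosed_compl (w := ![a, b, c, d])
    (by rw [Set.notMem_compl_iff]; exact transversal_iff_signs.1 ⟨H, hdet⟩)
  filter_upwards [this] with η hη a' b' c' d' h1 h2 h3 h4
  have h := hη ![a', b', c', d'] (by intro i; fin_cases i <;> assumption)
  rw [Set.notMem_compl_iff] at h
  exact (transversal_iff_signs.2 h).1

/-! ### Moving the vertices of a diagram -/

/-- The straight edge between the images of the ends of `e`. -/
def mapEdge (p : Pt → Pt) (e : Edge) : Edge := (p e.1, p e.2)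

/-- The polygonal data obtained by moving every vertex `v` to `p v`. -/
def DiagramData.map (D : DiagramData) (p : Pt → Pt) : DiagramData where
  edges := mapEdge p '' D.edges
  leg := p D.leg
  head := p D.head
  passesOver e f := ∃ e₀ f₀, D.passesOver e₀ f₀ ∧ e = mapEdge p e₀ ∧ f = mapEdge p f₀

/-- Moving the vertices by `p` keeps general position and the crossings. -/
structure MapOK (D : MultiKnotoidDiagram) (p : Pt → Pt) : Prop where
  inj : ∀ s ∈ verts D.edges, ∀ s' ∈ verts D.edges, p s = p s' → s = s'
  off : ∀ s ∈ verts D.edges, ∀ e ∈ D.edges, p s ∈ segment ℝ (p e.1) (p e.2) → s = e.1 ∨ s = e.2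
  cross_iff : ∀ e ∈ D.edges, ∀ f ∈ D.edges,
    ((mapEdge p e).Crosses (mapEdge p f) ↔ e.Crosses f)
  triple : ∀ e ∈ D.edges, ∀ f ∈ D.edges, ∀ g ∈ D.edges, e ≠ f → e ≠ g → f ≠ g → ∀ z,
    z ∈ (mapEdge p e).openSeg → z ∈ (mapEdge p f).openSeg → z ∉ (mapEdge p g).openSeg

namespace MultiKnotoidDiagram

variable {D : MultiKnotoidDiagram}

theorem toDiagramData_inj {D D' : MultiKnotoidDiagram} (h : D.toDiagramData = D'.toDiagramData) :
    D = D' := by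
  cases D; cases D'; cases h; rfl

theorem exists_leg_edge (D : MultiKnotoidDiagram) : ∃ e ∈ D.edges, e.1 = D.leg := by
  have : D.leg ∈ ({D.leg} : Set Pt) := rfl
  rw [← D.isCurveSystem.init_eq] at this
  exact this.1

theorem ne_leg {e : Edge} (he : e ∈ D.edges) : e.2 ≠ D.leg := by
  intro h
  have : D.leg ∈ ({D.leg} : Set Pt) := rfl
  rw [← D.isCurveSystem.init_eq] at this
  exact this.2 ⟨e, he, h⟩

theorem exists_head_edge (D : MultiKnotoidDiagram) : ∃ e ∈ D.edges, e.2 = D.head := by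
  have : D.head ∈ ({D.head} : Set Pt) := rfl
  rw [← D.isCurveSystem.term_eq] at this
  exact this.1

theorem ne_head {e : Edge} (he : e ∈ D.edges) : e.1 ≠ D.head := by
  intro h
  have : D.head ∈ ({D.head} : Set Pt) := rfl
  rw [← D.isCurveSystem.term_eq] at this
  exact this.2 ⟨e, he, h⟩

theorem leg_mem_verts (D : MultiKnotoidDiagram) : D.leg ∈ verts D.edges := by
  obtain ⟨e, he, h⟩ := D.exists_leg_edge
  exact h ▸ fst_mem_verts he

theorem head_mem_verts (D : MultiKnotoidDiagram) : D.head ∈ verts D.edges := by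
  obtain ⟨e, he, h⟩ := D.exists_head_edge
  exact h ▸ snd_mem_verts he

theorem exists_in_edge {v : Pt} (hv : v ∈ verts D.edges) (hl : v ≠ D.leg) :
    ∃ e ∈ D.edges, e.2 = v := by
  obtain ⟨e, he, rfl | rfl⟩ := hv
  · by_contra h
    apply hl
    have : e.1 ∈ ({D.leg} : Set Pt) := by
      rw [← D.isCurveSystem.init_eq]
      exact ⟨⟨e, he, rfl⟩, h⟩
    exact this
  · exact ⟨e, he, rfl⟩

theorem exists_out_edge {v : Pt} (hv : v ∈ verts D.edges) (hl : v ≠ D.head) :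
    ∃ e ∈ D.edges, e.1 = v := by
  obtain ⟨e, he, rfl | rfl⟩ := hv
  · exact ⟨e, he, rfl⟩
  · by_contra h
    apply hl
    have : e.2 ∈ ({D.head} : Set Pt) := by
      rw [← D.isCurveSystem.term_eq]
      exact ⟨⟨e, he, rfl⟩, h⟩
    exact this

end MultiKnotoidDiagram

namespace MapOK

variable {D : MultiKnotoidDiagram} {p : Pt → Pt}

theorem mapEdge_inj (h : MapOK D p) {e f : Edge} (he : e ∈ D.edges) (hf : f ∈ D.edges)
    (hef : mapEdge p e = mapEdge p f) : e = f :=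
  D.isCurveSystem.out_unique e he f hf
    (h.inj _ (fst_mem_verts he) _ (fst_mem_verts hf) (congrArg Prod.fst hef))

theorem passesOver_iff (h : MapOK D p) {e f : Edge} (he : e ∈ D.edges) (hf : f ∈ D.edges) :
    (D.toDiagramData.map p).passesOver (mapEdge p e) (mapEdge p f) ↔ D.passesOver e f := by
  constructor
  · rintro ⟨e₀, f₀, h0, h1, h2⟩
    obtain ⟨he₀, hf₀, -⟩ := D.isCurveSystem.passesOver_crosses _ _ h0
    rw [h.mapEdge_inj he he₀ h1, h.mapEdge_inj hf hf₀ h2]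
    exact h0
  · intro h0
    exact ⟨e, f, h0, rfl, rfl⟩

theorem isCurveSystem (h : MapOK D p) : IsCurveSystem (mapEdge p '' D.edges) {p D.leg} {p D.head}
    (D.toDiagramData.map p).passesOver := by
  have hD := D.isCurveSystem
  have nondeg : ∀ e ∈ mapEdge p '' D.edges, e.1 ≠ e.2 := by
    rintro _ ⟨e, he, rfl⟩ h1
    exact hD.nondegenerate e he (h.inj _ (fst_mem_verts he) _ (snd_mem_verts he) h1)
  have off : ∀ e ∈ mapEdge p '' D.edges, ∀ f ∈ mapEdge p '' D.edges, ∀ q,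
      (q = e.1 ∨ q = e.2) → q ∈ f.closedSeg → q = f.1 ∨ q = f.2 := by
    rintro _ ⟨e, he, rfl⟩ _ ⟨f, hf, rfl⟩ q hq hm
    rcases hq with rfl | rfl
    · rcases h.off e.1 (fst_mem_verts he) f hf hm with h1 | h1
      · exact Or.inl (congrArg p h1)
      · exact Or.inr (congrArg p h1)
    · rcases h.off e.2 (snd_mem_verts he) f hf hm with h1 | h1
      · exact Or.inl (congrArg p h1)
      · exact Or.inr (congrArg p h1)
  have noswap : ∀ e ∈ mapEdge p '' D.edges, (e.2, e.1) ∉ mapEdge p '' D.edges := by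
    rintro _ ⟨e, he, rfl⟩ ⟨f, hf, h1⟩
    have h2 : f.1 = e.2 :=
      h.inj _ (fst_mem_verts hf) _ (snd_mem_verts he) (congrArg Prod.fst h1)
    have h3 : f.2 = e.1 :=
      h.inj _ (snd_mem_verts hf) _ (fst_mem_verts he) (congrArg Prod.snd h1)
    apply hD.no_swap e he
    have : ((e.2, e.1) : Edge) = f := Prod.ext h2.symm h3.symm
    rwa [this]
  have hout : ∀ s ∈ verts D.edges, ((∃ e ∈ mapEdge p '' D.edges, e.1 = p s) ↔
      ∃ e ∈ D.edges, e.1 = s) := by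
    intro s hs
    constructor
    · rintro ⟨_, ⟨e, he, rfl⟩, h1⟩
      exact ⟨e, he, h.inj _ (fst_mem_verts he) _ hs h1⟩
    · rintro ⟨e, he, rfl⟩
      exact ⟨_, ⟨e, he, rfl⟩, rfl⟩
  have hin : ∀ s ∈ verts D.edges, ((∃ e ∈ mapEdge p '' D.edges, e.2 = p s) ↔
      ∃ e ∈ D.edges, e.2 = s) := by
    intro s hs
    constructor
    · rintro ⟨_, ⟨e, he, rfl⟩, h1⟩
      exact ⟨e, he, h.inj _ (snd_mem_verts he) _ hs h1⟩
    · rintro ⟨e, he, rfl⟩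
      exact ⟨_, ⟨e, he, rfl⟩, rfl⟩
  refine
    { finite := hD.finite.image _
      nondegenerate := nondeg
      out_unique := ?_
      in_unique := ?_
      init_eq := ?_
      term_eq := ?_
      vertex_off_edge := off
      transversal := transversal_of_off nondeg noswap off
      no_triple_point := ?_
      passesOver_crosses := ?_
      passesOver_iff_not := ?_ }
  · rintro _ ⟨e, he, rfl⟩ _ ⟨f, hf, rfl⟩ h1
    rw [hD.out_unique e he f hf (h.inj _ (fst_mem_verts he) _ (fst_mem_verts hf) h1)]
  · rintro _ ⟨e, he, rfl⟩ _ ⟨f, hf, rfl⟩ h1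
    rw [hD.in_unique e he f hf (h.inj _ (snd_mem_verts he) _ (snd_mem_verts hf) h1)]
  · ext q
    simp only [Set.mem_ofPred_eq, Set.mem_singleton_iff]
    constructor
    · rintro ⟨⟨_, ⟨e, he, rfl⟩, rfl⟩, h2⟩
      have h3 : e.1 ∈ ({D.leg} : Set Pt) := by
        rw [← hD.init_eq]
        exact ⟨⟨e, he, rfl⟩, fun h' => h2 ((hin e.1 (fst_mem_verts he)).2 h')⟩
      exact congrArg p h3
    · rintro rfl
      rw [hout _ D.leg_mem_verts, hin _ D.leg_mem_verts]
      exact ⟨D.exists_leg_edge, fun ⟨e, he, h'⟩ => MultiKnotoidDiagram.ne_leg he h'⟩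
  · ext q
    simp only [Set.mem_ofPred_eq, Set.mem_singleton_iff]
    constructor
    · rintro ⟨⟨_, ⟨e, he, rfl⟩, rfl⟩, h2⟩
      have h3 : e.2 ∈ ({D.head} : Set Pt) := by
        rw [← hD.term_eq]
        exact ⟨⟨e, he, rfl⟩, fun h' => h2 ((hout e.2 (snd_mem_verts he)).2 h')⟩
      exact congrArg p h3
    · rintro rfl
      rw [hout _ D.head_mem_verts, hin _ D.head_mem_verts]
      exact ⟨D.exists_head_edge, fun ⟨e, he, h'⟩ => MultiKnotoidDiagram.ne_head he h'⟩
  · rintro _ ⟨e, he, rfl⟩ _ ⟨f, hf, rfl⟩ _ ⟨g, hg, rfl⟩ hef heg hfg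
    rw [Set.eq_empty_iff_forall_notMem]
    rintro z ⟨⟨h1, h2⟩, h3⟩
    exact h.triple e he f hf g hg (fun h => hef (h ▸ rfl)) (fun h => heg (h ▸ rfl))
      (fun h => hfg (h ▸ rfl)) z h1 h2 h3
  · rintro _ _ ⟨e, f, h0, rfl, rfl⟩
    obtain ⟨he, hf, hc⟩ := hD.passesOver_crosses _ _ h0
    exact ⟨⟨e, he, rfl⟩, ⟨f, hf, rfl⟩, (h.cross_iff e he f hf).2 hc⟩
  · rintro _ ⟨e, he, rfl⟩ _ ⟨f, hf, rfl⟩ hc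
    rw [h.passesOver_iff he hf, h.passesOver_iff hf he]
    exact hD.passesOver_iff_not e he f hf ((h.cross_iff e he f hf).1 hc)

/-- The diagram obtained by moving every vertex `v` to `p v`. -/
def diagram (h : MapOK D p) : MultiKnotoidDiagram where
  toDiagramData := D.toDiagramData.map p
  isCurveSystem := h.isCurveSystem

theorem mem_edges (h : MapOK D p) {e : Edge} (he : e ∈ D.edges) :
    mapEdge p e ∈ h.diagram.edges := ⟨e, he, rfl⟩

theorem diagram_passesOver_iff (h : MapOK D p) {e f : Edge} (he : e ∈ D.edges)
    (hf : f ∈ D.edges) :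
    h.diagram.passesOver (mapEdge p e) (mapEdge p f) ↔ D.passesOver e f :=
  h.passesOver_iff he hf

theorem side_iff (h : MapOK D p) {τ : Label} {e f : Edge} (he : e ∈ D.edges) (hf : f ∈ D.edges) :
    Side h.diagram.passesOver τ (mapEdge p e) (mapEdge p f) ↔ Side D.passesOver τ e f := by
  cases τ
  · exact h.passesOver_iff he hf
  · exact h.passesOver_iff hf he

theorem pure_iff (h : MapOK D p) {τ : Label} {e : Edge} (he : e ∈ D.edges) :
    Pure h.diagram.passesOver τ (mapEdge p e) ↔ Pure D.passesOver τ e := by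
  rw [MultiKnotoidDiagram.pure_iff_side, MultiKnotoidDiagram.pure_iff_side]
  constructor
  · intro h1 f hf
    obtain ⟨-, hfE, -⟩ := MultiKnotoidDiagram.side_mem hf
    exact h1 _ ((h.side_iff he hfE).2 hf)
  · intro h1 f hf
    obtain ⟨-, ⟨f, hfE, rfl⟩, -⟩ := MultiKnotoidDiagram.side_mem hf
    exact h1 _ ((h.side_iff he hfE).1 hf)

theorem verts_eq (h : MapOK D p) : verts h.diagram.edges = p '' verts D.edges := by
  ext q
  constructor
  · rintro ⟨_, ⟨e, he, rfl⟩, rfl | rfl⟩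
    · exact ⟨e.1, fst_mem_verts he, rfl⟩
    · exact ⟨e.2, snd_mem_verts he, rfl⟩
  · rintro ⟨_, ⟨e, he, rfl | rfl⟩, rfl⟩
    · exact fst_mem_verts (h.mem_edges he)
    · exact snd_mem_verts (h.mem_edges he)

end MapOK

theorem map_congr {D : MultiKnotoidDiagram} {p q : Pt → Pt}
    (h : ∀ s ∈ verts D.edges, p s = q s) : D.toDiagramData.map p = D.toDiagramData.map q := by
  have hE : ∀ e ∈ D.edges, mapEdge p e = mapEdge q e := fun e he =>
    Prod.ext (h _ (fst_mem_verts he)) (h _ (snd_mem_verts he))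
  apply DiagramData.ext
  · exact Set.image_congr hE
  · exact h _ D.leg_mem_verts
  · exact h _ D.head_mem_verts
  · funext e f
    apply propext
    constructor
    · rintro ⟨e₀, f₀, h0, rfl, rfl⟩
      obtain ⟨he, hf, -⟩ := D.isCurveSystem.passesOver_crosses _ _ h0
      exact ⟨e₀, f₀, h0, hE _ he, hE _ hf⟩
    · rintro ⟨e₀, f₀, h0, rfl, rfl⟩
      obtain ⟨he, hf, -⟩ := D.isCurveSystem.passesOver_crosses _ _ h0
      exact ⟨e₀, f₀, h0, (hE _ he).symm, (hE _ hf).symm⟩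

theorem DiagramData.map_id (D : DiagramData) : D.map id = D := by
  apply DiagramData.ext
  · show (fun e : Edge => ((e.1, e.2) : Edge)) '' D.edges = D.edges
    simp
  · rfl
  · rfl
  · funext e f
    apply propext
    constructor
    · rintro ⟨e₀, f₀, h0, rfl, rfl⟩
      exact h0
    · intro h
      exact ⟨e, f, h, rfl, rfl⟩

theorem DiagramData.map_map (D : DiagramData) (p q : Pt → Pt) :
    (D.map p).map q = D.map (q ∘ p) := by
  apply DiagramData.ext
  · show mapEdge q '' (mapEdge p '' D.edges) = _
    rw [Set.image_image]
    rfl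
  · rfl
  · rfl
  · funext e f
    apply propext
    constructor
    · rintro ⟨_, _, ⟨e₀, f₀, h0, rfl, rfl⟩, rfl, rfl⟩
      exact ⟨e₀, f₀, h0, rfl, rfl⟩
    · rintro ⟨e₀, f₀, h0, rfl, rfl⟩
      exact ⟨_, _, ⟨e₀, f₀, h0, rfl, rfl⟩, rfl, rfl⟩

end PLKnotoid

namespace PLKnotoid

/-! ### Small movements of the vertices -/

/-- `p` moves every vertex of `D` by less than `η`. -/
def Near (D : MultiKnotoidDiagram) (η : ℝ) (p : Pt → Pt) : Prop :=
  ∀ s ∈ verts D.edges, dist (p s) s < η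

namespace MultiKnotoidDiagram

variable (D : MultiKnotoidDiagram)

theorem notMem_of_ne_ends {D : MultiKnotoidDiagram} {s : Pt} {e : Edge} (hs : s ∈ verts D.edges)
    (he : e ∈ D.edges) (h1 : s ≠ e.1) (h2 : s ≠ e.2) : s ∉ segment ℝ e.1 e.2 := by
  intro h
  obtain ⟨f, hf, hsf⟩ := hs
  rcases D.isCurveSystem.vertex_off_edge f hf e he s hsf h with h | h
  · exact h1 h
  · exact h2 h

theorem eventually_off : ∀ᶠ η in 𝓝[>] (0 : ℝ), ∀ s ∈ verts D.edges, ∀ e ∈ D.edges,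
    s ≠ e.1 → s ≠ e.2 → ∀ a' b' x' : Pt, dist a' e.1 < η → dist b' e.2 < η → dist x' s < η →
      x' ∉ segment ℝ a' b' := by
  have hD := D.isCurveSystem
  refine (Set.Finite.eventually_all (verts_finite hD.finite)).2 fun s hs =>
    (Set.Finite.eventually_all hD.finite).2 fun e he => ?_
  by_cases h1 : s = e.1
  · simp [h1]
  by_cases h2 : s = e.2
  · simp [h2]
  filter_upwards [near_seg_pt (notMem_of_ne_ends hs he h1 h2)] with η hη _ _
  exact hη

theorem eventually_inj : ∀ᶠ η in 𝓝[>] (0 : ℝ), ∀ s ∈ verts D.edges, ∀ s' ∈ verts D.edges,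
    s ≠ s' → ∀ x' y' : Pt, dist x' s < η → dist y' s' < η → x' ≠ y' := by
  have hD := D.isCurveSystem
  refine (Set.Finite.eventually_all (verts_finite hD.finite)).2 fun s hs =>
    (Set.Finite.eventually_all (verts_finite hD.finite)).2 fun s' hs' => ?_
  by_cases h1 : s = s'
  · simp [h1]
  filter_upwards [near_seg_pt (a := s') (b := s') (x := s) (by simpa using h1)] with
    η hη _ x' y' hx hy hxy
  exact hη y' y' x' hy hy hx (hxy ▸ left_mem_segment ℝ _ _)

theorem eventually_disjoint : ∀ᶠ η in 𝓝[>] (0 : ℝ), ∀ e ∈ D.edges, ∀ f ∈ D.edges,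
    (∀ z ∈ e.closedSeg, z ∉ f.closedSeg) → ∀ a' b' c' d' : Pt, dist a' e.1 < η → dist b' e.2 < η →
      dist c' f.1 < η → dist d' f.2 < η → ∀ z ∈ segment ℝ a' b', z ∉ segment ℝ c' d' := by
  have hD := D.isCurveSystem
  refine (Set.Finite.eventually_all hD.finite).2 fun e _ =>
    (Set.Finite.eventually_all hD.finite).2 fun f _ => ?_
  by_cases h : ∀ z ∈ e.closedSeg, z ∉ f.closedSeg
  · filter_upwards [near_seg_seg h] with η hη _
    exact hη
  · exact Eventually.of_forall fun _ h' => (h h').elim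

theorem eventually_cross : ∀ᶠ η in 𝓝[>] (0 : ℝ), ∀ e ∈ D.edges, ∀ f ∈ D.edges,
    e.Crosses f → ∀ a' b' c' d' : Pt, dist a' e.1 < η → dist b' e.2 < η →
      dist c' f.1 < η → dist d' f.2 < η →
      (openSegment ℝ a' b' ∩ openSegment ℝ c' d').Nonempty := by
  have hD := D.isCurveSystem
  refine (Set.Finite.eventually_all hD.finite).2 fun e he =>
    (Set.Finite.eventually_all hD.finite).2 fun f hf => ?_
  by_cases h : e.Crosses f
  · filter_upwards [near_cross h.2 (hD.transversal e he f hf h)] with η hη _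
    exact hη
  · simp [h]

theorem eventually_triple : ∀ᶠ η in 𝓝[>] (0 : ℝ), ∀ e ∈ D.edges, ∀ f ∈ D.edges, ∀ g ∈ D.edges,
    e.Crosses f → e.Crosses g → f.Crosses g → ∀ a' b' c' d' k' l' : Pt,
      dist a' e.1 < η → dist b' e.2 < η → dist c' f.1 < η → dist d' f.2 < η →
      dist k' g.1 < η → dist l' g.2 < η →
      ∀ z ∈ segment ℝ a' b', z ∈ segment ℝ c' d' → z ∉ segment ℝ k' l' := by
  have hD := D.isCurveSystem
  refine (Set.Finite.eventually_all hD.finite).2 fun e he =>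
    (Set.Finite.eventually_all hD.finite).2 fun f hf =>
    (Set.Finite.eventually_all hD.finite).2 fun g hg => ?_
  by_cases h1 : e.Crosses f
  swap
  · simp [h1]
  by_cases h2 : e.Crosses g
  swap
  · simp [h2]
  by_cases h3 : f.Crosses g
  swap
  · simp [h3]
  have key : ∀ {e f : Edge}, e ∈ D.edges → f ∈ D.edges → e.Crosses f → ∀ z ∈ e.closedSeg,
      z ∈ f.closedSeg → z ∈ e.openSeg := by
    intro e f he hf hc z hz hz'
    apply mem_oseg_of_seg hz
    · rintro rfl
      have := hD.vertex_off_edge e he f hf e.1 (Or.inl rfl) hz'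
      exact hD.not_crosses_of_common he hf (by tauto) hc
    · rintro rfl
      have := hD.vertex_off_edge e he f hf e.2 (Or.inr rfl) hz'
      exact hD.not_crosses_of_common he hf (by tauto) hc
  have hno : ∀ z ∈ segment ℝ e.1 e.2, z ∈ segment ℝ f.1 f.2 → z ∉ segment ℝ g.1 g.2 := by
    intro z z1 z2 z3
    exact Set.eq_empty_iff_forall_notMem.1
      (hD.no_triple_point e he f hf g hg h1.1 h2.1 h3.1) z
      ⟨⟨key he hf h1 z z1 z2, key hf he h1.symm z z2 z1⟩, key hg he h2.symm z z3 z1⟩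
  filter_upwards [near_seg3 hno] with η hη _ _ _
  exact hη

/-- Small movements of the vertices keep general position and the crossings. -/
theorem eventually_mapOK : ∀ᶠ η in 𝓝[>] (0 : ℝ), ∀ p, Near D η p → MapOK D p := by
  have hD := D.isCurveSystem
  filter_upwards [D.eventually_off, D.eventually_inj, D.eventually_disjoint, D.eventually_cross,
    D.eventually_triple] with η h1 h2 h3 h4 h5 p hp
  have p1 : ∀ e ∈ D.edges, dist (p e.1) e.1 < η := fun e he => hp _ (fst_mem_verts he)
  have p2 : ∀ e ∈ D.edges, dist (p e.2) e.2 < η := fun e he => hp _ (snd_mem_verts he)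
  have off : ∀ s ∈ verts D.edges, ∀ e ∈ D.edges, p s ∈ segment ℝ (p e.1) (p e.2) →
      s = e.1 ∨ s = e.2 := by
    intro s hs e he hm
    by_contra hne
    push Not at hne
    exact h1 s hs e he hne.1 hne.2 _ _ _ (p1 e he) (p2 e he) (hp s hs) hm
  have common : ∀ e ∈ D.edges, ∀ f ∈ D.edges, e.2 = f.1 → ∀ z ∈ (mapEdge p e).openSeg,
      z ∉ (mapEdge p f).openSeg := by
    intro e he f hf hef z hz hz'
    have i1 : p e.1 ∉ segment ℝ (p e.2) (p f.2) := by
      intro hm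
      rw [hef] at hm
      rcases off _ (fst_mem_verts he) f hf hm with h | h
      · exact hD.nondegenerate e he (h.trans hef.symm)
      · apply hD.no_swap e he
        have : ((e.2, e.1) : Edge) = f := Prod.ext hef h
        rwa [this]
    have i2 : p f.2 ∉ segment ℝ (p e.2) (p e.1) := by
      intro hm
      rw [segment_symm] at hm
      rcases off _ (snd_mem_verts hf) e he hm with h | h
      · apply hD.no_swap e he
        have : ((e.2, e.1) : Edge) = f := Prod.ext hef h.symm
        rwa [this]
      · exact hD.nondegenerate f hf (hef.symm.trans h.symm)
    have hz1 : z ∈ segment ℝ (p e.2) (p e.1) := by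
      rw [segment_symm]; exact oseg_subset_seg hz
    have hz2 : z ∈ segment ℝ (p e.2) (p f.2) := by
      rw [hef]; exact oseg_subset_seg hz'
    have hzw := seg_inter_of_common_end i1 i2 hz1 hz2
    have hne : p e.1 ≠ p e.2 :=
      h2 _ (fst_mem_verts he) _ (snd_mem_verts he) (hD.nondegenerate e he) _ _ (p1 e he) (p2 e he)
    exact (oseg_ne hne hz).2 hzw
  have cross_of : ∀ e ∈ D.edges, ∀ f ∈ D.edges, e ≠ f → ∀ z ∈ (mapEdge p e).openSeg,
      z ∈ (mapEdge p f).openSeg → e.Crosses f := by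
    intro e he f hf hef z hz hz'
    by_cases hd : ∀ z ∈ e.closedSeg, z ∉ f.closedSeg
    · exact (h3 e he f hf hd _ _ _ _ (p1 e he) (p2 e he) (p1 f hf) (p2 f hf) z
        (oseg_subset_seg hz) (oseg_subset_seg hz')).elim
    · push Not at hd
      obtain ⟨w, hw, hw'⟩ := hd
      rcases hD.crosses_or_common he hf hef hw hw' with h | h | h | h | h
      · exact h
      · exact (hef (hD.out_unique e he f hf h)).elim
      · exact (common f hf e he h.symm z hz' hz).elim
      · exact (common e he f hf h z hz hz').elim
      · exact (hef (hD.in_unique e he f hf h)).elim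
  refine ⟨?_, off, ?_, ?_⟩
  · intro s hs s' hs' hps
    by_contra hne
    exact h2 s hs s' hs' hne _ _ (hp s hs) (hp s' hs') hps
  · intro e he f hf
    constructor
    · rintro ⟨hne, z, hz, hz'⟩
      exact cross_of e he f hf (fun h => hne (h ▸ rfl)) z hz hz'
    · intro hc
      refine ⟨?_, h4 e he f hf hc _ _ _ _ (p1 e he) (p2 e he) (p1 f hf) (p2 f hf)⟩
      intro h
      have : e.1 = f.1 := by
        by_contra hne
        exact h2 _ (fst_mem_verts he) _ (fst_mem_verts hf) hne _ _ (p1 e he) (p1 f hf)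
          (congrArg Prod.fst h)
      exact hc.1 (hD.out_unique e he f hf this)
  · intro e he f hf g hg hef heg hfg z z1 z2 z3
    exact h5 e he f hf g hg (cross_of e he f hf hef z z1 z2) (cross_of e he g hg heg z z1 z3)
      (cross_of f hf g hg hfg z z2 z3) _ _ _ _ _ _ (p1 e he) (p2 e he) (p1 f hf) (p2 f hf)
      (p1 g hg) (p2 g hg) z (oseg_subset_seg z1) (oseg_subset_seg z2) (oseg_subset_seg z3)

/-- The thin triangles swept by small movements contain no vertex that was off the edge. -/
theorem eventually_thin : ∀ᶠ η in 𝓝[>] (0 : ℝ), ∀ s ∈ verts D.edges, ∀ e ∈ D.edges,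
    s ≠ e.1 → s ≠ e.2 → ∀ x' a' b' c' : Pt, dist x' s < η →
      (dist a' e.1 < η → dist b' e.2 < η → dist c' e.2 < η → x' ∉ triangle a' b' c') ∧
      (dist a' e.1 < η → dist b' e.1 < η → dist c' e.2 < η → x' ∉ triangle a' b' c') := by
  have hD := D.isCurveSystem
  refine (Set.Finite.eventually_all (verts_finite hD.finite)).2 fun s hs =>
    (Set.Finite.eventually_all hD.finite).2 fun e he => ?_
  by_cases h1 : s = e.1
  · simp [h1]
  by_cases h2 : s = e.2
  · simp [h2]
  have h3 := notMem_of_ne_ends hs he h1 h2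
  filter_upwards [near_tri_pt (a := e.1) (b := e.2) (c := e.2) (x := s) (by rwa [triangle_seg]),
    near_tri_pt (a := e.1) (b := e.1) (c := e.2) (x := s) (by rwa [triangle_seg'])] with
    η k1 k2 _ _ x' a' b' c' hx
  exact ⟨fun ha hb hc => k1 a' b' c' x' ha hb hc hx, fun ha hb hc => k2 a' b' c' x' ha hb hc hx⟩

/-- The segment between two positions of a vertex does not meet the edges at other vertices. -/
theorem eventually_free : ∀ᶠ η in 𝓝[>] (0 : ℝ), ∀ s ∈ verts D.edges, ∀ e ∈ D.edges,
    s ≠ e.1 → s ≠ e.2 → ∀ x' y' a' b' : Pt, dist x' s < η → dist y' s < η →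
      dist a' e.1 < η → dist b' e.2 < η → ∀ z ∈ segment ℝ x' y', z ∉ segment ℝ a' b' := by
  have hD := D.isCurveSystem
  refine (Set.Finite.eventually_all (verts_finite hD.finite)).2 fun s hs =>
    (Set.Finite.eventually_all hD.finite).2 fun e he => ?_
  by_cases h1 : s = e.1
  · simp [h1]
  by_cases h2 : s = e.2
  · simp [h2]
  have h3 := notMem_of_ne_ends hs he h1 h2
  filter_upwards [near_seg_seg (a := s) (b := s) (c := e.1) (d := e.2)
    (by simpa using h3)] with η k1 _ _
  exact k1

/-- The thin triangles at an edge do not meet the edges that are disjoint from it. -/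
theorem eventually_thin_disjoint : ∀ᶠ η in 𝓝[>] (0 : ℝ), ∀ e ∈ D.edges, ∀ f ∈ D.edges,
    (∀ z ∈ e.closedSeg, z ∉ f.closedSeg) → ∀ a' b' c' k' l' : Pt,
      dist k' f.1 < η → dist l' f.2 < η →
      (dist a' e.1 < η → dist b' e.1 < η → dist c' e.2 < η →
        ∀ z ∈ triangle a' b' c', z ∉ segment ℝ k' l') ∧
      (dist a' e.2 < η → dist b' e.2 < η → dist c' e.1 < η →
        ∀ z ∈ triangle a' b' c', z ∉ segment ℝ k' l') := by
  have hD := D.isCurveSystem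
  refine (Set.Finite.eventually_all hD.finite).2 fun e _ =>
    (Set.Finite.eventually_all hD.finite).2 fun f _ => ?_
  by_cases h : ∀ z ∈ e.closedSeg, z ∉ f.closedSeg
  swap
  · exact Eventually.of_forall fun _ h' => (h h').elim
  filter_upwards [near_tri_seg (a := e.1) (b := e.1) (c := e.2) (d := f.1) (e := f.2)
      (by rw [triangle_seg']; exact h),
    near_tri_seg (a := e.2) (b := e.2) (c := e.1) (d := f.1) (e := f.2)
      (by rw [triangle_seg', segment_symm]; exact h)] with η k1 k2 _ a' b' c' k' l' hk hl
  exact ⟨fun ha hb hc => k1 a' b' c' k' l' ha hb hc hk hl,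
    fun ha hb hc => k2 a' b' c' k' l' ha hb hc hk hl⟩

/-- The values of `η` for which all the preceding estimates hold. -/
structure Small (D : MultiKnotoidDiagram) (η : ℝ) : Prop where
  pos : 0 < η
  mapOK : ∀ p, Near D η p → MapOK D p
  thin : ∀ s ∈ verts D.edges, ∀ e ∈ D.edges,
    s ≠ e.1 → s ≠ e.2 → ∀ x' a' b' c' : Pt, dist x' s < η →
      (dist a' e.1 < η → dist b' e.2 < η → dist c' e.2 < η → x' ∉ triangle a' b' c') ∧
      (dist a' e.1 < η → dist b' e.1 < η → dist c' e.2 < η → x' ∉ triangle a' b' c')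
  free : ∀ s ∈ verts D.edges, ∀ e ∈ D.edges,
    s ≠ e.1 → s ≠ e.2 → ∀ x' y' a' b' : Pt, dist x' s < η → dist y' s < η →
      dist a' e.1 < η → dist b' e.2 < η → ∀ z ∈ segment ℝ x' y', z ∉ segment ℝ a' b'
  thin_disjoint : ∀ e ∈ D.edges, ∀ f ∈ D.edges,
    (∀ z ∈ e.closedSeg, z ∉ f.closedSeg) → ∀ a' b' c' k' l' : Pt,
      dist k' f.1 < η → dist l' f.2 < η →
      (dist a' e.1 < η → dist b' e.1 < η → dist c' e.2 < η →
        ∀ z ∈ triangle a' b' c', z ∉ segment ℝ k' l') ∧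
      (dist a' e.2 < η → dist b' e.2 < η → dist c' e.1 < η →
        ∀ z ∈ triangle a' b' c', z ∉ segment ℝ k' l')

theorem exists_small : ∃ η, Small D η := by
  obtain ⟨η, h1, h2, h3, h4, h5⟩ := (D.eventually_mapOK.and (D.eventually_thin.and
    (D.eventually_free.and (D.eventually_thin_disjoint.and self_mem_nhdsWithin)))).exists
  exact ⟨η, h5, h1, h2, h3, h4⟩

/-! ### Moving one vertex -/

variable {D}

theorem pure_side_iff {τ : Label} {e f : Edge} (he : e ∈ D.edges) (hf : f ∈ D.edges)
    (h : Pure D.passesOver τ e) : Side D.passesOver τ e f ↔ e.Crosses f :=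
  ⟨fun h' => (side_mem h').2.2, fun h' => (pure_iff he).1 h f hf h'⟩

/-- The over/under-data of an edge that is pure of the same type in two diagrams agree. -/
theorem passesOver_iff_of_pure {D₁ D₂ : MultiKnotoidDiagram} {τ : Label} {e f : Edge}
    (he₁ : e ∈ D₁.edges) (hf₁ : f ∈ D₁.edges) (he₂ : e ∈ D₂.edges) (hf₂ : f ∈ D₂.edges)
    (h₁ : Pure D₁.passesOver τ e) (h₂ : Pure D₂.passesOver τ e) :
    (D₁.passesOver e f ↔ D₂.passesOver e f) ∧ (D₁.passesOver f e ↔ D₂.passesOver f e) := by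
  have k1 := pure_side_iff he₁ hf₁ h₁
  have k2 := pure_side_iff he₂ hf₂ h₂
  have k3 := pure_iff_side.1 h₁ f
  have k4 := pure_iff_side.1 h₂ f
  cases τ
  · exact ⟨k1.trans k2.symm, iff_of_false k3 k4⟩
  · exact ⟨iff_of_false k3 k4, k1.trans k2.symm⟩

/-- Moving the common vertex `b` of the edges `(a, b)` and `(b, c)` to `v` is the composition of a
move that inserts `v` into `(a, b)` and the inverse of a move that inserts `b` into `(v, c)`. New
crossings between `(a, v)` and `(b, c)` are compatible with both moves, as the first is done on the
side `σ` and the second on the other side. -/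
theorem isotopic_slide {D₁ D₂ : MultiKnotoidDiagram} {E : Set Edge} {a b c v : Pt} (σ : Label)
    (hE₁ : D₁.edges = E ∪ {(a, b), (b, c)}) (hE₂ : D₂.edges = E ∪ {(a, v), (v, c)})
    (hab : (a, b) ∉ E) (hvc : (v, c) ∉ E)
    (hleg : D₂.leg = D₁.leg) (hhead : D₂.head = D₁.head)
    (hR : ∀ e ∈ E, ∀ f ∈ E, (D₂.passesOver e f ↔ D₁.passesOver e f))
    (p₁ : Pure D₁.passesOver σ (a, b)) (p₂ : Pure D₁.passesOver σ.flip (b, c))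
    (q₁ : Pure D₂.passesOver σ (a, v)) (q₂ : Pure D₂.passesOver σ.flip (v, c))
    (hI : Insertable D₁.edges a b v)
    (hfree : ∀ f ∈ E, ∀ z ∈ segment ℝ v b, z ∉ f.closedSeg)
    (t₁ : ∀ p, (p = D₁.leg ∨ p = D₁.head) → p ∈ triangle a b v → p = a ∨ p = b)
    (t₂ : ∀ p, (p = D₁.leg ∨ p = D₁.head) → p ∈ triangle v c b → p = v ∨ p = c) :
    Isotopic D₁ D₂ := by
  obtain ⟨M, hM, hME, hMl, hMh, hMR, hM1, hM2⟩ := exists_insert σ hI p₁ t₁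
  refine hM.trans (Isotopic.symm (Isotopic.of_delta ?_))
  have bcE : (b, c) ∈ D₁.edges := by rw [hE₁]; simp
  have avE : (a, v) ∈ D₂.edges := by rw [hE₂]; simp
  have vcE : (v, c) ∈ D₂.edges := by rw [hE₂]; simp
  have hbc : b ≠ c := D₁.isCurveSystem.nondegenerate _ bcE
  have hab' : a ≠ b := D₁.isCurveSystem.nondegenerate _ hI.mem
  have hva : v ≠ a := hI.ne_left
  have hE₁' : ∀ e ∈ E, e ∈ D₁.edges := fun e he => by rw [hE₁]; exact Or.inl he
  have hE₂' : ∀ e ∈ E, e ∈ D₂.edges := fun e he => by rw [hE₂]; exact Or.inl he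
  have hEab : ∀ e ∈ E, e ≠ (a, b) := fun e he h => hab (h ▸ he)
  have hEM : ∀ e ∈ E, e ∈ M.edges := fun e he => by
    rw [hME]; exact rest_mem_insertEdges (hE₁' e he) (hEab e he)
  have bc_ne : ((b, c) : Edge) ≠ (a, b) := fun h => hab' (congrArg Prod.fst h).symm
  have bcM : (b, c) ∈ M.edges := by rw [hME]; exact rest_mem_insertEdges bcE bc_ne
  have avM : (a, v) ∈ M.edges := by rw [hME]; exact left_mem_insertEdges
  have vbM : (v, b) ∈ M.edges := by rw [hME]; exact right_mem_insertEdges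
  have memM : ∀ e ∈ M.edges, e ∈ E ∨ e = (b, c) ∨ e = (a, v) ∨ e = (v, b) := by
    intro e he
    rw [hME] at he
    rcases mem_insertEdges.1 he with ⟨he, hea⟩ | rfl | rfl
    · rw [hE₁] at he
      rcases he with he | rfl | rfl
      · exact Or.inl he
      · exact (hea rfl).elim
      · tauto
    · tauto
    · tauto
  have hMc := M.isCurveSystem
  refine deltaMove_of_pure (c := b) σ.flip vcE ?_ (hMl.trans hleg.symm)
    (hMh.trans hhead.symm) ?_ ?_ q₂
    ?_ ?_
  · ext e
    rw [mem_insertEdges, hE₂]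
    constructor
    · intro he
      rcases memM e he with h | rfl | rfl | rfl
      · exact Or.inl ⟨Or.inl h, fun h' => hvc (h' ▸ h)⟩
      · tauto
      · exact Or.inl ⟨Or.inr (Or.inl rfl), fun h' => hva (congrArg Prod.fst h').symm⟩
      · tauto
    · rintro (⟨h | h | h, h'⟩ | rfl | rfl)
      · exact hEM e h
      · exact h ▸ avM
      · exact (h' h).elim
      · exact vbM
      · exact bcM
  · intro p hp hm
    rw [hleg, hhead] at hp
    exact t₂ p hp hm
  · have key : ∀ e ∈ D₂.edges \ {(v, c)}, e ∈ E ∨ e = (a, v) := by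
      rintro e ⟨he, hne⟩
      rw [hE₂] at he
      rcases he with he | he | he
      · exact Or.inl he
      · exact Or.inr he
      · exact (hne he).elim
    intro e he f hf
    rcases key e he with h1 | rfl <;> rcases key f hf with h2 | rfl
    · rw [hMR e (hE₁' e h1) f (hE₁' f h2) (hEab e h1) (hEab f h2), hR e h1 f h2]
    · exact (passesOver_iff_of_pure avM (hEM e h1) avE (hE₂' e h1) hM1 q₁).2
    · exact (passesOver_iff_of_pure avM (hEM f h2) avE (hE₂' f h2) hM1 q₁).1
    · exact (passesOver_iff_of_pure avM avM avE avE hM1 q₁).1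
  · apply pure_of_not_crosses
    rintro f hf hc
    rcases memM f hf with h | rfl | rfl | rfl
    · obtain ⟨-, z, hz, hz'⟩ := hc
      exact hfree f h z (oseg_subset_seg hz) (oseg_subset_seg hz')
    · exact hMc.not_crosses_of_common vbM bcM (Or.inr (Or.inr (Or.inl rfl))) hc
    · exact hMc.not_crosses_of_common vbM avM (Or.inr (Or.inl rfl)) hc
    · exact hc.1 rfl
  · rw [pure_iff bcM]
    intro f hf hc
    rcases memM f hf with h | rfl | rfl | rfl
    · have h1 := (pure_iff bcE).1 p₂ f (hE₁' f h) hc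
      have e1 := hMR _ bcE f (hE₁' f h) bc_ne (hEab f h)
      have e2 := hMR f (hE₁' f h) _ bcE (hEab f h) bc_ne
      cases σ
      · exact e2.2 h1
      · exact e1.2 h1
    · exact (hc.1 rfl).elim
    · exact side_comm.1 ((pure_iff avM).1 hM1 _ bcM hc.symm)
    · exact (hMc.not_crosses_of_common bcM vbM (Or.inr (Or.inl rfl)) hc).elim

end MultiKnotoidDiagram

end PLKnotoid

namespace PLKnotoid

namespace MultiKnotoidDiagram

variable {D : MultiKnotoidDiagram}

theorem Near.update {η : ℝ} {p : Pt → Pt} (hp : Near D η p) {v w : Pt}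
    (hw : dist w v < η) : Near D η (Function.update p v w) := by
  intro s hs
  by_cases h : s = v
  · subst h; simpa using hw
  · simpa [h] using hp s hs

theorem isotopic_move_generic (hf : Fine D) {η : ℝ} (hS : Small D η) {p : Pt → Pt}
    (hp : Near D η p) {v : Pt} (hv : v ∈ verts D.edges) (hvl : v ≠ D.leg) (hvh : v ≠ D.head)
    {w : Pt} (hw : dist w v < η) {X : Set Pt}
    (hX : verts (hS.mapOK p hp).diagram.edges ⊆ X)
    (hX' : crossPts (hS.mapOK p hp).diagram.edges ⊆ X) (hgen : Generic X w) :
    Isotopic (hS.mapOK p hp).diagram (hS.mapOK _ (Near.update hp hw)).diagram := by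
  have hD := D.isCurveSystem
  set h₁ := hS.mapOK p hp
  set h₂ := hS.mapOK _ (Near.update hp hw)
  set p' := Function.update p v w with hp'
  obtain ⟨e, he, hev⟩ := exists_in_edge hv hvl
  obtain ⟨f, hfE, hfv⟩ := exists_out_edge hv hvh
  have e1v : e.1 ≠ v := fun h => hD.nondegenerate e he (h.trans hev.symm)
  have f2v : f.2 ≠ v := fun h => hD.nondegenerate f hfE (hfv.trans h.symm)
  have hef : e ≠ f := fun h => e1v (by rw [h]; exact hfv)
  have pe1 : p' e.1 = p e.1 := by simp [hp', e1v]
  have pf2 : p' f.2 = p f.2 := by simp [hp', f2v]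
  have pv : p' v = w := by simp [hp']
  have rest1 : ∀ g ∈ D.edges, g ≠ e → g ≠ f → g.1 ≠ v ∧ g.2 ≠ v := by
    intro g hg hge hgf
    exact ⟨fun h => hgf (hD.out_unique g hg f hfE (h.trans hfv.symm)),
      fun h => hge (hD.in_unique g hg e he (h.trans hev.symm))⟩
  have rest2 : ∀ g ∈ D.edges, g ≠ e → g ≠ f → mapEdge p' g = mapEdge p g := by
    intro g hg hge hgf
    obtain ⟨h1, h2⟩ := rest1 g hg hge hgf
    simp [mapEdge, hp', h1, h2]
  have ee : mapEdge p e = (p e.1, p v) := by rw [← hev]; rfl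
  have ff : mapEdge p f = (p v, p f.2) := by rw [← hfv]; rfl
  have ee' : mapEdge p' e = (p e.1, w) := by rw [← pe1, ← pv, ← hev]; rfl
  have ff' : mapEdge p' f = (w, p f.2) := by rw [← pf2, ← pv, ← hfv]; rfl
  obtain ⟨σ, hσe, hσf⟩ := hf.consecutive e he f hfE (hev.trans hfv.symm)
  have edges₁ : h₁.diagram.edges = mapEdge p '' {g ∈ D.edges | g ≠ e ∧ g ≠ f} ∪
      {(p e.1, p v), (p v, p f.2)} := by
    ext g
    constructor
    · rintro ⟨g, hg, rfl⟩
      by_cases h1 : g = e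
      · subst h1; exact Or.inr (Or.inl ee)
      by_cases h2 : g = f
      · subst h2; exact Or.inr (Or.inr ff)
      exact Or.inl ⟨g, ⟨hg, h1, h2⟩, rfl⟩
    · rintro (⟨g, hg, rfl⟩ | rfl | rfl)
      · exact ⟨g, hg.1, rfl⟩
      · exact ⟨e, he, ee⟩
      · exact ⟨f, hfE, ff⟩
  have edges₂ : h₂.diagram.edges = mapEdge p '' {g ∈ D.edges | g ≠ e ∧ g ≠ f} ∪
      {(p e.1, w), (w, p f.2)} := by
    ext g
    constructor
    · rintro ⟨g, hg, rfl⟩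
      by_cases h1 : g = e
      · subst h1; exact Or.inr (Or.inl ee')
      by_cases h2 : g = f
      · subst h2; exact Or.inr (Or.inr ff')
      exact Or.inl ⟨g, ⟨hg, h1, h2⟩, (rest2 g hg h1 h2).symm⟩
    · rintro (⟨g, hg, rfl⟩ | rfl | rfl)
      · exact ⟨g, hg.1, rest2 g hg.1 hg.2.1 hg.2.2⟩
      · exact ⟨e, he, ee'⟩
      · exact ⟨f, hfE, ff'⟩
  have abE : (p e.1, p v) ∈ h₁.diagram.edges := ⟨e, he, ee⟩
  refine isotopic_slide σ edges₁ edges₂ ?_ ?_ ?_ ?_ ?_ ?_ ?_ ?_ ?_ ?_ ?_ ?_ ?_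
  · rintro ⟨g, hg, h⟩
    exact hg.2.1 (h₁.mapEdge_inj hg.1 he (h.trans ee.symm))
  · rintro ⟨g, hg, h⟩
    rw [← rest2 g hg.1 hg.2.1 hg.2.2, ← ff'] at h
    exact hg.2.2 (h₂.mapEdge_inj hg.1 hfE h)
  · show p' D.leg = p D.leg
    simp [hp', hvl.symm]
  · show p' D.head = p D.head
    simp [hp', hvh.symm]
  · rintro _ ⟨g, hg, rfl⟩ _ ⟨k, hk, rfl⟩
    rw [h₁.diagram_passesOver_iff hg.1 hk.1, ← rest2 g hg.1 hg.2.1 hg.2.2,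
      ← rest2 k hk.1 hk.2.1 hk.2.2, h₂.diagram_passesOver_iff hg.1 hk.1]
  · rw [← ee, h₁.pure_iff he]; exact hσe
  · rw [← ff, h₁.pure_iff hfE]; exact hσf
  · rw [← ee', h₂.pure_iff he]; exact hσe
  · rw [← ff', h₂.pure_iff hfE]; exact hσf
  · exact insertable_of_generic abE hX hX' hgen
  · rintro _ ⟨g, hg, rfl⟩ z hz
    obtain ⟨h1, h2⟩ := rest1 g hg.1 hg.2.1 hg.2.2
    exact hS.free v hv g hg.1 h1.symm h2.symm _ _ _ _ hw (hp v hv) (hp _ (fst_mem_verts hg.1))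
      (hp _ (snd_mem_verts hg.1)) z hz
  · have key : ∀ s ∈ verts D.edges, s ≠ v → p s ∈ triangle (p e.1) (p v) w →
        p s = p e.1 ∨ p s = p v := by
      intro s hs hsv hm
      by_cases h1 : s = e.1
      · exact Or.inl (h1 ▸ rfl)
      · exact ((hS.thin s hs e he h1 (by rw [hev]; exact hsv) _ _ _ _ (hp s hs)).1
          (hp _ (fst_mem_verts he)) (by rw [hev]; exact hp v hv) (by rw [hev]; exact hw) hm).elim
    rintro q (rfl | rfl) hm
    · exact key _ D.leg_mem_verts hvl.symm hm
    · exact key _ D.head_mem_verts hvh.symm hm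
  · have key : ∀ s ∈ verts D.edges, s ≠ v → p s ∈ triangle w (p f.2) (p v) →
        p s = w ∨ p s = p f.2 := by
      intro s hs hsv hm
      rw [triangle_swap_right] at hm
      by_cases h1 : s = f.2
      · exact Or.inr (h1 ▸ rfl)
      · exact ((hS.thin s hs f hfE (by rw [hfv]; exact hsv) h1 _ _ _ _ (hp s hs)).2
          (by rw [hfv]; exact hw) (by rw [hfv]; exact hp v hv) (hp _ (snd_mem_verts hfE)) hm).elim
    rintro q (rfl | rfl) hm
    · exact key _ D.leg_mem_verts hvl.symm hm
    · exact key _ D.head_mem_verts hvh.symm hm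

/-- A triangle with corner `c` meets a segment that starts at `c` only there, if the opposite side
does not meet the segment and the end of the segment is not in the triangle. -/
theorem seg_inter_triangle {c d y₁ y₂ : Pt} (h1 : ∀ z ∈ segment ℝ y₁ y₂, z ∉ segment ℝ c d)
    (h2 : d ∉ triangle y₁ y₂ c) : segment ℝ c d ∩ triangle y₁ y₂ c ⊆ {c} := by
  rintro z ⟨hz, hz'⟩
  rw [triangle_rotate] at hz' h2
  obtain ⟨m, hm, hzm⟩ := mem_triangle_iff.1 hz'
  have h3 : d ∉ segment ℝ c m := fun h => h2 (mem_triangle_iff.2 ⟨m, hm, h⟩)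
  exact seg_inter_of_common_end h3 (h1 m hm) hz hzm

theorem isotopic_move_leg (hf : Fine D) {η : ℝ} (hS : Small D η) {p q : Pt → Pt}
    (hp : Near D η p) (hq : Near D η q) (hpq : ∀ s ∈ verts D.edges, s ≠ D.leg → p s = q s) :
    Isotopic (hS.mapOK p hp).diagram (hS.mapOK q hq).diagram := by
  have hD := D.isCurveSystem
  set h₁ := hS.mapOK p hp
  set h₂ := hS.mapOK q hq
  obtain ⟨e, he, hel⟩ := D.exists_leg_edge
  have ee : mapEdge p e = (p D.leg, p e.2) := by rw [← hel]; rfl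
  have hq2 : q e.2 = p e.2 := (hpq _ (snd_mem_verts he) (ne_leg he)).symm
  have ee' : mapEdge q e = (q D.leg, p e.2) := by rw [← hel, ← hq2]; rfl
  have rest1 : ∀ g ∈ D.edges, g ≠ e → g.1 ≠ D.leg := fun g hg hge h =>
    hge (hD.out_unique g hg e he (h.trans hel.symm))
  have rest2 : ∀ g ∈ D.edges, g ≠ e → mapEdge p g = mapEdge q g := fun g hg hge =>
    Prod.ext (hpq _ (fst_mem_verts hg) (rest1 g hg hge)) (hpq _ (snd_mem_verts hg) (ne_leg hg))
  refine Relation.EqvGen.rel _ _ (Or.inr (Or.inr (Or.inl ⟨q D.leg, p e.2, ⟨e, he, ee⟩, ?_, rfl,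
    (hpq _ D.head_mem_verts ?_).symm, ?_, ?_⟩)))
  · ext g
    constructor
    · rintro ⟨g, hg, rfl⟩
      by_cases hge : g = e
      · subst hge; exact Or.inr ee'
      · refine Or.inl ⟨⟨g, hg, rest2 g hg hge⟩, fun h => hge (h₁.mapEdge_inj hg he ?_)⟩
        rw [rest2 g hg hge, ee]; exact h
    · rintro (⟨⟨g, hg, rfl⟩, hne⟩ | rfl)
      · have hge : g ≠ e := by rintro rfl; exact hne ee
        exact ⟨g, hg, (rest2 g hg hge).symm⟩
      · exact ⟨e, he, ee'⟩
  · obtain ⟨k, hk, hkh⟩ := D.exists_head_edge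
    rw [← hkh]; exact ne_leg hk
  · rintro _ ⟨⟨g, hg, rfl⟩, hne⟩
    have hge : g ≠ e := by rintro rfl; exact hne ee
    have hpl : dist (p D.leg) D.leg < η := hp _ D.leg_mem_verts
    have hql : dist (q D.leg) D.leg < η := hq _ D.leg_mem_verts
    have hp2 := hp _ (snd_mem_verts he)
    by_cases hadj : g.1 = e.2
    · have hgs : (mapEdge p g).closedSeg = segment ℝ (p e.2) (p g.2) := by rw [← hadj]; rfl
      rw [hgs]
      apply seg_inter_triangle
      · intro z hz hz'
        refine hS.free _ D.leg_mem_verts g hg (rest1 g hg hge).symm (ne_leg hg).symm _ _ _ _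
          hpl hql (hp _ (fst_mem_verts hg)) (hp _ (snd_mem_verts hg)) z hz ?_
        rw [hadj]; exact hz'
      · exact (hS.thin g.2 (snd_mem_verts hg) e he (by rw [hel]; exact ne_leg hg)
          (fun h => hD.nondegenerate g hg (hadj.trans h.symm)) _ _ _ _
          (hp _ (snd_mem_verts hg))).2 (by rw [hel]; exact hpl) (by rw [hel]; exact hql) hp2
    · rintro z ⟨hz, hz'⟩
      exfalso
      have hdis : ∀ z ∈ e.closedSeg, z ∉ g.closedSeg := by
        intro z hz hz'
        rcases hD.crosses_or_common he hg hge.symm hz hz' with h | h | h | h | h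
        · exact hf.leg e he hel g hg h
        · exact rest1 g hg hge (h.symm.trans hel)
        · exact ne_leg hg (h.symm.trans hel)
        · exact hadj h.symm
        · exact hge (hD.in_unique g hg e he h.symm)
      exact (hS.thin_disjoint e he g hg hdis _ _ _ _ _ (hp _ (fst_mem_verts hg))
        (hp _ (snd_mem_verts hg))).1 (by rw [hel]; exact hpl) (by rw [hel]; exact hql) hp2 z hz' hz
  · have key : ∀ g k, D.passesOver g k → g ≠ e ∧ k ≠ e := by
      intro g k h
      obtain ⟨hg, hk, hc⟩ := hD.passesOver_crosses _ _ h
      constructor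
      · rintro rfl; exact hf.leg _ he hel k hk hc
      · rintro rfl; exact hf.leg _ he hel g hg hc.symm
    intro g k
    constructor
    · rintro ⟨g, k, h, rfl, rfl⟩
      obtain ⟨hg, hk, -⟩ := hD.passesOver_crosses _ _ h
      exact ⟨g, k, h, (rest2 g hg (key g k h).1).symm, (rest2 k hk (key g k h).2).symm⟩
    · rintro ⟨g, k, h, rfl, rfl⟩
      obtain ⟨hg, hk, -⟩ := hD.passesOver_crosses _ _ h
      exact ⟨g, k, h, rest2 g hg (key g k h).1, rest2 k hk (key g k h).2⟩

theorem isotopic_move_head (hf : Fine D) {η : ℝ} (hS : Small D η) {p q : Pt → Pt}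
    (hp : Near D η p) (hq : Near D η q) (hpq : ∀ s ∈ verts D.edges, s ≠ D.head → p s = q s) :
    Isotopic (hS.mapOK p hp).diagram (hS.mapOK q hq).diagram := by
  have hD := D.isCurveSystem
  set h₁ := hS.mapOK p hp
  set h₂ := hS.mapOK q hq
  obtain ⟨e, he, hel⟩ := D.exists_head_edge
  have ee : mapEdge p e = (p e.1, p D.head) := by rw [← hel]; rfl
  have hq2 : q e.1 = p e.1 := (hpq _ (fst_mem_verts he) (ne_head he)).symm
  have ee' : mapEdge q e = (p e.1, q D.head) := by rw [← hel, ← hq2]; rfl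
  have rest1 : ∀ g ∈ D.edges, g ≠ e → g.2 ≠ D.head := fun g hg hge h =>
    hge (hD.in_unique g hg e he (h.trans hel.symm))
  have rest2 : ∀ g ∈ D.edges, g ≠ e → mapEdge p g = mapEdge q g := fun g hg hge =>
    Prod.ext (hpq _ (fst_mem_verts hg) (ne_head hg)) (hpq _ (snd_mem_verts hg) (rest1 g hg hge))
  refine Relation.EqvGen.rel _ _ (Or.inr (Or.inr (Or.inr ⟨q D.head, p e.1, ⟨e, he, ee⟩, ?_,
    (hpq _ D.leg_mem_verts ?_).symm, rfl, ?_, ?_⟩)))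
  · ext g
    constructor
    · rintro ⟨g, hg, rfl⟩
      by_cases hge : g = e
      · subst hge; exact Or.inr ee'
      · refine Or.inl ⟨⟨g, hg, rest2 g hg hge⟩, fun h => hge (h₁.mapEdge_inj hg he ?_)⟩
        rw [rest2 g hg hge, ee]; exact h
    · rintro (⟨⟨g, hg, rfl⟩, hne⟩ | rfl)
      · have hge : g ≠ e := by rintro rfl; exact hne ee
        exact ⟨g, hg, (rest2 g hg hge).symm⟩
      · exact ⟨e, he, ee'⟩
  · obtain ⟨k, hk, hkh⟩ := D.exists_leg_edge
    rw [← hkh]; exact ne_head hk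
  · rintro _ ⟨⟨g, hg, rfl⟩, hne⟩
    have hge : g ≠ e := by rintro rfl; exact hne ee
    have hpl : dist (p D.head) D.head < η := hp _ D.head_mem_verts
    have hql : dist (q D.head) D.head < η := hq _ D.head_mem_verts
    have hp2 := hp _ (fst_mem_verts he)
    by_cases hadj : g.2 = e.1
    · have hgs : (mapEdge p g).closedSeg = segment ℝ (p e.1) (p g.1) := by
        rw [← hadj, segment_symm]; rfl
      rw [hgs]
      apply seg_inter_triangle
      · intro z hz hz'
        refine hS.free _ D.head_mem_verts g hg (ne_head hg).symm (rest1 g hg hge).symm _ _ _ _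
          hpl hql (hp _ (fst_mem_verts hg)) (hp _ (snd_mem_verts hg)) z hz ?_
        rw [hadj, segment_symm]; exact hz'
      · rw [triangle_rotate]
        exact (hS.thin g.1 (fst_mem_verts hg) e he
          (fun h => hD.nondegenerate g hg (h.trans hadj.symm)) (by rw [hel]; exact ne_head hg)
          _ _ _ _ (hp _ (fst_mem_verts hg))).1 hp2 (by rw [hel]; exact hpl)
          (by rw [hel]; exact hql)
    · rintro z ⟨hz, hz'⟩
      exfalso
      have hdis : ∀ z ∈ e.closedSeg, z ∉ g.closedSeg := by
        intro z hz hz'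
        rcases hD.crosses_or_common he hg hge.symm hz hz' with h | h | h | h | h
        · exact hf.head e he hel g hg h
        · exact hge (hD.out_unique g hg e he h.symm)
        · exact hadj h.symm
        · exact ne_head hg (h.symm.trans hel)
        · exact rest1 g hg hge (h.symm.trans hel)
      exact (hS.thin_disjoint e he g hg hdis _ _ _ _ _ (hp _ (fst_mem_verts hg))
        (hp _ (snd_mem_verts hg))).2 (by rw [hel]; exact hpl) (by rw [hel]; exact hql) hp2 z hz' hz
  · have key : ∀ g k, D.passesOver g k → g ≠ e ∧ k ≠ e := by
      intro g k h
      obtain ⟨hg, hk, hc⟩ := hD.passesOver_crosses _ _ h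
      constructor
      · rintro rfl; exact hf.head _ he hel k hk hc
      · rintro rfl; exact hf.head _ he hel g hg hc.symm
    intro g k
    constructor
    · rintro ⟨g, k, h, rfl, rfl⟩
      obtain ⟨hg, hk, -⟩ := hD.passesOver_crosses _ _ h
      exact ⟨g, k, h, (rest2 g hg (key g k h).1).symm, (rest2 k hk (key g k h).2).symm⟩
    · rintro ⟨g, k, h, rfl, rfl⟩
      obtain ⟨hg, hk, -⟩ := hD.passesOver_crosses _ _ h
      exact ⟨g, k, h, rest2 g hg (key g k h).1, rest2 k hk (key g k h).2⟩

theorem isotopic_move_vertex (hf : Fine D) {η : ℝ} (hS : Small D η) {p q : Pt → Pt}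
    (hp : Near D η p) (hq : Near D η q) {v : Pt} (hv : v ∈ verts D.edges)
    (hpq : ∀ s ∈ verts D.edges, s ≠ v → p s = q s) :
    Isotopic (hS.mapOK p hp).diagram (hS.mapOK q hq).diagram := by
  by_cases hvl : v = D.leg
  · subst hvl; exact isotopic_move_leg hf hS hp hq hpq
  by_cases hvh : v = D.head
  · subst hvh; exact isotopic_move_head hf hS hp hq hpq
  set h₁ := hS.mapOK p hp with h₁def
  set h₂ := hS.mapOK q hq with h₂def
  set X : Set Pt := (verts h₁.diagram.edges ∪ crossPts h₁.diagram.edges) ∪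
    (verts h₂.diagram.edges ∪ crossPts h₂.diagram.edges) with hX
  have hXf : X.Finite :=
    ((verts_finite h₁.diagram.isCurveSystem.finite).union
      h₁.diagram.isCurveSystem.crossPts_finite).union
    ((verts_finite h₂.diagram.isCurveSystem.finite).union
      h₂.diagram.isCurveSystem.crossPts_finite)
  obtain ⟨w, hw, hgen⟩ := exists_generic hXf (Metric.isOpen_ball (x := v) (ε := η))
    ⟨v, Metric.mem_ball_self hS.pos⟩
  have k1 := isotopic_move_generic hf hS hp hv hvl hvh (X := X) hw
    (fun _ h => Or.inl (Or.inl h)) (fun _ h => Or.inl (Or.inr h)) hgen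
  have k2 := isotopic_move_generic hf hS hq hv hvl hvh (X := X) hw
    (fun _ h => Or.inr (Or.inl h)) (fun _ h => Or.inr (Or.inr h)) hgen
  have heq : (hS.mapOK _ (Near.update hp hw)).diagram =
      (hS.mapOK _ (Near.update hq hw)).diagram := by
    apply toDiagramData_inj
    apply map_congr (D := D)
    intro s hs
    by_cases h : s = v
    · simp [h]
    · simp [h, hpq s hs h]
  rw [heq] at k1
  exact k1.trans k2.symm

/-- Sufficiently small movements of the vertices of a fine diagram are isotopies. -/
theorem isotopic_of_near (hf : Fine D) {η : ℝ} (hS : Small D η) {q : Pt → Pt}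
    (hq : Near D η q) : Isotopic D (hS.mapOK q hq).diagram := by
  classical
  have hfin := verts_finite D.isCurveSystem.finite
  have key : ∀ T : Finset Pt, (T : Set Pt) ⊆ verts D.edges →
      ∃ h : Near D η (fun s => if s ∈ T then q s else s),
        Isotopic D (hS.mapOK _ h).diagram := by
    intro T
    induction T using Finset.induction_on with
    | empty =>
      intro _
      have h : Near D η (fun s => if s ∈ (∅ : Finset Pt) then q s else s) := by
        intro s _; simpa using hS.pos
      refine ⟨h, ?_⟩
      have : (hS.mapOK _ h).diagram = D := by
        apply toDiagramData_inj
        refine Eq.trans ?_ D.toDiagramData.map_id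
        exact map_congr (D := D) fun s _ => by simp
      rw [this]
      exact Isotopic.refl D
    | insert v T hvT ih =>
      intro hT
      rw [Finset.coe_insert] at hT
      obtain ⟨h, hiso⟩ := ih (fun s hs => hT (Or.inr hs))
      have hv : v ∈ verts D.edges := hT (Or.inl rfl)
      have h' : Near D η (fun s => if s ∈ insert v T then q s else s) := by
        intro s hs
        by_cases h : s ∈ insert v T
        · simpa only [h, if_true] using hq s hs
        · simp only [h, if_false, dist_self]; exact hS.pos
      refine ⟨h', hiso.trans (isotopic_move_vertex hf hS h h' hv ?_)⟩
      intro s _ hsv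
      simp [hsv]
  obtain ⟨h, hiso⟩ := key hfin.toFinset (by simp)
  have : (hS.mapOK _ h).diagram = (hS.mapOK q hq).diagram := by
    apply toDiagramData_inj
    exact map_congr (D := D) fun s hs => by simp [hs]
  rwa [this] at hiso

/-! ### Isotopies that move the whole plane -/

/-- An injective map of the plane that is affine on every edge of `D`. -/
structure EdgeAffine (D : MultiKnotoidDiagram) (φ : Pt → Pt) : Prop where
  inj : Function.Injective φ
  affine : ∀ e ∈ D.edges, ∀ s : ℝ, 0 ≤ s → s ≤ 1 →
    φ (AffineMap.lineMap e.1 e.2 s) = AffineMap.lineMap (φ e.1) (φ e.2) s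

namespace EdgeAffine

variable {φ : Pt → Pt}

theorem seg (h : EdgeAffine D φ) {e : Edge} (he : e ∈ D.edges) :
    (mapEdge φ e).closedSeg = φ '' e.closedSeg := by
  ext z
  simp only [Edge.closedSeg, mapEdge, segment_eq_image_lineMap, Set.mem_image]
  constructor
  · rintro ⟨s, hs, rfl⟩
    exact ⟨_, ⟨s, hs, rfl⟩, h.affine e he s hs.1 hs.2⟩
  · rintro ⟨_, ⟨s, hs, rfl⟩, rfl⟩
    exact ⟨s, hs, (h.affine e he s hs.1 hs.2).symm⟩

theorem oseg (h : EdgeAffine D φ) {e : Edge} (he : e ∈ D.edges) :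
    (mapEdge φ e).openSeg = φ '' e.openSeg := by
  ext z
  simp only [Edge.openSeg, mapEdge, openSegment_eq_image_lineMap, Set.mem_image]
  constructor
  · rintro ⟨s, hs, rfl⟩
    exact ⟨_, ⟨s, hs, rfl⟩, h.affine e he s hs.1.le hs.2.le⟩
  · rintro ⟨_, ⟨s, hs, rfl⟩, rfl⟩
    exact ⟨s, hs, (h.affine e he s hs.1.le hs.2.le).symm⟩

theorem mapOK (h : EdgeAffine D φ) : MapOK D φ := by
  have hD := D.isCurveSystem
  refine ⟨fun s _ s' _ hs => h.inj hs, ?_, ?_, ?_⟩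
  · rintro s ⟨f, hf, hs⟩ e he hm
    have hm' : φ s ∈ (mapEdge φ e).closedSeg := hm
    rw [h.seg he, h.inj.mem_set_image] at hm'
    exact hD.vertex_off_edge f hf e he s hs hm'
  · intro e he f hf
    constructor
    · rintro ⟨hne, z, hz, hz'⟩
      rw [h.oseg he] at hz
      rw [h.oseg hf] at hz'
      obtain ⟨w, hw, rfl⟩ := hz
      rw [h.inj.mem_set_image] at hz'
      exact ⟨fun h => hne (h ▸ rfl), w, hw, hz'⟩
    · rintro ⟨hne, z, hz, hz'⟩
      refine ⟨fun h' => hne (Prod.ext (h.inj (congrArg Prod.fst h'))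
        (h.inj (congrArg Prod.snd h'))), φ z, ?_, ?_⟩
      · rw [h.oseg he]; exact ⟨z, hz, rfl⟩
      · rw [h.oseg hf]; exact ⟨z, hz', rfl⟩
  · intro e he f hf g hg hef heg hfg z h1 h2 h3
    rw [h.oseg he] at h1
    rw [h.oseg hf] at h2
    rw [h.oseg hg] at h3
    obtain ⟨w, hw, rfl⟩ := h1
    rw [h.inj.mem_set_image] at h2 h3
    exact Set.eq_empty_iff_forall_notMem.1 (hD.no_triple_point e he f hf g hg hef heg hfg) w
      ⟨⟨hw, h2⟩, h3⟩

/-- Subdividing commutes with maps that are affine on the edges. -/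
theorem cut (h : EdgeAffine D φ) {D' : MultiKnotoidDiagram} {a b c : Pt} (hc : IsCut D D' a b c) :
    ∃ h' : EdgeAffine D' φ, Isotopic h.mapOK.diagram h'.mapOK.diagram := by
  have hI := hc.insertable
  have hs := oseg_subset_seg hc.inside
  have hsub : ∀ e ∈ D'.edges, ∀ s : ℝ, 0 ≤ s → s ≤ 1 →
      φ (AffineMap.lineMap e.1 e.2 s) = AffineMap.lineMap (φ e.1) (φ e.2) s := by
    intro e he s h0 h1
    rw [hc.edges_eq] at he
    have hin := hc.inside
    rw [openSegment_eq_image_lineMap] at hin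
    obtain ⟨r, ⟨r0, r1⟩, hr⟩ := hin
    have aff := h.affine (a, b) hc.mem
    have hφc : φ c = AffineMap.lineMap (φ a) (φ b) r := by rw [← hr]; exact aff r r0.le r1.le
    rcases mem_insertEdges.1 he with ⟨he, -⟩ | rfl | rfl
    · exact h.affine e he s h0 h1
    · have e1 : ∀ x y : Pt, AffineMap.lineMap x (AffineMap.lineMap x y r) s
          = (AffineMap.lineMap x y (s * r) : Pt) := by
        intro x y; simp only [AffineMap.lineMap_apply, vsub_eq_sub, vadd_eq_add]; module
      show φ (AffineMap.lineMap a c s) = AffineMap.lineMap (φ a) (φ c) s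
      rw [hφc, ← hr, e1, e1]
      exact aff (s * r) (by positivity) (by nlinarith)
    · have e1 : ∀ x y : Pt, AffineMap.lineMap (AffineMap.lineMap x y r) y s
          = (AffineMap.lineMap x y (r + s * (1 - r)) : Pt) := by
        intro x y; simp only [AffineMap.lineMap_apply, vsub_eq_sub, vadd_eq_add]; module
      show φ (AffineMap.lineMap c b s) = AffineMap.lineMap (φ c) (φ b) s
      rw [hφc, ← hr, e1, e1]
      exact aff (r + s * (1 - r)) (by nlinarith) (by nlinarith)
  have h' : EdgeAffine D' φ := ⟨h.inj, hsub⟩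
  refine ⟨h', Relation.EqvGen.rel _ _ (Or.inl ⟨φ a, φ b, φ c, ⟨(a, b), hc.mem, rfl⟩, ?_, ?_,
    congrArg φ hc.leg_eq, congrArg φ hc.head_eq, ?_, ?_⟩)⟩
  · have : φ c ∈ (mapEdge φ (a, b)).openSeg := by
      rw [h.oseg hc.mem]; exact ⟨c, hc.inside, rfl⟩
    exact this
  · have hE : h'.mapOK.diagram.edges = mapEdge φ '' D'.edges := rfl
    rw [hE, hc.edges_eq]
    ext e
    constructor
    · rintro ⟨e, he, rfl⟩
      rcases mem_insertEdges.1 he with ⟨he, hea⟩ | rfl | rfl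
      · exact Or.inl ⟨⟨e, he, rfl⟩, fun h1 => hea (h.mapOK.mapEdge_inj he hc.mem h1)⟩
      · exact Or.inr (Or.inl rfl)
      · exact Or.inr (Or.inr rfl)
    · rintro (⟨⟨e, he, rfl⟩, hne⟩ | rfl | rfl)
      · exact ⟨e, rest_mem_insertEdges he (by rintro rfl; exact hne rfl), rfl⟩
      · exact ⟨_, left_mem_insertEdges, rfl⟩
      · exact ⟨_, right_mem_insertEdges, rfl⟩
  · rintro _ ⟨⟨e, he, rfl⟩, hne⟩ _ ⟨⟨f, hf, rfl⟩, hnf⟩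
    have hea : e ≠ (a, b) := by rintro rfl; exact hne rfl
    have hfa : f ≠ (a, b) := by rintro rfl; exact hnf rfl
    have he' : e ∈ D'.edges := by rw [hc.edges_eq]; exact rest_mem_insertEdges he hea
    have hf' : f ∈ D'.edges := by rw [hc.edges_eq]; exact rest_mem_insertEdges hf hfa
    rw [h'.mapOK.diagram_passesOver_iff he' hf', h.mapOK.diagram_passesOver_iff he hf]
    exact hc.rest e he f hf hea hfa
  · rintro e₁ he₁ _ ⟨⟨f, hf, rfl⟩, hnf⟩
    have hfa : f ≠ (a, b) := by rintro rfl; exact hnf rfl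
    have hf' : f ∈ D'.edges := by rw [hc.edges_eq]; exact rest_mem_insertEdges hf hfa
    obtain ⟨e, hnew, rfl⟩ : ∃ e, IsNew a b c e ∧ e₁ = mapEdge φ e := by
      rcases he₁ with rfl | rfl
      · exact ⟨_, Or.inl rfl, rfl⟩
      · exact ⟨_, Or.inr rfl, rfl⟩
    have he' : e ∈ D'.edges := by rw [hc.edges_eq]; exact Or.inr hnew
    rw [h'.mapOK.diagram_passesOver_iff he' hf', h'.mapOK.diagram_passesOver_iff hf' he']
    have e2 : ((φ a, φ b) : Edge) = mapEdge φ (a, b) := rfl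
    rw [e2, h.mapOK.diagram_passesOver_iff hc.mem hf, h.mapOK.diagram_passesOver_iff hf hc.mem]
    exact ⟨fun h1 => (hc.new .o e hnew f h1).2.2, fun h1 => (hc.new .u e hnew f h1).2.2⟩

theorem refines (h : EdgeAffine D φ) {D' : MultiKnotoidDiagram} (hr : Refines D D') :
    ∃ h' : EdgeAffine D' φ, Isotopic h.mapOK.diagram h'.mapOK.diagram := by
  induction hr with
  | refl => exact ⟨h, Isotopic.refl _⟩
  | tail _ hc ih =>
    obtain ⟨h₁, hi⟩ := ih
    obtain ⟨a, b, c, hc⟩ := hc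
    obtain ⟨h₂, hi'⟩ := h₁.cut hc
    exact ⟨h₂, hi.trans hi'⟩

end EdgeAffine

theorem Fine.map (hf : Fine D) {p : Pt → Pt} (h : MapOK D p) : Fine h.diagram := by
  refine ⟨?_, ?_, ?_⟩
  · rintro _ ⟨e, he, rfl⟩ _ ⟨f, hfE, rfl⟩ hef
    obtain ⟨σ, h1, h2⟩ := hf.consecutive e he f hfE
      (h.inj _ (snd_mem_verts he) _ (fst_mem_verts hfE) hef)
    exact ⟨σ, (h.pure_iff he).2 h1, (h.pure_iff hfE).2 h2⟩
  · rintro _ ⟨e, he, rfl⟩ hel _ ⟨f, hfE, rfl⟩ hc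
    exact hf.leg e he (h.inj _ (fst_mem_verts he) _ D.leg_mem_verts hel) f hfE
      ((h.cross_iff e he f hfE).1 hc)
  · rintro _ ⟨e, he, rfl⟩ hel _ ⟨f, hfE, rfl⟩ hc
    exact hf.head e he (h.inj _ (snd_mem_verts he) _ D.head_mem_verts hel) f hfE
      ((h.cross_iff e he f hfE).1 hc)

theorem isotopic_family_of_fine (hf : Fine D) {φ : ℝ → Pt → Pt}
    (hφ : ∀ s ∈ Set.Icc (0 : ℝ) 1, EdgeAffine D (φ s)) (hc : ∀ v, Continuous fun s => φ s v)
    {s t : ℝ} (hs : s ∈ Set.Icc (0 : ℝ) 1) (ht : t ∈ Set.Icc (0 : ℝ) 1) :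
    Isotopic (hφ s hs).mapOK.diagram (hφ t ht).mapOK.diagram := by
  let P : ℝ → ℝ → Prop := fun s t => ∀ (hs : s ∈ Set.Icc (0 : ℝ) 1) (ht : t ∈ Set.Icc (0 : ℝ) 1),
    Isotopic (hφ s hs).mapOK.diagram (hφ t ht).mapOK.diagram
  have : P s t := by
    refine isPreconnected_Icc.induction₂ P ?_ ?_ ?_ hs ht
    · intro x hx
      obtain ⟨η, hS⟩ := exists_small (hφ x hx).mapOK.diagram
      have hnear : ∀ᶠ y in 𝓝 x, ∀ v ∈ verts D.edges, dist (φ y v) (φ x v) < η := by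
        refine (Set.Finite.eventually_all (verts_finite D.isCurveSystem.finite)).2 fun v _ => ?_
        exact (hc v).continuousAt.eventually (Metric.ball_mem_nhds _ hS.pos)
      filter_upwards [nhdsWithin_le_nhds hnear] with y hy hx' hy'
      let q : Pt → Pt := φ y ∘ Function.invFun (φ x)
      have hq : ∀ v, q (φ x v) = φ y v := fun v => by
        simp only [q, Function.comp, Function.leftInverse_invFun (hφ x hx).inj v]
      have hN : Near (hφ x hx).mapOK.diagram η q := by
        intro s hs
        rw [(hφ x hx).mapOK.verts_eq] at hs
        obtain ⟨v, hv, rfl⟩ := hs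
        rw [hq]
        exact hy v hv
      have := isotopic_of_near (hf.map (hφ x hx).mapOK) hS hN
      convert this using 1
      apply toDiagramData_inj
      show D.toDiagramData.map (φ y) = (D.toDiagramData.map (φ x)).map q
      rw [DiagramData.map_map]
      congr 1
      funext v
      exact (hq v).symm
    · exact fun x y z _ _ _ h1 h2 hx hz => (h1 hx ‹_›).trans (h2 ‹_› hz)
    · exact fun x y _ _ h1 hy hx => (h1 hx hy).symm
  exact this hs ht

/-- A diagram that is moved through a continuous family of injective maps of the plane which are
affine on its edges stays isotopic to itself. -/
theorem isotopic_family {φ : ℝ → Pt → Pt}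
    (hφ : ∀ s ∈ Set.Icc (0 : ℝ) 1, EdgeAffine D (φ s)) (hc : ∀ v, Continuous fun s => φ s v)
    (h0 : φ 0 = id) (h1 : EdgeAffine D (φ 1)) : Isotopic D h1.mapOK.diagram := by
  obtain ⟨D', hr, hf⟩ := exists_fine D
  have hφ' : ∀ s ∈ Set.Icc (0 : ℝ) 1, EdgeAffine D' (φ s) := fun s hs =>
    ((hφ s hs).refines hr).choose
  have i0 : (0 : ℝ) ∈ Set.Icc (0 : ℝ) 1 := by simp
  have i1 : (1 : ℝ) ∈ Set.Icc (0 : ℝ) 1 := by simp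
  have k := isotopic_family_of_fine hf hφ' hc i0 i1
  have e0 : (hφ' 0 i0).mapOK.diagram = D' := by
    apply toDiagramData_inj
    show D'.toDiagramData.map (φ 0) = _
    rw [h0, DiagramData.map_id]
  rw [e0] at k
  exact (hr.isotopic.trans k).trans (((hφ 1 i1).refines hr).choose_spec).symm

end MultiKnotoidDiagram

end PLKnotoid

namespace PLKnotoid

/-! ### Staircases -/

/-- All but finitely many points of a vertical line that contains at most one point of a finite set
`X` are generic with respect to `X`. -/
theorem exists_generic_on_line {X : Set Pt} (hX : X.Finite) {x lo hi : ℝ} {w : Pt} (hlt : lo < hi)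
    (h : ∀ y ∈ X, y.1 = x → y = w) : ∃ s ∈ Set.Ioo lo hi, Generic X (x, s) := by
  have hbad : ((fun q : Pt × Pt => q.1.2 + (q.2.2 - q.1.2) * (x - q.1.1) / (q.2.1 - q.1.1)) ''
      (X ×ˢ X)).Finite := (hX.prod hX).image _
  obtain ⟨s, hs, hs'⟩ := (Set.Ioo_infinite hlt).exists_notMem_finite hbad
  refine ⟨s, hs, fun y hy y' hy' hne h0 => hs' ?_⟩
  unfold cr at h0
  simp only [Prod.fst_sub, Prod.snd_sub] at h0
  by_cases h1 : y'.1 = y.1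
  · exfalso
    have h2 : y'.2 ≠ y.2 := fun h2 => hne (Prod.ext h1.symm h2.symm)
    have h3 : x - y.1 = 0 := by
      have : (y'.2 - y.2) * (x - y.1) = 0 := by rw [h1] at h0; linarith
      exact (mul_eq_zero.1 this).resolve_left (sub_ne_zero.2 h2)
    exact hne ((h y hy (by linarith)).trans (h y' hy' (by linarith)).symm)
  · refine ⟨(y, y'), ⟨hy, hy'⟩, ?_⟩
    have h2 : y'.1 - y.1 ≠ 0 := sub_ne_zero.2 h1
    simp only
    field_simp
    linarith

/-- The number `x` lies strictly between the `x`-coordinates of the ends of `e`. -/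
def InX (e : Edge) (x : ℝ) : Prop := 0 < (x - e.1.1) * (e.2.1 - x)

theorem InX.of_oseg {e : Edge} (hne : e.1.1 ≠ e.2.1) {z : Pt} (hz : z ∈ e.openSeg) :
    InX e z.1 := by
  obtain ⟨s, h0, h1, e1, -⟩ := mem_oseg_iff.1 hz
  have h2 : 0 < (e.2.1 - e.1.1) ^ 2 := by
    have := sub_ne_zero.2 hne.symm
    positivity
  have : (z.1 - e.1.1) * (e.2.1 - z.1) = s * (1 - s) * (e.2.1 - e.1.1) ^ 2 := by rw [e1]; ring
  unfold InX
  rw [this]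
  have : 0 < 1 - s := by linarith
  positivity

theorem InX.exists_mem {e : Edge} {x : ℝ} (h : InX e x) : ∃ z ∈ e.openSeg, z.1 = x := by
  unfold InX at h
  have hne : e.2.1 - e.1.1 ≠ 0 := by
    intro h0
    rw [sub_eq_zero.1 h0] at h
    nlinarith [sq_nonneg (x - e.1.1)]
  have hsq : 0 < (e.2.1 - e.1.1) ^ 2 := by positivity
  have hs0 : 0 < (x - e.1.1) / (e.2.1 - e.1.1) := by
    have : (x - e.1.1) / (e.2.1 - e.1.1)
        = (x - e.1.1) * (e.2.1 - e.1.1) / (e.2.1 - e.1.1) ^ 2 := by field_simp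
    rw [this]
    apply div_pos _ hsq
    nlinarith [sq_nonneg (x - e.1.1)]
  have hs1 : (x - e.1.1) / (e.2.1 - e.1.1) < 1 := by
    have : 1 - (x - e.1.1) / (e.2.1 - e.1.1)
        = (e.2.1 - x) * (e.2.1 - e.1.1) / (e.2.1 - e.1.1) ^ 2 := by field_simp; ring
    have h3 : 0 < (e.2.1 - x) * (e.2.1 - e.1.1) / (e.2.1 - e.1.1) ^ 2 := by
      apply div_pos _ hsq
      nlinarith [sq_nonneg (e.2.1 - x)]
    linarith
  have hx : e.1.1 + (x - e.1.1) / (e.2.1 - e.1.1) * (e.2.1 - e.1.1) = x := by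
    field_simp
    ring
  exact ⟨(x, e.1.2 + (x - e.1.1) / (e.2.1 - e.1.1) * (e.2.2 - e.1.2)),
    mem_oseg_iff.2 ⟨_, hs0, hs1, hx.symm, rfl⟩, rfl⟩

theorem InX.ne {e : Edge} {x : ℝ} (h : InX e x) : x ≠ e.1.1 ∧ x ≠ e.2.1 := by
  unfold InX at h
  constructor <;> rintro rfl <;> simp at h

theorem InX.left {P Q v : Pt} (h : InX (P, Q) v.1) {x : ℝ} (hx : InX (P, v) x) : InX (P, Q) x := by
  unfold InX at h hx ⊢
  simp only at h hx ⊢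
  rcases pos_and_pos_or_neg_and_neg_of_mul_pos h with ⟨h1, h2⟩ | ⟨h1, h2⟩ <;>
    rcases pos_and_pos_or_neg_and_neg_of_mul_pos hx with ⟨h3, h4⟩ | ⟨h3, h4⟩
  · exact mul_pos h3 (by linarith)
  · linarith
  · linarith
  · exact mul_pos_of_neg_of_neg h3 (by linarith)

theorem InX.symm {P Q : Pt} {x : ℝ} (h : InX (P, Q) x) : InX (Q, P) x := by
  unfold InX at h ⊢
  simp only at h ⊢
  linarith [h]

theorem InX.right {P Q v : Pt} (h : InX (P, Q) v.1) {x : ℝ} (hx : InX (v, Q) x) : InX (P, Q) x :=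
  (InX.left h.symm hx.symm).symm

theorem InX.left_right {P Q v : Pt} (h : InX (P, Q) v.1) {x : ℝ} (hx : InX (P, v) x) :
    ¬ InX (v, Q) x := by
  intro hy
  unfold InX at h hx hy
  simp only at h hx hy
  rcases pos_and_pos_or_neg_and_neg_of_mul_pos h with ⟨h1, h2⟩ | ⟨h1, h2⟩ <;>
    rcases pos_and_pos_or_neg_and_neg_of_mul_pos hx with ⟨h3, h4⟩ | ⟨h3, h4⟩ <;>
      rcases pos_and_pos_or_neg_and_neg_of_mul_pos hy with ⟨h5, h6⟩ | ⟨h5, h6⟩ <;> linarith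

theorem InX.isOpen (e : Edge) : IsOpen {x | InX e x} := by
  unfold InX
  exact isOpen_lt (by fun_prop) (by fun_prop)

/-- The box that is spanned by the ends of an upward edge, enlarged vertically by `r`. -/
def box (r : ℝ) (e : Edge) : Set Pt :=
  Set.uIcc e.1.1 e.2.1 ×ˢ Set.Icc (e.2.2 - r) (e.1.2 + r)

theorem convex_box (r : ℝ) (e : Edge) : Convex ℝ (box r e) :=
  (convex_uIcc _ _).prod (convex_Icc _ _)

theorem InX.mem_uIcc {e : Edge} {x : ℝ} (h : InX e x) : x ∈ Set.uIcc e.1.1 e.2.1 := by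
  unfold InX at h
  rcases pos_and_pos_or_neg_and_neg_of_mul_pos h with ⟨h1, h2⟩ | ⟨h1, h2⟩
  · exact Set.mem_uIcc_of_le (by linarith) (by linarith)
  · exact Set.mem_uIcc_of_ge (by linarith) (by linarith)

/-- `D'` arises from `D` by replacing the upward edge `(P, Q)` by a staircase of type `τ` through
`v` and `w`: a descending edge, an upward vertical edge, and a descending edge. The staircase stays
in the box of height `r`, its slanted edges contain no points of `X` except for `P` and `Q`, and the
line of its vertical edge avoids `X`. -/
structure Stair (D D' : MultiKnotoidDiagram) (τ : Label) (P Q v w : Pt) (r : ℝ) (X : Set Pt) :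
    Prop where
  isotopic : MultiKnotoidDiagram.Isotopic D D'
  leg_eq : D'.leg = D.leg
  head_eq : D'.head = D.head
  mem_edges : ∀ e, e ∈ D'.edges ↔
    (e ∈ D.edges ∧ e ≠ (P, Q)) ∨ e = (P, v) ∨ e = (v, w) ∨ e = (w, Q)
  rest : ∀ e ∈ D.edges, ∀ f ∈ D.edges, e ≠ (P, Q) → f ≠ (P, Q) →
    (D'.passesOver e f ↔ D.passesOver e f)
  pure : ∀ e, e = (P, v) ∨ e = (v, w) ∨ e = (w, Q) → Pure D'.passesOver τ e
  vertical : w.1 = v.1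
  inX : InX (P, Q) v.1
  v_lower : P.2 < v.2
  v_upper : v.2 < P.2 + r
  w_upper : w.2 < Q.2
  w_lower : Q.2 - r < w.2
  off : ∀ s ∈ X, s.1 ≠ v.1
  left : ∀ s ∈ X, s ∈ segment ℝ P v → s = P
  right : ∀ s ∈ X, s ∈ segment ℝ w Q → s = Q

namespace MultiKnotoidDiagram

variable {D : MultiKnotoidDiagram}

/-- A pure upward edge can be replaced by a staircase which is as close to the box of the edge as
desired, and generic: two insertions at generic points of the same vertical line. -/
theorem exists_stair {τ : Label} {P Q : Pt} (hPQ : (P, Q) ∈ D.edges) (hne : P.1 ≠ Q.1)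
    (hup : Q.2 ≤ P.2) (hp : Pure D.passesOver τ (P, Q)) {r : ℝ} (hr : 0 < r)
    (hends : ∀ p, (p = D.leg ∨ p = D.head) → p ∈ box r (P, Q) → p = P ∨ p = Q)
    {X : Set Pt} (hX : X.Finite) (hvX : verts D.edges ⊆ X) (hcX : crossPts D.edges ⊆ X) :
    ∃ D' v w, Stair D D' τ P Q v w r X := by
  have hD := D.isCurveSystem
  have hPX := hvX (fst_mem_verts hPQ)
  have hQX := hvX (snd_mem_verts hPQ)
  -- Genericity with respect to `X` and its vertical translate keeps `v` off the vertical lines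
  -- through the points of `X`.
  set X' : Set Pt := X ∪ (fun s : Pt => ((s.1, s.2 + 1) : Pt)) '' X with hX'
  have hO : IsOpen {z : Pt | InX (P, Q) z.1 ∧ P.2 < z.2 ∧ z.2 < P.2 + r} :=
    ((InX.isOpen (P, Q)).preimage continuous_fst).inter
      ((isOpen_lt continuous_const continuous_snd).inter
        (isOpen_lt continuous_snd continuous_const))
  have hOne : {z : Pt | InX (P, Q) z.1 ∧ P.2 < z.2 ∧ z.2 < P.2 + r}.Nonempty := by
    refine ⟨((P.1 + Q.1) / 2, P.2 + r / 2), ?_, ?_, ?_⟩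
    · unfold InX
      have : P.1 - Q.1 ≠ 0 := sub_ne_zero.2 hne
      have h2 : 0 < (P.1 - Q.1) ^ 2 := by positivity
      simp only
      nlinarith
    · simp only; linarith
    · simp only; linarith
  obtain ⟨v, ⟨hvx, hv1, hv2⟩, hgen⟩ := exists_generic (hX.union (hX.image _)) hO hOne
  have hgX : Generic X v := fun x hx y hy => hgen x (Or.inl hx) y (Or.inl hy)
  have hoff : ∀ s ∈ X, s.1 ≠ v.1 := by
    intro s hs h
    refine hgen s (Or.inl hs) (s.1, s.2 + 1) (Or.inr ⟨s, hs, rfl⟩) ?_ ?_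
    · intro h'
      have := congrArg Prod.snd h'
      simp at this
    · simp only [cr, Prod.fst_sub, Prod.snd_sub]
      rw [h]; ring
  have hPb : P ∈ box r (P, Q) := ⟨Set.left_mem_uIcc, by simp only; linarith, by simp only; linarith⟩
  have hQb : Q ∈ box r (P, Q) :=
    ⟨Set.right_mem_uIcc, by simp only; linarith, by simp only; linarith⟩
  have hvb : v ∈ box r (P, Q) := ⟨hvx.mem_uIcc, by simp only; linarith, by simp only; linarith⟩
  have hI := insertable_of_generic hPQ hvX hcX hgX
  obtain ⟨D₁, iso₁, edges₁, leg₁, head₁, rest₁, pure₁, pure₁'⟩ := exists_insert τ hI hp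
    (fun p hp hm => hends p hp (triangle_subset_of_convex (convex_box r _) hPb hQb hvb hm))
  have hD₁ := D₁.isCurveSystem
  have hneL : P.1 ≠ v.1 := hoff P hPX
  have hneR : v.1 ≠ Q.1 := (hoff Q hQX).symm
  set X₁ : Set Pt := X ∪ (verts D₁.edges ∪ crossPts D₁.edges) with hX₁
  have hX₁f : X₁.Finite := hX.union ((verts_finite hD₁.finite).union hD₁.crossPts_finite)
  have hline : ∀ y ∈ X₁, y.1 = v.1 → y = v := by
    rintro y (hy | hy | hy) hyv
    · exact (hoff y hy hyv).elim
    · rw [edges₁] at hy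
      rcases hI.verts_subset hy with hy | hy
      · exact (hoff y (hvX hy) hyv).elim
      · exact hy
    · exfalso
      have hnew : ∀ e, IsNew P Q v e → y ∉ e.openSeg := by
        rintro e (rfl | rfl) hm
        · exact (InX.of_oseg hneL hm).ne.2 hyv
        · exact (InX.of_oseg hneR hm).ne.1 hyv
      obtain ⟨e, he, f, hf, hef, h1, h2⟩ := hy
      rw [edges₁] at he hf
      rcases mem_insertEdges'.1 he with ⟨he, -⟩ | he
      · rcases mem_insertEdges'.1 hf with ⟨hf, -⟩ | hf
        · exact hoff y (hcX ⟨e, he, f, hf, hef, h1, h2⟩) hyv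
        · exact hnew f hf h2
      · exact hnew e he h1
  obtain ⟨s, ⟨hs1, hs2⟩, hgen₁⟩ := exists_generic_on_line hX₁f (by linarith : Q.2 - r < Q.2) hline
  set w : Pt := (v.1, s) with hw
  have hvQ : (v, Q) ∈ D₁.edges := by rw [edges₁]; exact right_mem_insertEdges
  have hI₁ := insertable_of_generic hvQ (fun z hz => Or.inr (Or.inl hz))
    (fun z hz => Or.inr (Or.inr hz)) hgen₁
  have hwb : w ∈ box r (P, Q) := ⟨hvx.mem_uIcc, by simp only [hw]; linarith,
    by simp only [hw]; linarith⟩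
  obtain ⟨D₂, iso₂, edges₂, leg₂, head₂, rest₂, pure₂, pure₂'⟩ := exists_insert τ hI₁ pure₁' (by
    intro p hp hm
    rw [leg₁, head₁] at hp
    rcases hends p hp (triangle_subset_of_convex (convex_box r _) hvb hQb hwb hm) with rfl | rfl
    · exfalso
      have hc : Convex ℝ (Set.uIcc v.1 Q.1 ×ˢ (Set.univ : Set ℝ)) :=
        (convex_uIcc _ _).prod convex_univ
      have := (triangle_subset_of_convex hc (c := w) ⟨Set.left_mem_uIcc, trivial⟩
        ⟨Set.right_mem_uIcc, trivial⟩ ⟨Set.left_mem_uIcc, trivial⟩ hm).1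
      unfold InX at hvx
      simp only at hvx
      rcases Set.mem_uIcc.1 this with ⟨h1, h2⟩ | ⟨h1, h2⟩ <;>
        rcases pos_and_pos_or_neg_and_neg_of_mul_pos hvx with ⟨h3, h4⟩ | ⟨h3, h4⟩ <;> linarith
    · exact Or.inr rfl)
  have hPv : (P, v) ∈ D₁.edges := by rw [edges₁]; exact left_mem_insertEdges
  have hPvne : ((P, v) : Edge) ≠ (v, Q) := fun h => hneL (congrArg (fun e : Edge => e.1.1) h)
  have hmem : ∀ e, e ∈ D₂.edges ↔
      (e ∈ D.edges ∧ e ≠ (P, Q)) ∨ e = (P, v) ∨ e = (v, w) ∨ e = (w, Q) := by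
    intro e
    rw [edges₂, mem_insertEdges, edges₁, mem_insertEdges]
    constructor
    · rintro (⟨h | h | h, h'⟩ | h | h)
      · exact Or.inl h
      · exact Or.inr (Or.inl h)
      · exact (h' h).elim
      · exact Or.inr (Or.inr (Or.inl h))
      · exact Or.inr (Or.inr (Or.inr h))
    · rintro (h | h | h | h)
      · exact Or.inl ⟨Or.inl h, fun h' => hI.right_notMem (h' ▸ h.1)⟩
      · exact Or.inl ⟨Or.inr (Or.inl h), fun h' => hPvne (h.symm.trans h')⟩
      · exact Or.inr (Or.inl h)
      · exact Or.inr (Or.inr h)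
  have hmem₁ : ∀ e ∈ D.edges, e ≠ (P, Q) → e ∈ D₁.edges ∧ e ≠ (v, Q) := by
    intro e he hea
    refine ⟨by rw [edges₁]; exact rest_mem_insertEdges he hea, fun h => hI.right_notMem (h ▸ he)⟩
  refine ⟨D₂, v, w, iso₁.trans iso₂, leg₂.trans leg₁, head₂.trans head₁, hmem, ?_, ?_, rfl,
    hvx, hv1, hv2, hs2, hs1, hoff, fun s hs hm => hgX.eq_of_mem_seg hPX hs hm, ?_⟩
  · intro e he f hf hea hfa
    have h1 := hmem₁ e he hea
    have h2 := hmem₁ f hf hfa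
    exact (rest₂ e h1.1 f h2.1 h1.2 h2.2).trans (rest₁ e he f hf hea hfa)
  · rintro e (rfl | rfl | rfl)
    · rw [pure_iff ((hmem _).2 (Or.inr (Or.inl rfl)))]
      intro f hf hc
      have key : ∀ g : Edge, g ∈ D₁.edges → g ≠ (v, Q) →
          (Side D₂.passesOver τ (P, v) g ↔ Side D₁.passesOver τ (P, v) g) := by
        intro g hg hg'
        cases τ
        · exact rest₂ _ hPv g hg hPvne hg'
        · exact rest₂ g hg _ hPv hg' hPvne
      rw [edges₂] at hf
      obtain ⟨-, z, hz, hz'⟩ := id hc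
      rcases mem_insertEdges.1 hf with ⟨hf, hf'⟩ | rfl | rfl
      · exact (key f hf hf').2 ((pure_iff hPv).1 pure₁ f hf hc)
      · exfalso
        obtain ⟨t, -, -, h1, -⟩ := mem_oseg_iff.1 hz'
        simp only [hw, sub_self, mul_zero, add_zero] at h1
        exact (InX.of_oseg hneL hz).ne.2 h1
      · exfalso
        exact InX.left_right hvx (InX.of_oseg hneL hz)
          (InX.of_oseg (e := (w, Q)) hneR hz')
    · exact pure₂
    · exact pure₂'
  · intro s hs hm
    rw [segment_symm] at hm
    exact hgen₁.eq_of_mem_seg (Or.inl hQX) (Or.inl hs) hm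

end MultiKnotoidDiagram

end PLKnotoid

namespace PLKnotoid

/-! ### Removing upward edges -/

/-- An upward vertical edge `e` of type `τ` whose vertical line contains neither the leg, nor the
head, nor a vertex or a crossing outside of `e`. These are the edges that turn into joining
arcs. -/
structure IsRiser (D : MultiKnotoidDiagram) (τ : Label) (e : Edge) : Prop where
  mem : e ∈ D.edges
  vertical : e.1.1 = e.2.1
  up : e.2.2 < e.1.2
  pure : Pure D.passesOver τ e
  leg : D.leg.1 ≠ e.1.1
  head : D.head.1 ≠ e.1.1
  verts : ∀ s ∈ verts D.edges, s.1 = e.1.1 → s = e.1 ∨ s = e.2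
  cross : ∀ z ∈ crossPts D.edges, z.1 = e.1.1 → z ∈ e.openSeg

/-- Every edge outside of `U` is descending or a riser, and the other edges are not vertical. -/
def Stage (D : MultiKnotoidDiagram) (U : Set Edge) : Prop :=
  ∀ e ∈ D.edges, (e.1.1 ≠ e.2.1 ∧ (e ∈ U ∨ e.1.2 < e.2.2)) ∨ ∃ τ, IsRiser D τ e

/-- The points of the non-vertical edges that lie on the vertical line through a vertical edge. -/
def levelPts (E : Set Edge) : Set Pt :=
  {z | ∃ f ∈ E, f.1.1 ≠ f.2.1 ∧ z ∈ f.closedSeg ∧ ∃ V ∈ E, V.1.1 = V.2.1 ∧ z.1 = V.1.1}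

theorem eq_of_fst_eq {e : Edge} (hne : e.1.1 ≠ e.2.1) {z w : Pt} (hz : z ∈ e.closedSeg)
    (hw : w ∈ e.closedSeg) (h : z.1 = w.1) : z = w := by
  obtain ⟨s, -, -, e1, e2⟩ := mem_seg_iff.1 hz
  obtain ⟨t, -, -, f1, f2⟩ := mem_seg_iff.1 hw
  have : (s - t) * (e.2.1 - e.1.1) = 0 := by linarith
  have hst : s = t := by
    linarith [(mul_eq_zero.1 this).resolve_right (sub_ne_zero.2 hne.symm)]
  exact Prod.ext h (by rw [e2, f2, hst])

theorem levelPts_finite {E : Set Edge} (hE : E.Finite) : (levelPts E).Finite := by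
  have : levelPts E ⊆ ⋃ q ∈ E ×ˢ E, {z : Pt | q.1.1.1 ≠ q.1.2.1 ∧ z ∈ q.1.closedSeg ∧
      z.1 = q.2.1.1} := by
    rintro z ⟨f, hf, hne, hz, V, hV, -, hzV⟩
    exact Set.mem_biUnion (x := (f, V)) ⟨hf, hV⟩ ⟨hne, hz, hzV⟩
  refine ((hE.prod hE).biUnion fun q _ => ?_).subset this
  apply Set.Subsingleton.finite
  rintro z ⟨hne, hz, hz'⟩ w ⟨-, hw, hw'⟩
  exact eq_of_fst_eq hne hz hw (hz'.trans hw'.symm)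

theorem fst_eq_of_mem_seg {e : Edge} (h : e.1.1 = e.2.1) {z : Pt} (hz : z ∈ e.closedSeg) :
    z.1 = e.1.1 := by
  obtain ⟨s, -, -, e1, -⟩ := mem_seg_iff.1 hz
  rw [e1, ← h]; ring

namespace Stage

variable {D : MultiKnotoidDiagram} {U : Set Edge}

theorem riser (h : Stage D U) {V : Edge} (hV : V ∈ D.edges) (hv : V.1.1 = V.2.1) :
    ∃ τ, IsRiser D τ V := by
  rcases h V hV with h | h
  · exact (h.1 hv).elim
  · exact h

theorem mono (h : Stage D U) {U' : Set Edge}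
    (hU : ∀ e ∈ U, e ∈ D.edges → ¬ e.1.2 < e.2.2 → e ∈ U') :
    Stage D U' := by
  intro e he
  rcases h e he with ⟨h1, h2⟩ | h
  · by_cases h3 : e.1.2 < e.2.2
    · exact Or.inl ⟨h1, Or.inr h3⟩
    · exact Or.inl ⟨h1, Or.inl (hU e (h2.resolve_right h3) he h3)⟩
  · exact Or.inr h

end Stage

/-- Two risers on the same vertical line are equal. -/
theorem IsRiser.eq_of_fst_eq {D : MultiKnotoidDiagram} {τ σ : Label} {V W : Edge}
    (hV : IsRiser D τ V) (hW : IsRiser D σ W) (h : V.1.1 = W.1.1) : V = W := by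
  have hD := D.isCurveSystem
  rcases hW.verts V.1 (fst_mem_verts hV.mem) h with h1 | h1
  · exact hD.out_unique V hV.mem W hW.mem h1
  · rcases hW.verts V.2 (snd_mem_verts hV.mem) (hV.vertical ▸ h) with h2 | h2
    · have h3 := hV.up
      have h4 := hW.up
      rw [h1, h2] at h3
      linarith
    · exact hD.in_unique V hV.mem W hW.mem h2

/-- An upward edge `g` which is ready to be replaced by a staircase in the box of height `r`: it is
pure, the box contains no endpoint except for its own ends, and a vertical edge in the strip of `g`
crosses `g`, and so is of the other type, or misses the box. -/
structure Ready (D : MultiKnotoidDiagram) (r : ℝ) (g : Edge) : Prop where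
  mem : g ∈ D.edges
  slanted : g.1.1 ≠ g.2.1
  up : g.2.2 ≤ g.1.2
  pure : ∃ τ, Pure D.passesOver τ g
  ends : ∀ p, (p = D.leg ∨ p = D.head) → p ∈ box r g → p = g.1 ∨ p = g.2
  vertical : ∀ V ∈ D.edges, V.1.1 = V.2.1 → InX g V.1.1 →
    V.Crosses g ∨ ∀ z ∈ V.closedSeg, z ∉ box r g

namespace Stair

open MultiKnotoidDiagram

variable {D D' : MultiKnotoidDiagram} {τ : Label} {P Q v w : Pt} {r : ℝ} {X : Set Pt}

/-- The three new edges of a staircase. -/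
def New (P Q v w : Pt) (e : Edge) : Prop := e = (P, v) ∨ e = (v, w) ∨ e = (w, Q)

theorem inX_of_new (h : Stair D D' τ P Q v w r X) {e : Edge} (he : New P Q v w e) {z : Pt}
    (hz : z ∈ e.openSeg) : InX (P, Q) z.1 := by
  have hne := h.inX.ne
  rcases he with rfl | rfl | rfl
  · exact InX.left h.inX (InX.of_oseg (e := (P, v)) (Ne.symm hne.1) hz)
  · have := fst_eq_of_mem_seg (e := (v, w)) h.vertical.symm (oseg_subset_seg hz)
    rw [this]
    exact h.inX
  · have hw : InX (P, Q) w.1 := h.vertical ▸ h.inX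
    exact InX.right hw (InX.of_oseg (e := (w, Q)) hw.ne.2 hz)

theorem mem_box_of_new (h : Stair D D' τ P Q v w r X) (hup : Q.2 ≤ P.2) {e : Edge}
    (he : New P Q v w e) {z : Pt} (hz : z ∈ e.openSeg) : z ∈ box r (P, Q) := by
  have h1 := h.v_lower
  have h2 := h.v_upper
  have h3 := h.w_lower
  have h4 := h.w_upper
  have hP : P ∈ box r (P, Q) := ⟨Set.left_mem_uIcc, by simp only; linarith, by simp only; linarith⟩
  have hQ : Q ∈ box r (P, Q) := ⟨Set.right_mem_uIcc, by simp only; linarith, by simp only; linarith⟩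
  have hv : v ∈ box r (P, Q) := ⟨h.inX.mem_uIcc, by simp only; linarith, by simp only; linarith⟩
  have hw : w ∈ box r (P, Q) :=
    ⟨(h.vertical ▸ h.inX : InX (P, Q) w.1).mem_uIcc, by simp only; linarith, by simp only; linarith⟩
  have hc := convex_box r (P, Q)
  rcases he with rfl | rfl | rfl
  · exact hc.segment_subset hP hv (oseg_subset_seg hz)
  · exact hc.segment_subset hv hw (oseg_subset_seg hz)
  · exact hc.segment_subset hw hQ (oseg_subset_seg hz)

theorem mem_old (h : Stair D D' τ P Q v w r X) {e : Edge} (he : e ∈ D.edges) (he' : e ≠ (P, Q)) :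
    e ∈ D'.edges := (h.mem_edges e).2 (Or.inl ⟨he, he'⟩)

/-- An old edge stays pure if it is of the other type or misses the staircase. -/
theorem pure_old (h : Stair D D' τ P Q v w r X) {e : Edge} (he : e ∈ D.edges) (he' : e ≠ (P, Q))
    {σ : Label} (hσ : Pure D.passesOver σ e)
    (hnew : ∀ f, New P Q v w f → e.Crosses f → σ = τ.flip) : Pure D'.passesOver σ e := by
  rw [pure_iff_side] at hσ ⊢
  intro f hs
  obtain ⟨-, hf, hc⟩ := side_mem hs
  rcases (h.mem_edges f).1 hf with ⟨hf, hf'⟩ | hf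
  · apply hσ f
    cases σ
    · exact (h.rest f hf e he hf' he').1 hs
    · exact (h.rest e he f hf he' hf').1 hs
  · have := hnew f hf hc
    subst this
    exact pure_iff_side.1 (h.pure f hf) e (by simpa using side_comm.1 hs)

theorem mem_verts (h : Stair D D' τ P Q v w r X) (hPQ : (P, Q) ∈ D.edges) {s : Pt}
    (hs : s ∈ verts D'.edges) :
    s ∈ verts D.edges ∨ s = v ∨ s = w := by
  obtain ⟨e, he, hse⟩ := hs
  rcases (h.mem_edges e).1 he with ⟨he, -⟩ | rfl | rfl | rfl
  · exact Or.inl ⟨e, he, hse⟩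
  · rcases hse with hse | hse
    · exact Or.inl (by rw [hse]; exact fst_mem_verts (e := (P, Q)) hPQ)
    · exact Or.inr (Or.inl hse)
  · exact Or.inr hse
  · rcases hse with hse | hse
    · exact Or.inr (Or.inr hse)
    · exact Or.inl (by rw [hse]; exact snd_mem_verts (e := (P, Q)) hPQ)

theorem mem_crossPts (h : Stair D D' τ P Q v w r X) {z : Pt} (hz : z ∈ crossPts D'.edges) :
    z ∈ crossPts D.edges ∨ z ∈ openSegment ℝ v w ∨
      ((z ∈ openSegment ℝ P v ∨ z ∈ openSegment ℝ w Q) ∧ ∃ f ∈ D.edges, z ∈ f.openSeg) := by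
  obtain ⟨e, he, f, hf, hef, h1, h2⟩ := hz
  have hw : InX (P, Q) w.1 := h.vertical ▸ h.inX
  have hx : ∀ z, z ∈ openSegment ℝ P v → z ∉ openSegment ℝ w Q := fun z h1 h2 =>
    InX.left_right h.inX (InX.of_oseg (e := (P, v)) h.inX.ne.1.symm h1)
      (by
        have := InX.of_oseg (e := (w, Q)) hw.ne.2 h2
        unfold InX at this ⊢
        rwa [← h.vertical])
  rcases (h.mem_edges e).1 he with ⟨he, -⟩ | rfl | rfl | rfl <;>
    rcases (h.mem_edges f).1 hf with ⟨hf, -⟩ | rfl | rfl | rfl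
  · exact Or.inl ⟨e, he, f, hf, hef, h1, h2⟩
  · exact Or.inr (Or.inr ⟨Or.inl h2, e, he, h1⟩)
  · exact Or.inr (Or.inl h2)
  · exact Or.inr (Or.inr ⟨Or.inr h2, e, he, h1⟩)
  · exact Or.inr (Or.inr ⟨Or.inl h1, f, hf, h2⟩)
  · exact (hef rfl).elim
  · exact Or.inr (Or.inl h2)
  · exact (hx z h1 h2).elim
  · exact Or.inr (Or.inl h1)
  · exact Or.inr (Or.inl h1)
  · exact (hef rfl).elim
  · exact Or.inr (Or.inl h1)
  · exact Or.inr (Or.inr ⟨Or.inr h1, f, hf, h2⟩)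
  · exact (hx z h2 h1).elim
  · exact Or.inr (Or.inl h2)
  · exact (hef rfl).elim

/-- Replacing a ready edge by a staircase brings the diagram closer to the normal form. A riser that
meets the new edges crosses the old one, so it is of the other type and remains pure. Its line
meets no further crossings, since the points of this line on other edges belong to `X`. -/
theorem stage (h : Stair D D' τ P Q v w r X) {U : Set Edge} (hS : Stage D U)
    (hR : Ready D r (P, Q)) (hp : Pure D.passesOver τ (P, Q)) (hvX : verts D.edges ⊆ X)
    (hcX : crossPts D.edges ⊆ X) (hlX : levelPts D.edges ⊆ X) : Stage D' (U \ {(P, Q)}) := by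
  have hne := h.inX.ne
  have hw : InX (P, Q) w.1 := h.vertical ▸ h.inX
  intro e he
  rcases (h.mem_edges e).1 he with ⟨he, he'⟩ | rfl | rfl | rfl
  · rcases hS e he with ⟨h1, h2⟩ | ⟨σ, hσ⟩
    · exact Or.inl ⟨h1, h2.imp (fun h2 => ⟨h2, he'⟩) id⟩
    refine Or.inr ⟨σ, h.mem_old he he', hσ.vertical, hσ.up, ?_, ?_, ?_, ?_, ?_⟩
    · refine h.pure_old he he' hσ.pure fun f hf hc => ?_
      obtain ⟨-, z, hz, hz'⟩ := hc
      have hx := h.inX_of_new hf hz'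
      rw [fst_eq_of_mem_seg hσ.vertical (oseg_subset_seg hz)] at hx
      rcases hR.vertical e he hσ.vertical hx with hcr | hcr
      · by_contra hne
        have : σ = τ := by cases σ <;> cases τ <;> simp [Label.flip] at hne ⊢
        subst this
        exact not_crosses_of_pure he hR.mem hσ.pure hp hcr
      · exact (hcr z (oseg_subset_seg hz) (h.mem_box_of_new hR.up hf hz')).elim
    · rw [h.leg_eq]; exact hσ.leg
    · rw [h.head_eq]; exact hσ.head
    · intro s hs hse
      have hoff := h.off _ (hvX (fst_mem_verts he))
      rcases h.mem_verts hR.mem hs with hs | rfl | rfl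
      · exact hσ.verts s hs hse
      · exact (hoff hse.symm).elim
      · exact (hoff (hse.symm.trans h.vertical)).elim
    · intro z hz hze
      rcases h.mem_crossPts hz with hz | hz | ⟨hz, f, hf, hzf⟩
      · exact hσ.cross z hz hze
      · have := fst_eq_of_mem_seg (e := (v, w)) h.vertical.symm (oseg_subset_seg hz)
        exact (h.off _ (hvX (fst_mem_verts he)) (hze.symm.trans this)).elim
      · by_cases hfv : f.1.1 = f.2.1
        · obtain ⟨ρ, hρ⟩ := hS.riser hf hfv
          have : f = e := hρ.eq_of_fst_eq hσ
            ((fst_eq_of_mem_seg hfv (oseg_subset_seg hzf)).symm.trans hze)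
          exact this ▸ hzf
        · exfalso
          have hzX := hlX ⟨f, hf, hfv, oseg_subset_seg hzf, e, he, hσ.vertical, hze⟩
          rcases hz with hz | hz
          · exact (oseg_ne (fun h' => hne.1 (congrArg Prod.fst h').symm) hz).1
              (h.left z hzX (oseg_subset_seg hz))
          · exact (oseg_ne (fun h' => hw.ne.2 (congrArg Prod.fst h')) hz).2
              (h.right z hzX (oseg_subset_seg hz))
  · exact Or.inl ⟨hne.1.symm, Or.inr h.v_lower⟩
  · refine Or.inr ⟨τ, he, h.vertical.symm, ?_, h.pure _ (Or.inr (Or.inl rfl)), ?_, ?_, ?_, ?_⟩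
    · have := hR.up
      have := h.w_upper
      have := h.v_lower
      simp only at *
      linarith
    · rw [h.leg_eq]; exact h.off _ (hvX D.leg_mem_verts)
    · rw [h.head_eq]; exact h.off _ (hvX D.head_mem_verts)
    · intro s hs hse
      rcases h.mem_verts hR.mem hs with hs | hs
      · exact (h.off s (hvX hs) hse).elim
      · exact hs
    · intro z hz hze
      rcases h.mem_crossPts hz with hz | hz | ⟨hz | hz, -⟩
      · exact (h.off z (hcX hz) hze).elim
      · exact hz
      · exact ((InX.of_oseg (e := (P, v)) hne.1.symm hz).ne.2 hze).elim
      · exact ((InX.of_oseg (e := (w, Q)) hw.ne.2 hz).ne.1 (hze.trans h.vertical.symm)).elim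
  · exact Or.inl ⟨hw.ne.2, Or.inr h.w_upper⟩

/-- The other pieces of a subdivided edge, which lie in other vertical strips, stay ready. -/
theorem ready (h : Stair D D' τ P Q v w r X) {g : Edge} (hg : Ready D r g) (hne : g ≠ (P, Q))
    (hx : ∀ x, InX g x → ¬ InX (P, Q) x) : Ready D' r g := by
  refine ⟨h.mem_old hg.mem hne, hg.slanted, hg.up, ?_, ?_, ?_⟩
  · obtain ⟨σ, hσ⟩ := hg.pure
    refine ⟨σ, h.pure_old hg.mem hne hσ fun f hf hc => ?_⟩
    obtain ⟨-, z, hz, hz'⟩ := hc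
    exact (hx z.1 (InX.of_oseg hg.slanted hz) (h.inX_of_new hf hz')).elim
  · rw [h.leg_eq, h.head_eq]; exact hg.ends
  · intro V hV hv hVg
    rcases (h.mem_edges V).1 hV with ⟨hV, -⟩ | rfl | rfl | rfl
    · exact hg.vertical V hV hv hVg
    · exact (h.inX.ne.1.symm hv).elim
    · exact (hx _ hVg h.inX).elim
    · exact ((h.vertical ▸ h.inX : InX (P, Q) w.1).ne.2 hv).elim

end Stair

namespace MultiKnotoidDiagram

/-- Ready edges over disjoint intervals can be replaced by staircases one after another. -/
theorem exists_stage_of_ready {r : ℝ} (hr : 0 < r) {G : Set Edge} (hG : G.Finite) :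
    ∀ (D : MultiKnotoidDiagram) (U : Set Edge), Stage D (U ∪ G) → (∀ g ∈ G, Ready D r g) →
      (∀ g ∈ G, ∀ g' ∈ G, g ≠ g' → ∀ x, InX g x → ¬ InX g' x) →
      ∃ D', Isotopic D D' ∧ Stage D' U := by
  induction G, hG using Set.Finite.induction_on with
  | empty =>
    intro D U hS _ _
    exact ⟨D, Isotopic.refl D, by simpa using hS⟩
  | @insert g G hg hG ih =>
    intro D U hS hR hx
    obtain ⟨P, Q⟩ := g
    have hRg := hR _ (Set.mem_insert _ _)
    obtain ⟨τ, hτ⟩ := hRg.pure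
    have hD := D.isCurveSystem
    obtain ⟨D₁, v, w, st⟩ := exists_stair (D := D) (τ := τ) (P := P) (Q := Q)
      (X := verts D.edges ∪ crossPts D.edges ∪ levelPts D.edges) hRg.mem hRg.slanted hRg.up hτ hr
      hRg.ends (((verts_finite hD.finite).union hD.crossPts_finite).union
        (levelPts_finite hD.finite)) (fun z hz => Or.inl (Or.inl hz))
      (fun z hz => Or.inl (Or.inr hz))
    have hS₁ := st.stage hS hRg hτ (fun z hz => Or.inl (Or.inl hz))
      (fun z hz => Or.inl (Or.inr hz)) (fun z hz => Or.inr hz)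
    have hne : ∀ g ∈ G, g ≠ (P, Q) := fun g hg' h => hg (h ▸ hg')
    obtain ⟨D₂, iso, hS₂⟩ := ih D₁ U (hS₁.mono (by
        rintro e ⟨he | rfl | he, he'⟩ - -
        · exact Or.inl he
        · exact (he' rfl).elim
        · exact Or.inr he))
      (fun g hg' => st.ready (hR g (Or.inr hg')) (hne g hg')
        (hx g (Or.inr hg') _ (Or.inl rfl) (hne g hg')))
      (fun g hg' g' hg'' => hx g (Or.inr hg') g' (Or.inr hg''))
    exact ⟨D₂, st.isotopic.trans iso, hS₂⟩

end MultiKnotoidDiagram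

end PLKnotoid

namespace PLKnotoid

/-! ### The normal form: descending edges and risers -/

theorem exists_mem_closedSeg {e : Edge} {x : ℝ} (h : x ∈ Set.uIcc e.1.1 e.2.1) :
    ∃ z ∈ e.closedSeg, z.1 = x := by
  by_cases h1 : x = e.1.1
  · exact ⟨e.1, left_mem_segment ℝ _ _, h1.symm⟩
  by_cases h2 : x = e.2.1
  · exact ⟨e.2, right_mem_segment ℝ _ _, h2.symm⟩
  have : InX e x := by
    unfold InX
    rcases Set.mem_uIcc.1 h with ⟨h3, h4⟩ | ⟨h3, h4⟩
    · exact mul_pos (sub_pos.2 (lt_of_le_of_ne h3 (Ne.symm h1)))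
        (sub_pos.2 (lt_of_le_of_ne h4 h2))
    · exact mul_pos_of_neg_of_neg (sub_neg.2 (lt_of_le_of_ne h4 h1))
        (sub_neg.2 (lt_of_le_of_ne h3 (Ne.symm h2)))
  obtain ⟨z, hz, hzx⟩ := this.exists_mem
  exact ⟨z, oseg_subset_seg hz, hzx⟩

theorem isCompact_seg (a b : Pt) : IsCompact (segment ℝ a b) := by
  rw [segment_eq_image_lineMap]
  exact isCompact_Icc.image AffineMap.lineMap_continuous

namespace MultiKnotoidDiagram

variable {D : MultiKnotoidDiagram}

/-- An edge with at most one crossing point is pure. -/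
theorem exists_pure {e : Edge}
    (h : ∀ z ∈ crossPts D.edges, ∀ w ∈ crossPts D.edges, z ∈ e.openSeg → w ∈ e.openSeg → z = w) :
    ∃ σ, Pure D.passesOver σ e := by
  by_cases hu : D.sidePts .u e = ∅
  · exact ⟨.o, pure_iff_sidePts.2 hu⟩
  refine ⟨.u, pure_iff_sidePts.2 (Set.eq_empty_iff_forall_notMem.2 ?_)⟩
  obtain ⟨z, hz⟩ := Set.nonempty_iff_ne_empty.2 hu
  intro w hw
  have hzw := h z (sidePts_subset_crossPts hz) w (sidePts_subset_crossPts hw) hz.choose_spec.2.1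
    hw.choose_spec.2.1
  subst hzw
  obtain ⟨f, hf, h1, h2⟩ := hz
  obtain ⟨g, hg, h3, h4⟩ := hw
  have hfg : f ≠ g := by
    rintro rfl
    exact not_side_and hf hg
  obtain ⟨he, hfe, hc⟩ := side_mem hf
  obtain ⟨-, hge, hc'⟩ := side_mem hg
  exact Set.eq_empty_iff_forall_notMem.1
    (D.isCurveSystem.no_triple_point e he f hfe g hge hc.1 hc'.1 hfg) z ⟨⟨h1, h2⟩, h4⟩

/-- A slanted upward edge has a subdivision into ready edges. -/
theorem exists_ready_mesh {U : Set Edge} (hS : Stage D U) {a b : Pt} (hab : (a, b) ∈ D.edges)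
    (hsl : a.1 ≠ b.1) (hup : b.2 ≤ a.2) :
    ∃ D' G r, 0 < r ∧ Isotopic D D' ∧ G.Finite ∧ Stage D' (U \ {(a, b)} ∪ G) ∧
      (∀ g ∈ G, Ready D' r g) ∧
      (∀ g ∈ G, ∀ g' ∈ G, g ≠ g' → ∀ x, InX g x → ¬ InX g' x) := by
  have hD := D.isCurveSystem
  obtain ⟨r₀, hr₀, hsep⟩ := exists_separation hD.crossPts_finite
  -- The endpoints and the vertical edges that do not meet `(a, b)` have positive distance to it.
  set C : Set Pt := {p | (p = D.leg ∨ p = D.head) ∧ p ∉ segment ℝ a b} ∪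
    ⋃ V ∈ {V ∈ D.edges | Disjoint V.closedSeg (segment ℝ a b)}, V.closedSeg with hC
  have hCc : IsClosed C := by
    apply IsClosed.union
    · apply Set.Finite.isClosed
      exact (Set.toFinite {D.leg, D.head}).subset fun p hp => hp.1
    · apply Set.Finite.isClosed_biUnion (hD.finite.subset fun V hV => hV.1)
      intro V _
      exact (isCompact_seg V.1 V.2).isClosed
  have hdis : Disjoint (segment ℝ a b) C := by
    rw [Set.disjoint_left]
    rintro z hz (hz' | hz')
    · exact hz'.2 hz
    · obtain ⟨V, hV, hzV⟩ := Set.mem_iUnion₂.1 hz'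
      exact Set.disjoint_left.1 hV.2 hzV hz
  obtain ⟨ρ, hρ, hfar⟩ := Metric.exists_pos_forall_lt_edist (isCompact_seg a b) hCc hdis
  have hρ' : (0 : ℝ) < ρ := hρ
  have hfar' : ∀ x ∈ segment ℝ a b, ∀ y ∈ C, (ρ : ℝ) < dist x y := by
    intro x hx y hy
    have := hfar x hx y hy
    rw [edist_dist, ← ENNReal.ofReal_coe_nnreal] at this
    exact (ENNReal.ofReal_lt_ofReal_iff_of_nonneg ρ.2).1 this
  set r : ℝ := min (r₀ / 2) (ρ / 2) with hr
  have hr0 : 0 < r := lt_min (by linarith) (by linarith)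
  have hr1 : r ≤ r₀ / 2 := min_le_left _ _
  have hr2 : r ≤ ρ / 2 := min_le_right _ _
  obtain ⟨D', G, m⟩ := exists_edgeMesh hab (A := crossPts D.edges ∪ levelPts D.edges)
    (hD.crossPts_finite.union (levelPts_finite hD.finite)) Set.subset_union_left hr0
  have hD' := D'.isCurveSystem
  have hGE : G ⊆ D'.edges := by rw [m.edges_eq]; exact Set.subset_union_right
  have hsl' : ∀ g ∈ G, g.1.1 ≠ g.2.1 := by
    intro g hg h
    obtain ⟨k, hk, hd⟩ := m.direction g hg
    have := congrArg Prod.fst hd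
    simp only [Prod.fst_sub, Prod.smul_fst, smul_eq_mul] at this
    have h2 : k * (b.1 - a.1) = 0 := by rw [← this, h]; ring
    exact (mul_ne_zero hk.ne' (sub_ne_zero.2 hsl.symm)) h2
  have hup' : ∀ g ∈ G, g.2.2 ≤ g.1.2 := by
    intro g hg
    obtain ⟨k, hk, hd⟩ := m.direction g hg
    have := congrArg Prod.snd hd
    simp only [Prod.snd_sub, Prod.smul_snd, smul_eq_mul] at this
    nlinarith
  have huniq : ∀ z ∈ segment ℝ a b, ∀ w ∈ segment ℝ a b, z.1 = w.1 → z = w :=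
    fun z hz w hw => eq_of_fst_eq (e := (a, b)) hsl hz hw
  have hbox : ∀ g ∈ G, ∀ z ∈ box r g, z ∉ C := by
    rintro g hg z ⟨hz1, hz2, hz3⟩ hzC
    have h1 := hfar' g.1 (m.closed_sub g hg (left_mem_segment ℝ _ _)) z hzC
    have h2 := m.short g hg
    rw [Prod.dist_eq, max_lt_iff, Real.dist_eq, Real.dist_eq] at h2
    rw [Prod.dist_eq, lt_max_iff, Real.dist_eq, Real.dist_eq] at h1
    have h3 := hup' g hg
    have h4 := abs_lt.1 h2.1
    have h5 := abs_lt.1 h2.2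
    rcases h1 with h1 | h1
    · rcases Set.mem_uIcc.1 hz1 with h6 | h6 <;>
        rcases lt_abs.1 h1 with h7 | h7 <;> linarith
    · rcases lt_abs.1 h1 with h7 | h7 <;> linarith
  refine ⟨D', G, r, hr0, m.refines.isotopic, hD'.finite.subset hGE, ?_, ?_, ?_⟩
  · intro e he
    rw [m.edges_eq] at he
    rcases he with ⟨he, he'⟩ | he
    · rcases hS e he with ⟨h1, h2⟩ | ⟨σ, hσ⟩
      · exact Or.inl ⟨h1, h2.imp (fun h2 => Or.inl ⟨h2, he'⟩) id⟩
      refine Or.inr ⟨σ, ?_, hσ.vertical, hσ.up, ?_, ?_, ?_, ?_, ?_⟩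
      · rw [m.edges_eq]; exact Or.inl ⟨he, he'⟩
      · rw [pure_iff_sidePts]
        exact Set.subset_empty_iff.1 ((m.side_old _ e he he').trans
          (pure_iff_sidePts.1 hσ.pure).subset)
      · rw [m.refines.leg_eq]; exact hσ.leg
      · rw [m.refines.head_eq]; exact hσ.head
      · rintro s ⟨g, hg, hs⟩ hse
        rw [m.edges_eq] at hg
        rcases hg with ⟨hg, -⟩ | hg
        · exact hσ.verts s ⟨g, hg, hs⟩ hse
        · have hsm : s ∈ segment ℝ a b := by
            apply m.closed_sub g hg
            rcases hs with rfl | rfl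
            · exact left_mem_segment ℝ _ _
            · exact right_mem_segment ℝ _ _
          rcases m.ends g hg s hs with rfl | rfl | hsA
          · exact hσ.verts _ (fst_mem_verts hab) hse
          · exact hσ.verts _ (snd_mem_verts hab) hse
          · exact (hsA (Or.inr ⟨(a, b), hab, hsl, hsm, e, he, hσ.vertical, hse⟩)).elim
      · exact fun z hz => hσ.cross z (m.refines.crossPts_subset hz)
    · exact Or.inl ⟨hsl' e he, Or.inl (Or.inr he)⟩
  · intro g hg
    refine ⟨hGE hg, hsl' g hg, hup' g hg, ?_, ?_, ?_⟩
    · apply exists_pure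
      intro z hz w hw hzg hwg
      apply hsep z (m.refines.crossPts_subset hz) w (m.refines.crossPts_subset hw)
      have h1 := (dist_le_of_mem_seg (oseg_subset_seg hzg)).1
      have h2 := (dist_le_of_mem_seg (oseg_subset_seg hwg)).1
      have := dist_triangle_left z w g.1
      linarith [m.short g hg]
    · intro p hp hpb
      have hp' : p = D.leg ∨ p = D.head := by rwa [m.refines.leg_eq, m.refines.head_eq] at hp
      have hps : p ∈ segment ℝ a b := by
        by_contra hps
        exact hbox g hg p hpb (Or.inl ⟨hp', hps⟩)
      obtain ⟨q, hq, hqp⟩ := exists_mem_closedSeg hpb.1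
      rw [huniq q (m.closed_sub g hg hq) p hps hqp] at hq
      obtain ⟨e, he, hpe⟩ : p ∈ verts D'.edges := by
        rcases hp with rfl | rfl
        · exact D'.leg_mem_verts
        · exact D'.head_mem_verts
      exact hD'.vertex_off_edge e he g (hGE hg) p hpe hq
    · intro V hV hv hVg
      have hVE : V ∈ D.edges := by
        rw [m.edges_eq] at hV
        rcases hV with hV | hV
        · exact hV.1
        · exact (hsl' V hV hv).elim
      by_cases hdj : Disjoint V.closedSeg (segment ℝ a b)
      · refine Or.inr fun z hz hzb => hbox g hg z hzb (Or.inr ?_)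
        exact Set.mem_biUnion (x := V) ⟨hVE, hdj⟩ hz
      · obtain ⟨z, hzV, hz⟩ := Set.not_disjoint_iff.1 hdj
        obtain ⟨q, hq, hqV⟩ := hVg.exists_mem
        have hqz := huniq q (m.closed_sub g hg (oseg_subset_seg hq)) z hz
          (hqV.trans (fst_eq_of_mem_seg hv hzV).symm)
        subst hqz
        refine Or.inl ⟨fun h => hsl' g hg (h ▸ hv), q, ?_, hq⟩
        have hqne := oseg_ne (hD'.nondegenerate g (hGE hg)) hq
        have hoff := fun hp => hD'.vertex_off_edge V hV g (hGE hg) q hp (oseg_subset_seg hq)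
        refine mem_oseg_of_seg hzV (fun h => ?_) (fun h => ?_)
        · exact (hoff (Or.inl h)).elim hqne.1 hqne.2
        · exact (hoff (Or.inr h)).elim hqne.1 hqne.2
  · intro g hg g' hg' hne x hx hx'
    obtain ⟨z, hz, hzx⟩ := hx.exists_mem
    obtain ⟨w, hw, hwx⟩ := hx'.exists_mem
    have hzw := huniq z (m.closed_sub g hg (oseg_subset_seg hz)) w
      (m.closed_sub g' hg' (oseg_subset_seg hw)) (hzx.trans hwx.symm)
    subst hzw
    exact m.sep g hg g' hg' hne z hz (oseg_subset_seg hw)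

/-- The edges in `U` can be processed one after another: the upward ones are subdivided and replaced
by staircases. -/
theorem exists_stage_empty {U : Set Edge} (hU : U.Finite) :
    ∀ D : MultiKnotoidDiagram, Stage D U → ∃ D', Isotopic D D' ∧ Stage D' ∅ := by
  induction U, hU using Set.Finite.induction_on with
  | empty => exact fun D hS => ⟨D, Isotopic.refl D, hS⟩
  | @insert e U he hU ih =>
    intro D hS
    by_cases h : e ∈ D.edges ∧ ¬ e.1.2 < e.2.2
    · rcases hS e h.1 with ⟨hsl, -⟩ | ⟨σ, hσ⟩
      · obtain ⟨D₁, G, r, hr, iso, hG, hS₁, hR, hx⟩ :=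
          exists_ready_mesh (a := e.1) (b := e.2) hS h.1 hsl (not_lt.1 h.2)
        obtain ⟨D₂, iso₂, hS₂⟩ := exists_stage_of_ready hr hG D₁ U
          (hS₁.mono (by
            rintro f (⟨hf | hf, hf'⟩ | hf) - -
            · exact (hf' hf).elim
            · exact Or.inl hf
            · exact Or.inr hf)) hR hx
        obtain ⟨D₃, iso₃, hS₃⟩ := ih D₂ hS₂
        exact ⟨D₃, (iso.trans iso₂).trans iso₃, hS₃⟩
      · refine ih D fun f hf => ?_
        rcases hS f hf with ⟨h1, h2 | h2⟩ | h2
        · rcases h2 with rfl | h2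
          · exact (h1 hσ.vertical).elim
          · exact Or.inl ⟨h1, Or.inl h2⟩
        · exact Or.inl ⟨h1, Or.inr h2⟩
        · exact Or.inr h2
    · refine ih D (hS.mono ?_)
      rintro f (rfl | hf) hfD hf'
      · exact (h ⟨hfD, hf'⟩).elim
      · exact hf

/-- The shear `(x, t) ↦ (x + k * t, t)`. -/
def shear (k : ℝ) (z : Pt) : Pt := (z.1 + k * z.2, z.2)

theorem exists_not_vertical (D : MultiKnotoidDiagram) :
    ∃ D', Isotopic D D' ∧ ∀ e ∈ D'.edges, e.1.1 ≠ e.2.1 := by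
  have hD := D.isCurveSystem
  -- The shear makes `e` vertical for at most one value of `k`.
  obtain ⟨k, hk⟩ :=
    (hD.finite.image fun e : Edge => (e.1.1 - e.2.1) / (e.2.2 - e.1.2)).exists_notMem
  have haff : ∀ s : ℝ, EdgeAffine D (shear (s * k)) := by
    intro s
    refine ⟨?_, ?_⟩
    · intro z w h
      have h1 := congrArg Prod.fst h
      have h2 := congrArg Prod.snd h
      simp only [shear] at h1 h2
      rw [h2] at h1
      exact Prod.ext (by linarith) h2
    · intro e _ t _ _
      ext
      · simp only [shear, AffineMap.lineMap_apply_module, Prod.fst_add, Prod.smul_fst, smul_eq_mul,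
          Prod.snd_add, Prod.smul_snd]
        ring
      · simp only [shear, AffineMap.lineMap_apply_module, Prod.smul_snd, smul_eq_mul,
          Prod.snd_add]
  refine ⟨_, isotopic_family (φ := fun s => shear (s * k)) (fun s _ => haff s) ?_ ?_ (haff 1), ?_⟩
  · intro v
    unfold shear
    fun_prop
  · funext z
    simp [shear]
  · rintro e he
    obtain ⟨f, hf, rfl⟩ := he
    simp only [mapEdge, shear]
    intro h
    apply hk
    refine ⟨f, hf, ?_⟩
    have h1 : f.2.2 - f.1.2 ≠ 0 := by
      intro h0
      apply hD.nondegenerate f hf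
      have h2 : f.2.2 = f.1.2 := by linarith
      rw [h2] at h
      exact Prod.ext (by linarith) h2.symm
    simp only
    rw [div_eq_iff h1]
    linarith

/-- Every diagram is isotopic to one whose edges are descending or risers. -/
theorem exists_normal (D : MultiKnotoidDiagram) : ∃ D', Isotopic D D' ∧ Stage D' ∅ := by
  obtain ⟨D₁, iso, h⟩ := exists_not_vertical D
  obtain ⟨D₂, iso₂, hS⟩ := exists_stage_empty D₁.isCurveSystem.finite D₁
    (fun e he => Or.inl ⟨h e he, Or.inl he⟩)
  exact ⟨D₂, iso.trans iso₂, hS⟩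

end MultiKnotoidDiagram

end PLKnotoid

namespace PLKnotoid

/-! ### Equidistant risers in the unit square -/

/-- The map that acts by `h` and `k` on the two coordinates. -/
def coordMap (h k : ℝ → ℝ) (z : Pt) : Pt := (h z.1, k z.2)

/-- Strictly monotone coordinate changes preserve the normal form. -/
theorem MultiKnotoidDiagram.EdgeAffine.stage {D : MultiKnotoidDiagram} {h k : ℝ → ℝ}
    (hh : StrictMono h) (hk : StrictMono k) (ha : D.EdgeAffine (coordMap h k)) (hS : Stage D ∅) :
    Stage ha.mapOK.diagram ∅ := by
  rintro _ ⟨e, he, rfl⟩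
  rcases hS e he with ⟨h1, h2⟩ | ⟨σ, hσ⟩
  · exact Or.inl ⟨fun h' => h1 (hh.injective h'), Or.inr (hk (h2.resolve_left (fun h => h)))⟩
  refine Or.inr ⟨σ, ha.mapOK.mem_edges he, congrArg h hσ.vertical, hk hσ.up,
    (ha.mapOK.pure_iff he).2 hσ.pure, fun h' => hσ.leg (hh.injective h'),
    fun h' => hσ.head (hh.injective h'), ?_, ?_⟩
  · intro s hs hse
    rw [ha.mapOK.verts_eq] at hs
    obtain ⟨s, hs, rfl⟩ := hs
    exact (hσ.verts s hs (hh.injective hse)).imp (congrArg _) (congrArg _)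
  · rintro z ⟨_, ⟨f, hf, rfl⟩, _, ⟨g, hg, rfl⟩, hfg, hz, hz'⟩ hze
    rw [ha.oseg hf] at hz
    rw [ha.oseg hg] at hz'
    obtain ⟨w, hw, rfl⟩ := hz
    rw [ha.inj.mem_set_image] at hz'
    rw [ha.oseg he]
    exact ⟨w, hσ.cross w ⟨f, hf, g, hg, fun h' => hfg (h' ▸ rfl), hw, hz'⟩ (hh.injective hze), rfl⟩

/-- The edges `V i` are the vertical edges, from the left to the right. -/
structure Enumerates (D : MultiKnotoidDiagram) {n : ℕ} (V : Fin n → Edge) : Prop where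
  mem : ∀ i, V i ∈ D.edges
  vertical : ∀ i, (V i).1.1 = (V i).2.1
  surj : ∀ e ∈ D.edges, e.1.1 = e.2.1 → ∃ i, V i = e
  mono : StrictMono fun i => (V i).1.1

theorem Stage.exists_enumerates {D : MultiKnotoidDiagram} (hS : Stage D ∅) :
    ∃ (n : ℕ) (V : Fin n → Edge), Enumerates D V := by
  classical
  have hf : {e ∈ D.edges | e.1.1 = e.2.1}.Finite := D.isCurveSystem.finite.subset fun e he => he.1
  let S : Finset ℝ := hf.toFinset.image fun e => e.1.1
  have hmem : ∀ i, ∃ e ∈ D.edges, e.1.1 = e.2.1 ∧ e.1.1 = S.orderEmbOfFin rfl i := by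
    intro i
    obtain ⟨e, he, hei⟩ := Finset.mem_image.1 (S.orderEmbOfFin_mem rfl i)
    have := hf.mem_toFinset.1 he
    exact ⟨e, this.1, this.2, hei⟩
  choose V hV hv hx using hmem
  refine ⟨S.card, V, hV, hv, ?_, ?_⟩
  · intro e he hev
    have : e.1.1 ∈ Set.range (S.orderEmbOfFin rfl) := by
      rw [Finset.range_orderEmbOfFin]
      exact Finset.mem_image.2 ⟨e, hf.mem_toFinset.2 ⟨he, hev⟩, rfl⟩
    obtain ⟨i, hi⟩ := this
    obtain ⟨σ, hσ⟩ := hS.riser he hev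
    obtain ⟨ρ, hρ⟩ := hS.riser (hV i) (hv i)
    exact ⟨i, hρ.eq_of_fst_eq hσ ((hx i).trans hi)⟩
  · intro i j hij
    simp only [hx]
    exact (S.orderEmbOfFin rfl).strictMono hij

theorem Enumerates.map {D : MultiKnotoidDiagram} {n : ℕ} {V : Fin n → Edge} (hV : Enumerates D V)
    {h k : ℝ → ℝ} (hh : StrictMono h) (ha : D.EdgeAffine (coordMap h k)) :
    Enumerates ha.mapOK.diagram fun i => mapEdge (coordMap h k) (V i) := by
  refine ⟨fun i => ha.mapOK.mem_edges (hV.mem i), fun i => congrArg h (hV.vertical i), ?_, ?_⟩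
  · rintro _ ⟨e, he, rfl⟩ hv
    obtain ⟨i, rfl⟩ := hV.surj e he (hh.injective hv)
    exact ⟨i, rfl⟩
  · exact fun i j hij => hh (hV.mono hij)

namespace MultiKnotoidDiagram

/-- The normal form is kept when the edges are subdivided along a vertical line in general
position. -/
theorem exists_cut_line {c : ℝ} (D : MultiKnotoidDiagram) (hS : Stage D ∅)
    (hX : ∀ z ∈ crossPts D.edges, z.1 ≠ c) (hV : ∀ e ∈ D.edges, e.1.1 = e.2.1 → e.1.1 ≠ c) :
    ∃ D', Isotopic D D' ∧ Stage D' ∅ ∧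
      (∀ e, e.1.1 = e.2.1 → (e ∈ D'.edges ↔ e ∈ D.edges)) ∧ ∀ e ∈ D'.edges, ¬ InX e c := by
  induction hn : {e ∈ D.edges | InX e c}.ncard using Nat.strong_induction_on generalizing D with
  | _ n ih =>
    by_cases h : ∀ e ∈ D.edges, ¬ InX e c
    · exact ⟨D, Isotopic.refl D, hS, fun e _ => Iff.rfl, h⟩
    push Not at h
    obtain ⟨⟨a, b⟩, hab, hc⟩ := h
    obtain ⟨p, hp, hpc⟩ := hc.exists_mem
    have hfin := D.isCurveSystem.finite
    obtain ⟨D₁, cut⟩ := exists_isCut hab hp fun h => hX p h hpc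
    have hab' : a.1 ≠ b.1 := fun h' => by
      have := hc.ne
      have hp' := fst_eq_of_mem_seg (e := (a, b)) h' (oseg_subset_seg hp)
      exact this.1 (hpc.symm.trans hp')
    have hnew : ∀ e, IsNew a b p e → e.1.1 ≠ e.2.1 ∧ e.1.2 < e.2.2 ∧ ¬ InX e c := by
      have hdesc : a.2 < b.2 := by
        rcases hS _ hab with ⟨-, h2⟩ | ⟨σ, hσ⟩
        · exact h2.resolve_left fun h => h
        · exact (hab' hσ.vertical).elim
      obtain ⟨s, h0, h1, -, e2⟩ := mem_oseg_iff.1 hp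
      rintro e (rfl | rfl)
      · exact ⟨fun h' => hc.ne.1 (hpc.symm.trans h'.symm), by simp only; nlinarith,
          fun h' => h'.ne.2 hpc.symm⟩
      · exact ⟨fun h' => hc.ne.2 (hpc.symm.trans h'), by simp only; nlinarith,
          fun h' => h'.ne.1 hpc.symm⟩
    have hmem : ∀ e, e ∈ D₁.edges ↔ (e ∈ D.edges ∧ e ≠ (a, b)) ∨ IsNew a b p e := by
      intro e; rw [cut.edges_eq]; exact mem_insertEdges'
    have hvert : ∀ e : Edge, e.1.1 = e.2.1 → (e ∈ D₁.edges ↔ e ∈ D.edges) := by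
      intro e hev
      rw [hmem]
      constructor
      · rintro (h | h)
        · exact h.1
        · exact ((hnew e h).1 hev).elim
      · exact fun he => Or.inl ⟨he, fun h' => hab' (by rw [h'] at hev; exact hev)⟩
    have hS₁ : Stage D₁ ∅ := by
      intro e he
      rcases (hmem e).1 he with ⟨heD, hne⟩ | he'
      · rcases hS e heD with h | ⟨σ, hσ⟩
        · exact Or.inl h
        refine Or.inr ⟨σ, he, hσ.vertical, hσ.up, ?_, ?_, ?_, ?_, ?_⟩
        · rw [pure_iff_sidePts]
          exact Set.subset_empty_iff.1 ((cut.sidePts_old heD hne _).trans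
            (pure_iff_sidePts.1 hσ.pure).subset)
        · rw [cut.leg_eq]; exact hσ.leg
        · rw [cut.head_eq]; exact hσ.head
        · intro s hs hse
          rw [cut.edges_eq] at hs
          rcases cut.insertable.verts_subset hs with hs | rfl
          · exact hσ.verts s hs hse
          · exact (hV e heD hσ.vertical (hse.symm.trans hpc)).elim
        · exact fun z hz => hσ.cross z (cut.crossPts_subset hz)
      · exact Or.inl ⟨(hnew e he').1, Or.inr (hnew e he').2.1⟩
    obtain ⟨D₂, iso, hS₂, hv₂, hc₂⟩ := ih _ (by
        rw [← hn]
        apply Set.ncard_lt_ncard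
        · refine ⟨?_, fun h' => ?_⟩
          · rintro e ⟨he, hec⟩
            rcases (hmem e).1 he with h1 | h1
            · exact ⟨h1.1, hec⟩
            · exact ((hnew e h1).2.2 hec).elim
          · have := (hmem _).1 (h' ⟨hab, hc⟩).1
            rcases this with h1 | h1
            · exact h1.2 rfl
            · exact (hnew _ h1).2.2 hc
        · exact hfin.subset fun e he => he.1) D₁ hS₁
      (fun z hz => hX z (cut.crossPts_subset hz))
      (fun e he hev => hV e ((hvert e hev).1 he) hev) rfl
    exact ⟨D₂, cut.isotopic.trans iso, hS₂, fun e hev => (hv₂ e hev).trans (hvert e hev), hc₂⟩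

/-- The piecewise linear function with slope `1` up to `c` and slope `1 + m` from there on. -/
def bend (c m x : ℝ) : ℝ := x + m * max (x - c) 0

theorem bend_of_le {c m x : ℝ} (h : x ≤ c) : bend c m x = x := by
  rw [bend, max_eq_right (by linarith)]; ring

theorem bend_of_ge {c m x : ℝ} (h : c ≤ x) : bend c m x = x + m * (x - c) := by
  rw [bend, max_eq_left (by linarith)]

theorem bend_strictMono {c m : ℝ} (hm : -1 < m) : StrictMono (bend c m) := by
  intro x y hxy
  rcases le_total y c with hy | hy
  · rwa [bend_of_le hy, bend_of_le (hxy.le.trans hy)]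
  · rcases le_total x c with hx | hx
    · rw [bend_of_ge hy, bend_of_le hx]
      rcases hx.lt_or_eq with hx | rfl <;> nlinarith
    · rw [bend_of_ge hy, bend_of_ge hx]
      nlinarith

theorem edgeAffine_bend {D : MultiKnotoidDiagram} {c m : ℝ} (hm : -1 < m)
    (hc : ∀ e ∈ D.edges, ¬ InX e c) : EdgeAffine D (coordMap (bend c m) id) := by
  refine ⟨?_, ?_⟩
  · intro z w h
    exact Prod.ext ((bend_strictMono hm).injective (congrArg Prod.fst h))
      (congrArg Prod.snd h :)
  · intro e he s h0 h1
    have h := hc e he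
    unfold InX at h
    rw [not_lt] at h
    have key : bend c m (AffineMap.lineMap e.1.1 e.2.1 s)
        = AffineMap.lineMap (bend c m e.1.1) (bend c m e.2.1) s := by
      simp only [AffineMap.lineMap_apply_module, smul_eq_mul]
      have : (e.1.1 ≤ c ∧ e.2.1 ≤ c) ∨ (c ≤ e.1.1 ∧ c ≤ e.2.1) := by
        rcases le_total e.1.1 c with h2 | h2 <;> rcases le_total e.2.1 c with h3 | h3
        · exact Or.inl ⟨h2, h3⟩
        · rcases h2.eq_or_lt with h2 | h2
          · exact Or.inr ⟨h2.ge, h3⟩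
          · exact Or.inl ⟨h2.le, by nlinarith⟩
        · rcases h2.eq_or_lt with h2 | h2
          · exact Or.inl ⟨h2.ge, h3⟩
          · exact Or.inr ⟨h2.le, by nlinarith⟩
        · exact Or.inr ⟨h2, h3⟩
      rcases this with ⟨h2, h3⟩ | ⟨h2, h3⟩
      · rw [bend_of_le h2, bend_of_le h3, bend_of_le (by nlinarith)]
      · rw [bend_of_ge h2, bend_of_ge h3, bend_of_ge (by nlinarith)]
        ring
    have e1 : (AffineMap.lineMap e.1 e.2 s : Pt) =
        (AffineMap.lineMap e.1.1 e.2.1 s, AffineMap.lineMap e.1.2 e.2.2 s) := by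
      simp only [AffineMap.lineMap_apply_module]
      rfl
    rw [e1]
    simp only [coordMap, key, id]
    simp only [AffineMap.lineMap_apply_module]
    rfl

/-- The `k`-th gap between consecutive risers can be made equal to `1` without changing the gaps
before it. -/
theorem exists_gap_step {D : MultiKnotoidDiagram} (hS : Stage D ∅) {n : ℕ} {V : Fin n → Edge}
    (hV : Enumerates D V) (k : ℕ)
    (hk : ∀ i j : Fin n, j.val = i.val + 1 → j.val ≤ k → (V j).1.1 = (V i).1.1 + 1) :
    ∃ (D' : MultiKnotoidDiagram) (V' : Fin n → Edge), Isotopic D D' ∧ Stage D' ∅ ∧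
      Enumerates D' V' ∧
      ∀ i j : Fin n, j.val = i.val + 1 → j.val ≤ k + 1 → (V' j).1.1 = (V' i).1.1 + 1 := by
  by_cases hkn : k + 1 < n
  swap
  · exact ⟨D, V, Isotopic.refl D, hS, hV, fun i j hij _ => hk i j hij (by omega)⟩
  set a : Fin n := ⟨k, by omega⟩ with ha
  set b : Fin n := ⟨k + 1, hkn⟩ with hb
  have hab : (V a).1.1 < (V b).1.1 := hV.mono (by simp [ha, hb])
  obtain ⟨c, ⟨hc1, hc2⟩, hcX⟩ := (Set.Ioo_infinite (lt_min hab (lt_add_one (V a).1.1))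
    ).exists_notMem_finite (D.isCurveSystem.crossPts_finite.image Prod.fst)
  rw [lt_min_iff] at hc2
  have hcmp : ∀ i : Fin n, (i.val ≤ k → (V i).1.1 < c) ∧ (k + 1 ≤ i.val → c < (V i).1.1) := by
    intro i
    refine ⟨fun hi => ?_, fun hi => ?_⟩
    · exact (hV.mono.monotone (show i ≤ a from hi)).trans_lt hc1
    · exact hc2.1.trans_le (hV.mono.monotone (show b ≤ i from hi))
  obtain ⟨D₁, iso₁, hS₁, hv₁, hc₁⟩ := exists_cut_line (c := c) D hS
    (fun z hz h => hcX ⟨z, hz, h⟩) (by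
      intro e he hev
      obtain ⟨i, rfl⟩ := hV.surj e he hev
      rcases le_or_gt i.val k with hi | hi
      · exact ((hcmp i).1 hi).ne
      · exact ((hcmp i).2 hi).ne')
  have hV₁ : Enumerates D₁ V := ⟨fun i => (hv₁ _ (hV.vertical i)).2 (hV.mem i), hV.vertical,
    fun e he hev => hV.surj e ((hv₁ e hev).1 he) hev, hV.mono⟩
  -- The slope to the right of `c` is chosen such that the next riser moves to distance `1`.
  set m : ℝ := ((V a).1.1 + 1 - (V b).1.1) / ((V b).1.1 - c) with hm
  have hbc : 0 < (V b).1.1 - c := by linarith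
  have hm1 : -1 < m := by
    rw [hm, lt_div_iff₀ hbc]
    linarith
  have hms : ∀ s ∈ Set.Icc (0 : ℝ) 1, -1 < s * m := by
    rintro s ⟨h0, h1⟩
    rcases h0.eq_or_lt with rfl | h0
    · norm_num
    · nlinarith [mul_pos h0 (by linarith : 0 < m + 1)]
  have haff : EdgeAffine D₁ (coordMap (bend c (1 * m)) id) :=
    edgeAffine_bend (hms 1 (by simp)) hc₁
  have hmono : StrictMono (bend c (1 * m)) := bend_strictMono (hms 1 (by simp))
  refine ⟨_, _, iso₁.trans (isotopic_family (φ := fun s => coordMap (bend c (s * m)) id)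
    (fun s hs => edgeAffine_bend (hms s hs) hc₁) ?_ ?_ haff),
    EdgeAffine.stage hmono strictMono_id haff hS₁, hV₁.map hmono haff, ?_⟩
  · intro v
    unfold coordMap bend
    fun_prop
  · funext z
    simp [coordMap, bend]
  · intro i j hij hjk
    change bend c (1 * m) (V j).1.1 = bend c (1 * m) (V i).1.1 + 1
    have hi := ((hcmp i).1 (by omega)).le
    rcases le_or_gt j.val k with hj | hj
    · rw [bend_of_le hi, bend_of_le ((hcmp j).1 hj).le]
      exact hk i j hij hj
    · have hjb : j = b := Fin.ext (by simp only [hb]; omega)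
      have hia : i = a := Fin.ext (by simp only [ha]; omega)
      rw [bend_of_le hi, bend_of_ge ((hcmp j).2 hj).le, hjb, hia, hm]
      field_simp
      ring

theorem exists_equidistant (D : MultiKnotoidDiagram) (hS : Stage D ∅) :
    ∃ (D' : MultiKnotoidDiagram) (n : ℕ) (V : Fin n → Edge) (c : ℝ), Isotopic D D' ∧ Stage D' ∅ ∧
      Enumerates D' V ∧ ∀ i, (V i).1.1 = c + (i : ℕ) := by
  obtain ⟨n, V, hV⟩ := hS.exists_enumerates
  have step : ∀ k : ℕ, ∃ (D' : MultiKnotoidDiagram) (V' : Fin n → Edge), Isotopic D D' ∧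
      Stage D' ∅ ∧ Enumerates D' V' ∧
      ∀ i j : Fin n, j.val = i.val + 1 → j.val ≤ k → (V' j).1.1 = (V' i).1.1 + 1 := by
    intro k
    induction k with
    | zero => exact ⟨D, V, Isotopic.refl D, hS, hV, fun i j h1 h2 => by omega⟩
    | succ k ih =>
      obtain ⟨D₁, V₁, iso, hS₁, hV₁, hk⟩ := ih
      obtain ⟨D₂, V₂, iso₂, hS₂, hV₂, hk₂⟩ := exists_gap_step hS₁ hV₁ k hk
      exact ⟨D₂, V₂, iso.trans iso₂, hS₂, hV₂, hk₂⟩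
  obtain ⟨D', V', iso, hS', hV', hk⟩ := step n
  rcases n with _ | n
  · exact ⟨D', 0, V', 0, iso, hS', hV', fun i => i.elim0⟩
  refine ⟨D', n + 1, V', (V' 0).1.1, iso, hS', hV', ?_⟩
  rintro ⟨k, hkn⟩
  induction k with
  | zero => simp
  | succ k ih =>
    rw [hk ⟨k, by omega⟩ ⟨k + 1, hkn⟩ rfl hkn.le, ih]
    push_cast
    ring

/-- Every diagram is isotopic to one in the open unit square whose edges are descending or
equidistant risers. -/
theorem exists_equidistant_square (D : MultiKnotoidDiagram) :
    ∃ (D' : MultiKnotoidDiagram) (n : ℕ) (V : Fin n → Edge) (c d : ℝ), Isotopic D D' ∧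
      Stage D' ∅ ∧ Enumerates D' V ∧ 0 < d ∧ (∀ i, (V i).1.1 = endX c d i) ∧
      ∀ s ∈ verts D'.edges, s ∈ Set.Ioo (0 : ℝ) 1 ×ˢ Set.Ioo (0 : ℝ) 1 := by
  obtain ⟨D₀, iso₀, hS₀⟩ := exists_normal D
  obtain ⟨D₁, n, V, c, iso₁, hS, hV, hx⟩ := exists_equidistant D₀ hS₀
  obtain ⟨M, hM⟩ := (verts_finite D₁.isCurveSystem.finite).isBounded.exists_norm_le
  have hM0 : 0 ≤ M := (norm_nonneg _).trans (hM _ D₁.leg_mem_verts)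
  set α : ℝ := 1 / (2 * (M + 1)) with hα
  have hα0 : 0 < α := by positivity
  have hαM : α * (M + 1) = 1 / 2 := by rw [hα]; field_simp
  let h : ℝ → ℝ → ℝ := fun s x => (1 - s + s * α) * x + s * (1 / 2)
  have hpos : ∀ s ∈ Set.Icc (0 : ℝ) 1, 0 < 1 - s + s * α := by
    rintro s ⟨h0, h1⟩
    rcases h0.eq_or_lt with rfl | h0
    · norm_num
    · have := mul_pos h0 hα0
      linarith
  have hmono : ∀ s ∈ Set.Icc (0 : ℝ) 1, StrictMono (h s) := by
    intro s hs x y hxy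
    have := hpos s hs
    simp only [h]
    nlinarith
  have haff : ∀ s ∈ Set.Icc (0 : ℝ) 1, EdgeAffine D₁ (coordMap (h s) (h s)) := by
    intro s hs
    refine ⟨?_, ?_⟩
    · intro z w hzw
      exact Prod.ext ((hmono s hs).injective (congrArg Prod.fst hzw))
        ((hmono s hs).injective (congrArg Prod.snd hzw))
    · intro e _ t _ _
      ext
      · simp only [coordMap, h, AffineMap.lineMap_apply_module, Prod.fst_add, Prod.smul_fst,
          smul_eq_mul]
        ring
      · simp only [coordMap, h, AffineMap.lineMap_apply_module, Prod.snd_add, Prod.smul_snd,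
          smul_eq_mul]
        ring
  have i1 : (1 : ℝ) ∈ Set.Icc (0 : ℝ) 1 := by simp
  refine ⟨(haff 1 i1).mapOK.diagram, n, fun i => mapEdge (coordMap (h 1) (h 1)) (V i),
    α * c + 1 / 2, α, (iso₀.trans iso₁).trans (isotopic_family
    (φ := fun s => coordMap (h s) (h s)) haff ?_ ?_ (haff 1 i1)),
    EdgeAffine.stage (hmono 1 i1) (hmono 1 i1) (haff 1 i1) hS, hV.map (hmono 1 i1) (haff 1 i1),
    hα0, ?_, ?_⟩
  · intro v
    simp only [coordMap, h]
    fun_prop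
  · funext z
    simp [coordMap, h]
  · intro i
    change h 1 (V i).1.1 = _
    rw [hx]
    simp only [h, endX]
    ring
  · intro s hs
    rw [MapOK.verts_eq] at hs
    obtain ⟨v, hv, rfl⟩ := hs
    have h1 := hM v hv
    rw [Prod.norm_def, max_le_iff, Real.norm_eq_abs, Real.norm_eq_abs, abs_le, abs_le] at h1
    simp only [coordMap, h]
    refine ⟨⟨?_, ?_⟩, ⟨?_, ?_⟩⟩ <;> simp only <;> nlinarith

end MultiKnotoidDiagram

end PLKnotoid

namespace PLKnotoid

/-! ### Growing a finger out of a riser -/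

theorem seg_fst_le {a b z : Pt} {m : ℝ} (ha : a.1 ≤ m) (hb : b.1 ≤ m) (hz : z ∈ segment ℝ a b) :
    z.1 ≤ m := by
  obtain ⟨s, h0, h1, e, -⟩ := mem_seg_iff.1 hz
  rw [e]; nlinarith

theorem le_seg_fst {a b z : Pt} {m : ℝ} (ha : m ≤ a.1) (hb : m ≤ b.1) (hz : z ∈ segment ℝ a b) :
    m ≤ z.1 := by
  obtain ⟨s, h0, h1, e, -⟩ := mem_seg_iff.1 hz
  rw [e]; nlinarith

theorem seg_snd_le {a b z : Pt} {m : ℝ} (ha : a.2 ≤ m) (hb : b.2 ≤ m) (hz : z ∈ segment ℝ a b) :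
    z.2 ≤ m := by
  obtain ⟨s, h0, h1, -, e⟩ := mem_seg_iff.1 hz
  rw [e]; nlinarith

theorem le_seg_snd {a b z : Pt} {m : ℝ} (ha : m ≤ a.2) (hb : m ≤ b.2) (hz : z ∈ segment ℝ a b) :
    m ≤ z.2 := by
  obtain ⟨s, h0, h1, -, e⟩ := mem_seg_iff.1 hz
  rw [e]; nlinarith

theorem oseg_fst_lt {a b z : Pt} {m : ℝ} (ha : a.1 < m) (hb : b.1 ≤ m)
    (hz : z ∈ openSegment ℝ a b) : z.1 < m := by
  obtain ⟨s, h0, h1, e, -⟩ := mem_oseg_iff.1 hz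
  rw [e]; nlinarith

namespace MultiKnotoidDiagram

variable {D : MultiKnotoidDiagram}

/-- In the vertical strip `x ≤ z.1 ≤ x + ε`, the diagram `D` consists of the edges `N`, which are
pure of type `τ`, and of pieces of the edges `R`, which run between the levels `0` and `1`, do not
cross each other, and have no vertices apart from `p` and `q`. -/
structure InStrip (D : MultiKnotoidDiagram) (R N : Set Edge) (τ : Label) (p q : Pt) (x ε : ℝ) :
    Prop where
  edges_eq : D.edges = R ∪ N
  disjoint : ∀ e ∈ N, e ∉ R
  pure : ∀ e ∈ N, Pure D.passesOver τ e
  mem_fst : p ∈ verts N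
  mem_snd : q ∈ verts N
  verts : ∀ s ∈ verts R, s.1 ∈ Set.Icc x (x + ε) → s = p ∨ s = q
  level : ∀ f ∈ R, ∀ z ∈ f.closedSeg, z.1 ∈ Set.Icc x (x + ε) → z.2 ∈ Set.Ioo (0 : ℝ) 1
  cross : ∀ f ∈ R, ∀ g ∈ R, f ≠ g → ∀ z ∈ f.openSeg, z ∈ g.openSeg → z.1 ∉ Set.Icc x (x + ε)
  ends : ∀ s, (s = D.leg ∨ s = D.head) → s.1 ∉ Set.Icc x (x + ε)

/-- Inserting a vertex `v` into an edge `(a, b)` of `N` inside the strip. Only the mutual position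
of the edges `N` matters if `v` does not lie between the levels `0` and `1`. -/
theorem InStrip.exists_step {R N N' : Set Edge} {τ : Label} {p q : Pt} {x ε : ℝ}
    (h : InStrip D R N τ p q x ε) {a b v : Pt} (hab : (a, b) ∈ N)
    (hN' : ∀ e, e ∈ N' ↔ (e ∈ N ∧ e ≠ (a, b)) ∨ e = (a, v) ∨ e = (v, b))
    (ha : a.1 ∈ Set.Icc x (x + ε)) (hb : b.1 ∈ Set.Icc x (x + ε)) (hv : v.1 ∈ Set.Icc x (x + ε))
    (hvl : v.2 ∉ Set.Ioo (0 : ℝ) 1) (hva : v ≠ a) (hvb : v ≠ b)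
    (off : ∀ f ∈ N, f ≠ (a, b) → v ∉ f.closedSeg)
    (left : ∀ s ∈ PLKnotoid.verts N, s ∈ segment ℝ a v → s = a)
    (right : ∀ s ∈ PLKnotoid.verts N, s ∈ segment ℝ v b → s = b)
    (dleft : ∀ f ∈ N, f ≠ (a, b) → ∀ z ∈ openSegment ℝ a v, z ∉ f.openSeg)
    (dright : ∀ f ∈ N, f ≠ (a, b) → ∀ z ∈ openSegment ℝ v b, z ∉ f.openSeg) :
    ∃ D', Isotopic D D' ∧ D'.leg = D.leg ∧ D'.head = D.head ∧
      (∀ e ∈ R, ∀ f ∈ R, (D'.passesOver e f ↔ D.passesOver e f)) ∧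
      InStrip D' R N' τ p q x ε := by
  have habE : (a, b) ∈ D.edges := by rw [h.edges_eq]; exact Or.inr hab
  have hseg : ∀ {c c' z : Pt}, c.1 ∈ Set.Icc x (x + ε) → c'.1 ∈ Set.Icc x (x + ε) →
      z ∈ segment ℝ c c' → z.1 ∈ Set.Icc x (x + ε) := fun hc hc' hz =>
    ⟨le_seg_fst hc.1 hc'.1 hz, seg_fst_le hc.2 hc'.2 hz⟩
  have hvert : ∀ s ∈ PLKnotoid.verts D.edges, s.1 ∈ Set.Icc x (x + ε) →
      s ∈ PLKnotoid.verts N := by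
    rintro s ⟨e, he, hs⟩ hsx
    rw [h.edges_eq] at he
    rcases he with he | he
    · rcases h.verts s ⟨e, he, hs⟩ hsx with rfl | rfl
      · exact h.mem_fst
      · exact h.mem_snd
    · exact ⟨e, he, hs⟩
  have hI : Insertable D.edges a b v := by
    refine ⟨habE, hva, hvb, ?_, ?_, ?_, ?_, ?_⟩
    · intro f hf hfa hm
      rw [h.edges_eq] at hf
      rcases hf with hf | hf
      · exact hvl (h.level f hf v hm hv)
      · exact off f hf hfa hm
    · exact fun s hs hm => left s (hvert s hs (hseg ha hv hm)) hm
    · exact fun s hs hm => right s (hvert s hs (hseg hv hb hm)) hm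
    · intro f hf g hg hfa hga hfg z hz h1 h2
      rw [h.edges_eq] at hf hg
      rcases hf with hf | hf
      · rcases hg with hg | hg
        · exact h.cross f hf g hg hfg z h1 h2 (hseg ha hv (oseg_subset_seg hz))
        · exact dleft g hg hga z hz h2
      · exact dleft f hf hfa z hz h1
    · intro f hf g hg hfa hga hfg z hz h1 h2
      rw [h.edges_eq] at hf hg
      rcases hf with hf | hf
      · rcases hg with hg | hg
        · exact h.cross f hf g hg hfg z h1 h2 (hseg hv hb (oseg_subset_seg hz))
        · exact dright g hg hga z hz h2
      · exact dright f hf hfa z hz h1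
  have hRne : ∀ e ∈ R, e ≠ (a, b) := fun e he h' => h.disjoint _ hab (h' ▸ he)
  have hRE : ∀ e ∈ R, e ∈ D.edges := fun e he => by rw [h.edges_eq]; exact Or.inl he
  have hNE : ∀ e ∈ N, e ∈ D.edges := fun e he => by rw [h.edges_eq]; exact Or.inr he
  have hconv : Convex ℝ (Set.Icc x (x + ε) ×ˢ (Set.univ : Set ℝ)) :=
    (convex_Icc _ _).prod convex_univ
  obtain ⟨D', iso, edges, leg, head, rest, pure₁, pure₂⟩ := exists_insert τ hI (h.pure _ hab)
    (fun s hs hm => (h.ends s hs (triangle_subset_of_convex hconv (a := a) (b := b) (c := v)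
      ⟨ha, trivial⟩ ⟨hb, trivial⟩ ⟨hv, trivial⟩ hm).1).elim)
  have hverts' : ∀ s ∈ PLKnotoid.verts N, s ∈ PLKnotoid.verts N' := by
    rintro s ⟨e, he, hs⟩
    by_cases hea : e = (a, b)
    · subst hea
      rcases hs with rfl | rfl
      · exact fst_mem_verts ((hN' _).2 (Or.inr (Or.inl rfl)))
      · exact snd_mem_verts ((hN' _).2 (Or.inr (Or.inr rfl)))
    · exact ⟨e, (hN' e).2 (Or.inl ⟨he, hea⟩), hs⟩
  refine ⟨D', iso, leg, head, fun e he f hf =>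
    rest e (hRE e he) f (hRE f hf) (hRne e he) (hRne f hf), ?_, ?_, ?_, hverts' _ h.mem_fst,
    hverts' _ h.mem_snd, h.verts, h.level, h.cross, ?_⟩
  · ext e
    rw [edges, mem_insertEdges, h.edges_eq, Set.mem_union, Set.mem_union, hN']
    constructor
    · rintro (⟨h1 | h1, h2⟩ | h1)
      · exact Or.inl h1
      · exact Or.inr (Or.inl ⟨h1, h2⟩)
      · exact Or.inr (Or.inr h1)
    · rintro (h1 | ⟨h1, h2⟩ | h1)
      · exact Or.inl ⟨Or.inl h1, hRne e h1⟩
      · exact Or.inl ⟨Or.inr h1, h2⟩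
      · exact Or.inr h1
  · intro e he heR
    rcases (hN' e).1 he with ⟨he, -⟩ | he
    · exact h.disjoint e he heR
    · exact hI.new_notMem he (hRE e heR)
  · intro e he
    rcases (hN' e).1 he with ⟨he, hea⟩ | rfl | rfl
    · rw [pure_iff_side]
      intro f hs
      obtain ⟨-, hf, -, z, hz, hz'⟩ := side_mem hs
      rw [edges] at hf
      rcases mem_insertEdges.1 hf with ⟨hf, hfa⟩ | rfl | rfl
      · apply pure_iff_side.1 (h.pure e he) f
        cases τ
        · exact (rest f hf e (hNE e he) hfa hea).1 hs
        · exact (rest e (hNE e he) f hf hea hfa).1 hs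
      · exact dleft e he hea z hz' hz
      · exact dright e he hea z hz' hz
    · exact pure₁
    · exact pure₂
  · rw [leg, head]; exact h.ends

end MultiKnotoidDiagram

/-- The parts of a finger at the vertical line through its riser, which goes from `(x, a)` to
`(x, b)`: they join the riser's ends to the ends of the joining arc. -/
def stubs (x a b : ℝ) : Set Edge := {((x, a), (x, 1)), ((x, 0), (x, b))}

/-- The finger that replaces the riser from `(x, a)` to `(x, b)`. -/
def finger (x a b ε : ℝ) : Set Edge := stubs x a b ∪ joiningArc x ε

namespace MultiKnotoidDiagram

variable {D : MultiKnotoidDiagram}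

/-- A riser can be replaced by a finger. The finger is obtained by four insertions of vertices at
levels where the strip contains no other edges, so that general position only has to be checked
against the finger itself. -/
theorem exists_finger {R : Set Edge} {τ : Label} {x a b ε : ℝ} (hε : 0 < ε) (hb : 0 < b)
    (hba : b < a) (ha : a < 1)
    (h : InStrip D R {((x, a), (x, b))} τ (x, a) (x, b) x ε) :
    ∃ D', Isotopic D D' ∧ D'.leg = D.leg ∧ D'.head = D.head ∧
      (∀ e ∈ R, ∀ f ∈ R, (D'.passesOver e f ↔ D.passesOver e f)) ∧
      InStrip D' R (finger x a b ε) τ (x, a) (x, b) x ε := by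
  set p : Pt := (x, a) with hp
  set q : Pt := (x, b) with hq
  set A : Pt := (x + ε, 1 + ε) with hA
  set A' : Pt := (x + ε, -ε) with hA'
  set B : Pt := (x, 1) with hB
  set B' : Pt := (x, 0) with hB'
  have mx : x ∈ Set.Icc x (x + ε) := ⟨le_rfl, by linarith⟩
  have mxε : x + ε ∈ Set.Icc x (x + ε) := ⟨by linarith, le_rfl⟩
  have pA : ∀ z ∈ segment ℝ p A, a ≤ z.2 := fun z =>
    le_seg_snd le_rfl (by simp only [hA]; linarith)
  have Aq : p ∉ segment ℝ A q := by
    intro hm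
    obtain ⟨s, -, -, e1, e2⟩ := mem_seg_iff.1 hm
    simp only [hp, hq, hA] at e1 e2
    have h1 : ε * (1 - s) = 0 := by linarith
    have h2 := (mul_eq_zero.1 h1).resolve_left hε.ne'
    have hs : s = 1 := by linarith
    rw [hs] at e2
    linarith
  have AA' : ∀ z ∈ segment ℝ A A', x + ε ≤ z.1 := fun z => le_seg_fst le_rfl le_rfl
  have A'q : ∀ z ∈ segment ℝ A' q, z.2 ≤ b := fun z =>
    seg_snd_le (by simp only [hA']; linarith) le_rfl
  have pB : ∀ z ∈ segment ℝ p B, z.1 ≤ x ∧ a ≤ z.2 := fun z hz =>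
    ⟨seg_fst_le le_rfl le_rfl hz, le_seg_snd le_rfl (by simp only [hB]; linarith) hz⟩
  have BA : ∀ z ∈ segment ℝ B A, 1 ≤ z.2 := fun z =>
    le_seg_snd le_rfl (by simp only [hA]; linarith)
  have A'B' : ∀ z ∈ segment ℝ A' B', z.2 ≤ 0 := fun z =>
    seg_snd_le (by simp only [hA']; linarith) le_rfl
  have B'q : ∀ z ∈ segment ℝ B' q, z.1 ≤ x ∧ 0 ≤ z.2 ∧ z.2 ≤ b := fun z hz =>
    ⟨seg_fst_le le_rfl le_rfl hz, le_seg_snd le_rfl hb.le hz, seg_snd_le hb.le le_rfl hz⟩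
  have opA : ∀ z ∈ openSegment ℝ p A, z.1 < x + ε := fun z =>
    oseg_fst_lt (by simp only [hp]; linarith) le_rfl
  have oBA : ∀ z ∈ openSegment ℝ B A, z.1 < x + ε := fun z =>
    oseg_fst_lt (by simp only [hB]; linarith) le_rfl
  have oA'B' : ∀ z ∈ openSegment ℝ A' B', z.1 < x + ε := fun z hz =>
    oseg_fst_lt (a := B') (b := A') (by simp only [hB']; linarith) le_rfl
      (by rwa [openSegment_symm])
  have vpair : ∀ {N : Set Edge} {P : Pt → Prop}, (∀ e ∈ N, P e.1 ∧ P e.2) →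
      ∀ s ∈ verts N, P s := by
    rintro N P hN s ⟨e, he, rfl | rfl⟩
    · exact (hN e he).1
    · exact (hN e he).2
  have o2 : ∀ {z : Pt} {u v : Pt}, z ∈ Edge.openSeg (u, v) → z ∈ segment ℝ u v :=
    fun hz => oseg_subset_seg hz
  have npA : p ≠ A := fun h => by have := congrArg Prod.fst h; simp [hp, hA] at this; linarith
  have nqA : q ≠ A := fun h => by have := congrArg Prod.fst h; simp [hq, hA] at this; linarith
  have npA' : p ≠ A' := fun h => by have := congrArg Prod.fst h; simp [hp, hA'] at this; linarith
  have nqA' : q ≠ A' := fun h => by have := congrArg Prod.fst h; simp [hq, hA'] at this; linarith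
  have nAA' : A ≠ A' := fun h => by have := congrArg Prod.snd h; simp [hA, hA'] at this; linarith
  have npB : p ≠ B := fun h => by have := congrArg Prod.snd h; simp [hp, hB] at this; linarith
  have nAB : A ≠ B := fun h => by have := congrArg Prod.fst h; simp [hA, hB] at this; linarith
  have nA'B : A' ≠ B := fun h => by have := congrArg Prod.fst h; simp [hA', hB] at this; linarith
  have nA'B' : A' ≠ B' := fun h => by
    have := congrArg Prod.fst h; simp [hA', hB'] at this; linarith
  have nqB' : q ≠ B' := fun h => by have := congrArg Prod.snd h; simp [hq, hB'] at this; linarith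
  -- Pull the riser over to the lower tip of the joining arc.
  obtain ⟨D₁, iso₁, leg₁, head₁, rest₁, h₁⟩ := h.exists_step (a := p) (b := q) (v := A)
    (N' := {(p, A), (A, q)}) rfl
    (by
      intro e
      simp only [Set.mem_insert_iff, Set.mem_singleton_iff]
      constructor
      · exact Or.inr
      · rintro (⟨h1, h2⟩ | h1)
        · exact (h2 h1).elim
        · exact h1)
    mx mx mxε (fun h => by have := h.2; simp only [hA] at this; linarith) npA.symm nqA.symm
    (by rintro f rfl hf; exact (hf rfl).elim)
    (vpair (by
      rintro e rfl
      refine ⟨fun _ => rfl, fun hm => ?_⟩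
      have := pA _ hm
      simp only [hq] at this
      linarith))
    (vpair (by
      rintro e rfl
      exact ⟨fun hm => (Aq hm).elim, fun _ => rfl⟩))
    (by rintro f rfl hf; exact (hf rfl).elim)
    (by rintro f rfl hf; exact (hf rfl).elim)
  -- Then pull the edge that returns from this tip over to the upper tip.
  obtain ⟨D₂, iso₂, leg₂, head₂, rest₂, h₂⟩ := h₁.exists_step (a := A) (b := q) (v := A')
    (N' := {(p, A), (A, A'), (A', q)}) (Or.inr rfl)
    (by
      intro e
      simp only [Set.mem_insert_iff, Set.mem_singleton_iff]
      constructor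
      · rintro (rfl | h1)
        · exact Or.inl ⟨Or.inl rfl, fun h => npA (congrArg Prod.fst h)⟩
        · exact Or.inr h1
      · rintro (⟨h1 | h1, h2⟩ | h1)
        · exact Or.inl h1
        · exact (h2 h1).elim
        · exact Or.inr h1)
    mxε mx mxε (fun h => by have := h.1; simp only [hA'] at this; linarith) nAA'.symm nqA'.symm
    (by
      rintro f (rfl | rfl) hf hm
      · have := pA _ hm
        simp only [hA'] at this
        linarith
      · exact (hf rfl).elim)
    (vpair (by
      have hx : ∀ t : ℝ, ((x, t) : Pt) ∉ segment ℝ A A' := fun t hm => by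
        have := AA' _ hm
        simp only at this
        linarith
      rintro e (rfl | rfl)
      · exact ⟨fun hm => (hx _ hm).elim, fun _ => rfl⟩
      · exact ⟨fun _ => rfl, fun hm => (hx _ hm).elim⟩))
    (vpair (by
      have hn : ∀ s : Pt, a ≤ s.2 → s ∉ segment ℝ A' q := fun s hs hm => by
        have := A'q _ hm
        linarith
      have h1 : A ∉ segment ℝ A' q := hn A (by simp only [hA]; linarith)
      rintro e (rfl | rfl)
      · exact ⟨fun hm => (hn p le_rfl hm).elim, fun hm => (h1 hm).elim⟩
      · exact ⟨fun hm => (h1 hm).elim, fun _ => rfl⟩))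
    (by
      rintro f (rfl | rfl) hf z hz hm
      · exact absurd (AA' z (oseg_subset_seg hz)) (not_le.2 (opA z hm))
      · exact hf rfl)
    (by
      rintro f (rfl | rfl) hf z hz hm
      · have := A'q z (oseg_subset_seg hz)
        have := pA z (o2 hm)
        linarith
      · exact hf rfl)
  -- The two remaining insertions make the edges at the riser's ends vertical.
  obtain ⟨D₃, iso₃, leg₃, head₃, rest₃, h₃⟩ := h₂.exists_step (a := p) (b := A) (v := B)
    (N' := {(p, B), (B, A), (A, A'), (A', q)}) (Or.inl rfl)
    (by
      intro e
      simp only [Set.mem_insert_iff, Set.mem_singleton_iff]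
      constructor
      · rintro (h1 | h1 | rfl | rfl)
        · exact Or.inr (Or.inl h1)
        · exact Or.inr (Or.inr h1)
        · exact Or.inl ⟨Or.inr (Or.inl rfl), fun h => npA (congrArg Prod.fst h).symm⟩
        · exact Or.inl ⟨Or.inr (Or.inr rfl), fun h => npA' (congrArg Prod.fst h).symm⟩
      · rintro (⟨h1 | h1, h2⟩ | h1 | h1)
        · exact (h2 h1).elim
        · exact Or.inr (Or.inr h1)
        · exact Or.inl h1
        · exact Or.inr (Or.inl h1))
    mx mxε mx (fun h => by have := h.2; simp only [hB] at this; linarith) npB.symm nAB.symm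
    (by
      rintro f (rfl | rfl | rfl) hf hm
      · exact hf rfl
      · have := AA' _ hm
        simp only [hB] at this
        linarith
      · have := A'q _ hm
        simp only [hB] at this
        linarith)
    (vpair (by
      have h1 : A ∉ segment ℝ p B := fun hm => by
        have := (pB _ hm).1
        simp only [hA] at this
        linarith
      have h2 : A' ∉ segment ℝ p B := fun hm => by
        have := (pB _ hm).1
        simp only [hA'] at this
        linarith
      have h3 : q ∉ segment ℝ p B := fun hm => by
        have := (pB _ hm).2
        simp only [hq] at this
        linarith
      rintro e (rfl | rfl | rfl)
      · exact ⟨fun _ => rfl, fun hm => (h1 hm).elim⟩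
      · exact ⟨fun hm => (h1 hm).elim, fun hm => (h2 hm).elim⟩
      · exact ⟨fun hm => (h2 hm).elim, fun hm => (h3 hm).elim⟩))
    (vpair (by
      have hn : ∀ s : Pt, s.2 < 1 → s ∉ segment ℝ B A := fun s hs hm => by
        have := BA _ hm
        linarith
      have h2 : A' ∉ segment ℝ B A := hn A' (by simp only [hA']; linarith)
      rintro e (rfl | rfl | rfl)
      · exact ⟨fun hm => (hn p ha hm).elim, fun _ => rfl⟩
      · exact ⟨fun _ => rfl, fun hm => (h2 hm).elim⟩
      · exact ⟨fun hm => (h2 hm).elim, fun hm => (hn q (hba.trans ha) hm).elim⟩))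
    (by
      rintro f (rfl | rfl | rfl) hf z hz hm
      · exact hf rfl
      · have := AA' z (o2 hm)
        have := (pB z (oseg_subset_seg hz)).1
        linarith
      · have := A'q z (o2 hm)
        have := (pB z (oseg_subset_seg hz)).2
        linarith)
    (by
      rintro f (rfl | rfl | rfl) hf z hz hm
      · exact hf rfl
      · exact absurd (AA' z (o2 hm)) (not_le.2 (oBA z hz))
      · have := A'q z (o2 hm)
        have := BA z (oseg_subset_seg hz)
        linarith)
  obtain ⟨D₄, iso₄, leg₄, head₄, rest₄, h₄⟩ := h₃.exists_step (a := A') (b := q) (v := B')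
    (N' := finger x a b ε) (Or.inr (Or.inr (Or.inr rfl)))
    (by
      intro e
      simp only [finger, stubs, joiningArc, Set.mem_union, Set.mem_insert_iff,
        Set.mem_singleton_iff]
      constructor
      · rintro ((rfl | h1) | rfl | rfl | h1)
        · exact Or.inl ⟨Or.inl rfl, fun h => npA' (congrArg Prod.fst h)⟩
        · exact Or.inr (Or.inr h1)
        · exact Or.inl ⟨Or.inr (Or.inl rfl), fun h => nA'B (congrArg Prod.fst h).symm⟩
        · exact Or.inl ⟨Or.inr (Or.inr (Or.inl rfl)), fun h => nAA' (congrArg Prod.fst h)⟩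
        · exact Or.inr (Or.inl h1)
      · rintro (⟨h1 | h1 | h1 | h1, h2⟩ | h1 | h1)
        · exact Or.inl (Or.inl h1)
        · exact Or.inr (Or.inl h1)
        · exact Or.inr (Or.inr (Or.inl h1))
        · exact (h2 h1).elim
        · exact Or.inr (Or.inr (Or.inr h1))
        · exact Or.inl (Or.inr h1))
    mxε mx mx (fun h => by have := h.1; simp only [hB'] at this; linarith) nA'B'.symm nqB'.symm
    (by
      rintro f (rfl | rfl | rfl | rfl) hf hm
      · have := (pB _ hm).2
        simp only [hB'] at this
        linarith
      · have := BA _ hm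
        simp only [hB'] at this
        linarith
      · have := AA' _ hm
        simp only [hB'] at this
        linarith
      · exact hf rfl)
    (vpair (by
      have hn : ∀ s : Pt, 0 < s.2 → s ∉ segment ℝ A' B' := fun s hs hm => by
        have := A'B' _ hm
        linarith
      have h1 := hn A (by simp only [hA]; linarith)
      have h2 := hn B (by simp only [hB]; linarith)
      rintro e (rfl | rfl | rfl | rfl)
      · exact ⟨fun hm => (hn p (hb.trans hba) hm).elim, fun hm => (h2 hm).elim⟩
      · exact ⟨fun hm => (h2 hm).elim, fun hm => (h1 hm).elim⟩
      · exact ⟨fun hm => (h1 hm).elim, fun _ => rfl⟩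
      · exact ⟨fun _ => rfl, fun hm => (hn q hb hm).elim⟩))
    (vpair (by
      have hn : ∀ s : Pt, b < s.2 → s ∉ segment ℝ B' q := fun s hs hm => by
        have := (B'q _ hm).2.2
        linarith
      have h1 := hn A (by simp only [hA]; linarith)
      have h2 := hn B (by simp only [hB]; linarith)
      have h3 : A' ∉ segment ℝ B' q := fun hm => by
        have := (B'q _ hm).2.1
        simp only [hA'] at this
        linarith
      rintro e (rfl | rfl | rfl | rfl)
      · exact ⟨fun hm => (hn p hba hm).elim, fun hm => (h2 hm).elim⟩
      · exact ⟨fun hm => (h2 hm).elim, fun hm => (h1 hm).elim⟩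
      · exact ⟨fun hm => (h1 hm).elim, fun hm => (h3 hm).elim⟩
      · exact ⟨fun hm => (h3 hm).elim, fun _ => rfl⟩))
    (by
      rintro f (rfl | rfl | rfl | rfl) hf z hz hm
      · have := A'B' z (oseg_subset_seg hz)
        have := (pB z (o2 hm)).2
        linarith
      · have := A'B' z (oseg_subset_seg hz)
        have := BA z (o2 hm)
        linarith
      · exact absurd (AA' z (o2 hm)) (not_le.2 (oA'B' z hz))
      · exact hf rfl)
    (by
      rintro f (rfl | rfl | rfl | rfl) hf z hz hm
      · have := (B'q z (oseg_subset_seg hz)).2.2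
        have := (pB z (o2 hm)).2
        linarith
      · have := (B'q z (oseg_subset_seg hz)).2.2
        have := BA z (o2 hm)
        linarith
      · have := (B'q z (oseg_subset_seg hz)).1
        have := AA' z (o2 hm)
        linarith
      · exact hf rfl)
  refine ⟨D₄, ((iso₁.trans iso₂).trans iso₃).trans iso₄, ?_, ?_, ?_, h₄⟩
  · rw [leg₄, leg₃, leg₂, leg₁]
  · rw [head₄, head₃, head₂, head₁]
  · intro e he f hf
    rw [rest₄ e he f hf, rest₃ e he f hf, rest₂ e he f hf, rest₁ e he f hf]

end MultiKnotoidDiagram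

end PLKnotoid

namespace PLKnotoid

/-! ### Replacing all risers by fingers -/

/-- The edges `V i` are equidistant risers of `D`, of types `τ i`, all other edges descend, and `D`
lies in the open unit square. -/
structure IsFramed (D : MultiKnotoidDiagram) {n : ℕ} (V : Fin n → Edge) (τ : Fin n → Label)
    (c d : ℝ) : Prop where
  riser : ∀ i, IsRiser D (τ i) (V i)
  descending : ∀ e ∈ D.edges, (∀ i, e ≠ V i) → e.1.2 < e.2.2
  pos : 0 < d
  fst : ∀ i, (V i).1.1 = endX c d i
  square : ∀ s ∈ verts D.edges, s ∈ Set.Ioo (0 : ℝ) 1 ×ˢ Set.Ioo (0 : ℝ) 1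

/-- The strips of width `ε` to the right of the risers are disjoint and free of the vertices and
crossings of `D` outside of the lines of the risers. -/
structure Thin (D : MultiKnotoidDiagram) (n : ℕ) (c d ε : ℝ) : Prop where
  pos : 0 < ε
  lt : ε < d
  sep : ∀ i : Fin n, ∀ z ∈ verts D.edges ∪ crossPts D.edges,
    z.1 ∈ Set.Icc (endX c d i) (endX c d i + ε) → z.1 = endX c d i

theorem eventually_thin (D : MultiKnotoidDiagram) (n : ℕ) (c : ℝ) {d : ℝ} (hd : 0 < d) :
    ∀ᶠ ε in 𝓝[>] (0 : ℝ), Thin D n c d ε := by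
  have hfin : (verts D.edges ∪ crossPts D.edges).Finite :=
    (verts_finite D.isCurveSystem.finite).union D.isCurveSystem.crossPts_finite
  have h1 : ∀ᶠ ε in 𝓝[>] (0 : ℝ), ε < d := nhdsWithin_le_nhds (eventually_lt_nhds hd)
  have h2 : ∀ᶠ ε in 𝓝[>] (0 : ℝ), ∀ i : Fin n, ∀ z ∈ verts D.edges ∪ crossPts D.edges,
      z.1 ∈ Set.Icc (endX c d i) (endX c d i + ε) → z.1 = endX c d i := by
    rw [eventually_all]
    intro i
    rw [Set.Finite.eventually_all hfin]
    intro z _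
    by_cases hz : endX c d i < z.1
    · filter_upwards [nhdsWithin_le_nhds (eventually_lt_nhds (sub_pos.2 hz))] with ε hε hm
      have := hm.2
      linarith
    · exact Eventually.of_forall fun ε hm => le_antisymm (not_lt.1 hz) hm.1
  filter_upwards [h1, h2, self_mem_nhdsWithin] with ε h1 h2 h3
  exact ⟨h3, h1, h2⟩

theorem Thin.disjoint {D : MultiKnotoidDiagram} {n : ℕ} {c d ε : ℝ} (h : Thin D n c d ε)
    {i j : Fin n} (hij : i ≠ j) {y : ℝ} (hi : y ∈ Set.Icc (endX c d i) (endX c d i + ε)) :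
    y ∉ Set.Icc (endX c d j) (endX c d j + ε) := by
  have key : ∀ i j : Fin n, i < j → endX c d i + ε < endX c d j := by
    intro i j hij
    have h1 : ((i : ℕ) : ℝ) + 1 ≤ ((j : ℕ) : ℝ) := by exact_mod_cast hij
    have := h.pos.trans h.lt
    have := h.lt
    unfold endX
    nlinarith
  intro hj
  rcases lt_or_gt_of_ne hij with h1 | h1
  · linarith [key i j h1, hi.2, hj.1]
  · linarith [key j i h1, hj.2, hi.1]

theorem finger_strip {x a b ε : ℝ} (hε : 0 < ε) {e : Edge} (he : e ∈ finger x a b ε) {z : Pt}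
    (hz : z ∈ e.closedSeg) : z.1 ∈ Set.Icc x (x + ε) := by
  have h : e.1.1 ∈ Set.Icc x (x + ε) ∧ e.2.1 ∈ Set.Icc x (x + ε) := by
    rcases he with (rfl | rfl) | rfl | rfl | rfl <;>
      simp only [Set.mem_Icc] <;> refine ⟨⟨?_, ?_⟩, ?_, ?_⟩ <;> linarith
  exact ⟨le_seg_fst h.1.1 h.2.1 hz, seg_fst_le h.1.2 h.2.2 hz⟩

section Frame

variable {D : MultiKnotoidDiagram} {n : ℕ} {V : Fin n → Edge} {τ : Fin n → Label} {c d ε : ℝ}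

/-- The finger that replaces the `i`-th riser. -/
def fingerOf (V : Fin n → Edge) (c d ε : ℝ) (i : Fin n) : Set Edge :=
  finger (endX c d i) (V i).1.2 (V i).2.2 ε

/-- The stubs of the finger that replaces the `i`-th riser. -/
def stubsOf (V : Fin n → Edge) (c d : ℝ) (i : Fin n) : Set Edge :=
  stubs (endX c d i) (V i).1.2 (V i).2.2

/-- The edges of `D` that are not risers. -/
def restEdges (D : MultiKnotoidDiagram) (V : Fin n → Edge) : Set Edge :=
  {e | e ∈ D.edges ∧ ∀ i, e ≠ V i}

theorem IsFramed.riser_eq (h : IsFramed D V τ c d) (i : Fin n) :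
    V i = ((endX c d i, (V i).1.2), (endX c d i, (V i).2.2)) := by
  rw [← h.fst i]
  conv_rhs => rw [show ((V i).1.1, (V i).2.2) = (V i).2 by rw [(h.riser i).vertical]]

theorem IsFramed.fst_of_mem (h : IsFramed D V τ c d) (i : Fin n) {z : Pt}
    (hz : z ∈ (V i).closedSeg) : z.1 = endX c d i :=
  (fst_eq_of_mem_seg (h.riser i).vertical hz).trans (h.fst i)

theorem Thin.endX_mem (ht : Thin D n c d ε) (i : Fin n) :
    endX c d i ∈ Set.Icc (endX c d i) (endX c d i + ε) := ⟨le_rfl, by linarith [ht.pos]⟩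

theorem Thin.not_both (ht : Thin D n c d ε) {i j : Fin n} (hij : i ≠ j) {e f : Edge}
    (he : e ∈ fingerOf V c d ε i) (hf : f ∈ fingerOf V c d ε j) {z : Pt} (hz : z ∈ e.closedSeg) :
    z ∉ f.closedSeg := fun hz' =>
  ht.disjoint hij (finger_strip ht.pos he hz) (finger_strip ht.pos hf hz')

theorem IsFramed.not_both (h : IsFramed D V τ c d) (ht : Thin D n c d ε) {i j : Fin n}
    (hij : i ≠ j) {f : Edge} (hf : f ∈ fingerOf V c d ε j) {z : Pt} (hz : z ∈ (V i).closedSeg) :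
    z ∉ f.closedSeg := fun hz' =>
  ht.disjoint hij (by rw [h.fst_of_mem i hz]; exact ht.endX_mem i) (finger_strip ht.pos hf hz')

theorem IsFramed.inj (h : IsFramed D V τ c d) (ht : Thin D n c d ε) {i j : Fin n}
    (hij : V i = V j) : i = j := by
  by_contra hne
  refine ht.disjoint hne (ht.endX_mem i) ?_
  rw [← h.fst i, hij, h.fst j]
  exact ht.endX_mem j

open MultiKnotoidDiagram

/-- The diagram obtained by replacing the risers in `I` by fingers. -/
structure Fingers (D D' : MultiKnotoidDiagram) (V : Fin n → Edge) (τ : Fin n → Label)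
    (c d ε : ℝ) (I : Finset (Fin n)) : Prop where
  isotopic : Isotopic D D'
  leg_eq : D'.leg = D.leg
  head_eq : D'.head = D.head
  mem_edges : ∀ e, e ∈ D'.edges ↔
    (e ∈ D.edges ∧ ∀ i ∈ I, e ≠ V i) ∨ ∃ i ∈ I, e ∈ fingerOf V c d ε i
  rest : ∀ e ∈ D.edges, ∀ f ∈ D.edges, (∀ i ∈ I, e ≠ V i) → (∀ i ∈ I, f ≠ V i) →
    (D'.passesOver e f ↔ D.passesOver e f)
  pure : ∀ i ∈ I, ∀ e ∈ fingerOf V c d ε i, Pure D'.passesOver (τ i) e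

/-- When some risers are replaced by fingers, the strip of another riser `V i` still consists of
`V i` and pieces of descending edges which do not cross each other. -/
theorem Fingers.inStrip {D' : MultiKnotoidDiagram} {I : Finset (Fin n)}
    (F : Fingers D D' V τ c d ε I) (h : IsFramed D V τ c d) (ht : Thin D n c d ε) {i : Fin n}
    (hi : i ∉ I) : InStrip D' (D'.edges \ {V i}) {V i} (τ i) (V i).1 (V i).2 (endX c d i) ε := by
  have hD := D.isCurveSystem
  have hne : ∀ j ∈ I, i ≠ j := fun j hj hij => hi (hij ▸ hj)
  have hVi := (h.riser i).mem
  have hViF : V i ∈ D'.edges := (F.mem_edges _).2 (Or.inl ⟨hVi, fun j hj hij =>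
    hne j hj (h.inj ht hij)⟩)
  have hfin : ∀ e ∈ D'.edges, (∃ z ∈ e.closedSeg, z.1 ∈ Set.Icc (endX c d i) (endX c d i + ε)) →
      e ∈ D.edges ∧ ∀ j ∈ I, e ≠ V j := by
    rintro e he ⟨z, hz, hzx⟩
    rcases (F.mem_edges e).1 he with he | ⟨j, hj, he⟩
    · exact he
    · exact (ht.disjoint (hne j hj) hzx (finger_strip ht.pos he hz)).elim
  refine ⟨?_, ?_, ?_, fst_mem_verts (e := V i) rfl, snd_mem_verts (e := V i) rfl, ?_, ?_, ?_, ?_⟩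
  · rw [Set.sdiff_union_self, Set.union_eq_self_of_subset_right]
    simpa using hViF
  · rintro e rfl he
    exact he.2 rfl
  · rintro e rfl
    rw [pure_iff_side]
    intro f hs
    obtain ⟨-, hf, -, z, hz, hz'⟩ := side_mem hs
    have hf' := hfin f hf ⟨z, oseg_subset_seg hz', by
      rw [h.fst_of_mem i (oseg_subset_seg hz)]; exact ht.endX_mem i⟩
    have hVI : ∀ j ∈ I, V i ≠ V j := fun j hj hij => hne j hj (h.inj ht hij)
    apply pure_iff_side.1 (h.riser i).pure f
    cases hτ : τ i <;> rw [hτ] at hs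
    · exact (F.rest f hf'.1 _ hVi hf'.2 hVI).1 hs
    · exact (F.rest _ hVi f hf'.1 hVI hf'.2).1 hs
  · rintro s ⟨e, he, hs⟩ hsx
    have he' := hfin e he.1 ⟨s, by
      rcases hs with rfl | rfl
      · exact left_mem_segment ℝ _ _
      · exact right_mem_segment ℝ _ _, hsx⟩
    have hsv : s ∈ verts D.edges := ⟨e, he'.1, hs⟩
    exact (h.riser i).verts s hsv ((ht.sep i s (Or.inl hsv) hsx).trans (h.fst i).symm)
  · intro f hf z hz hzx
    have hf' := (hfin f hf.1 ⟨z, hz, hzx⟩).1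
    have h1 := (h.square _ (fst_mem_verts hf')).2
    have h2 := (h.square _ (snd_mem_verts hf')).2
    obtain ⟨s, s0, s1, -, e2⟩ := mem_seg_iff.1 hz
    rw [Set.mem_Ioo] at h1 h2 ⊢
    rw [e2]
    constructor
    · rcases s0.eq_or_lt with rfl | s0
      · linarith
      · nlinarith [mul_pos s0 h2.1]
    · rcases s0.eq_or_lt with rfl | s0
      · linarith
      · nlinarith [mul_pos s0 (sub_pos.2 h2.2)]
  · intro f hf g hg hfg z hz hz' hzx
    have hf' := (hfin f hf.1 ⟨z, oseg_subset_seg hz, hzx⟩).1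
    have hg' := (hfin g hg.1 ⟨z, oseg_subset_seg hz', hzx⟩).1
    have hzc : z ∈ crossPts D.edges := ⟨f, hf', g, hg', hfg, hz, hz'⟩
    have hzV := (h.riser i).cross z hzc
      ((ht.sep i z (Or.inr hzc) hzx).trans (h.fst i).symm)
    exact Set.eq_empty_iff_forall_notMem.1
      (hD.no_triple_point f hf' g hg' (V i) hVi hfg hf.2 hg.2) z ⟨⟨hz, hz'⟩, hzV⟩
  · rintro s hs hsx
    rw [F.leg_eq, F.head_eq] at hs
    have hsv : s ∈ verts D.edges := by
      rcases hs with rfl | rfl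
      · exact D.leg_mem_verts
      · exact D.head_mem_verts
    have := (ht.sep i s (Or.inl hsv) hsx).trans (h.fst i).symm
    rcases hs with rfl | rfl
    · exact (h.riser i).leg this
    · exact (h.riser i).head this

/-- The risers are replaced by fingers one after another; as their strips are disjoint, a finger
does not interfere with the other risers. -/
theorem exists_fingers (h : IsFramed D V τ c d) (ht : Thin D n c d ε) (I : Finset (Fin n)) :
    ∃ D', Fingers D D' V τ c d ε I := by
  classical
  induction I using Finset.induction_on with
  | empty =>
    exact ⟨D, Isotopic.refl D, rfl, rfl, by simp, fun e _ f _ _ _ => Iff.rfl, by simp⟩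
  | @insert i I hi ih =>
    obtain ⟨D₁, F⟩ := ih
    have hne : ∀ j ∈ I, i ≠ j := fun j hj hij => hi (hij ▸ hj)
    have hS := F.inStrip h ht hi
    have hup := (h.riser i).up
    have h1 := (h.square _ (fst_mem_verts (h.riser i).mem)).2
    have h2 := (h.square _ (snd_mem_verts (h.riser i).mem)).2
    have hS' : InStrip D₁ (D₁.edges \ {V i})
        {((endX c d i, (V i).1.2), (endX c d i, (V i).2.2))} (τ i)
        (endX c d i, (V i).1.2) (endX c d i, (V i).2.2) (endX c d i) ε := by
      have := hS
      have e := h.riser_eq i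
      rw [← e]
      have e1 : (endX c d i, (V i).1.2) = (V i).1 := (congrArg Prod.fst e).symm
      have e2 : (endX c d i, (V i).2.2) = (V i).2 := (congrArg Prod.snd e).symm
      rw [e1, e2]
      exact this
    obtain ⟨D₂, iso, leg, head, rest, hS₂⟩ := exists_finger ht.pos h2.1 hup h1.2 hS'
    have hR : ∀ e ∈ D.edges, (∀ j ∈ insert i I, e ≠ V j) → e ∈ D₁.edges \ {V i} :=
      fun e he hj => ⟨(F.mem_edges e).2
          (Or.inl ⟨he, fun j hjI => hj j (Finset.mem_insert_of_mem hjI)⟩),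
        hj i (Finset.mem_insert_self _ _)⟩
    have hRf : ∀ j ∈ I, ∀ e ∈ fingerOf V c d ε j, e ∈ D₁.edges \ {V i} := by
      intro j hj e he
      refine ⟨(F.mem_edges e).2 (Or.inr ⟨j, hj, he⟩), ?_⟩
      rintro rfl
      exact h.not_both ht (hne j hj) he (left_mem_segment ℝ _ _) (left_mem_segment ℝ _ _)
    refine ⟨D₂, F.isotopic.trans iso, leg.trans F.leg_eq, head.trans F.head_eq, ?_, ?_, ?_⟩
    · intro e
      rw [hS₂.edges_eq]
      constructor
      · rintro (⟨he, hne'⟩ | he)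
        · rcases (F.mem_edges e).1 he with ⟨he, hj⟩ | ⟨j, hj, he⟩
          · refine Or.inl ⟨he, fun j hj' => ?_⟩
            rcases Finset.mem_insert.1 hj' with rfl | hj'
            · exact hne'
            · exact hj j hj'
          · exact Or.inr ⟨j, Finset.mem_insert_of_mem hj, he⟩
        · exact Or.inr ⟨i, Finset.mem_insert_self _ _, he⟩
      · rintro (⟨he, hj⟩ | ⟨j, hj, he⟩)
        · exact Or.inl (hR e he hj)
        · rcases Finset.mem_insert.1 hj with rfl | hj
          · exact Or.inr he
          · exact Or.inl (hRf j hj e he)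
    · intro e he f hf hej hfj
      exact (rest e (hR e he hej) f (hR f hf hfj)).trans (F.rest e he f hf
        (fun j hj => hej j (Finset.mem_insert_of_mem hj))
        (fun j hj => hfj j (Finset.mem_insert_of_mem hj)))
    · intro j hj e he
      rcases Finset.mem_insert.1 hj with rfl | hj
      · exact hS₂.pure e he
      · rw [pure_iff_side]
        intro f hs
        obtain ⟨-, hf, -, z, hz, hz'⟩ := side_mem hs
        rw [hS₂.edges_eq] at hf
        have heR := hRf j hj e he
        rcases hf with hf | hf
        · apply pure_iff_side.1 (F.pure j hj e he) f
          cases hτ : τ j <;> rw [hτ] at hs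
          · exact (rest f hf e heR).1 hs
          · exact (rest e heR f hf).1 hs
        · exact ht.not_both (V := V) (hne j hj) hf he (oseg_subset_seg hz') (oseg_subset_seg hz)

end Frame

end PLKnotoid

namespace PLKnotoid

/-! ### The braidoid diagram and its closure -/

/-- A subsystem of a curve system is a curve system. -/
theorem IsCurveSystem.restrict {E E' : Set Edge} {I T I' T' : Set Pt} {R R' : Edge → Edge → Prop}
    (h : IsCurveSystem E I T R) (hE : E' ⊆ E)
    (hR : ∀ e f, R' e f ↔ e ∈ E' ∧ f ∈ E' ∧ R e f)
    (hI : {p | (∃ e ∈ E', e.1 = p) ∧ ¬ ∃ e ∈ E', e.2 = p} = I')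
    (hT : {p | (∃ e ∈ E', e.2 = p) ∧ ¬ ∃ e ∈ E', e.1 = p} = T') :
    IsCurveSystem E' I' T' R' where
  finite := h.finite.subset hE
  nondegenerate e he := h.nondegenerate e (hE he)
  out_unique e he f hf := h.out_unique e (hE he) f (hE hf)
  in_unique e he f hf := h.in_unique e (hE he) f (hE hf)
  init_eq := hI
  term_eq := hT
  vertex_off_edge e he f hf := h.vertex_off_edge e (hE he) f (hE hf)
  transversal e he f hf := h.transversal e (hE he) f (hE hf)
  no_triple_point e he f hf g hg := h.no_triple_point e (hE he) f (hE hf) g (hE hg)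
  passesOver_crosses e f hef := by
    obtain ⟨h1, h2, h3⟩ := (hR e f).1 hef
    exact ⟨h1, h2, (h.passesOver_crosses e f h3).2.2⟩
  passesOver_iff_not e he f hf hc := by
    rw [hR, hR, h.passesOver_iff_not e (hE he) f (hE hf) hc]
    tauto

section Frame

open MultiKnotoidDiagram

variable {D D' : MultiKnotoidDiagram} {n : ℕ} {V : Fin n → Edge} {τ : Fin n → Label} {c d ε : ℝ}

/-- The over/under-data when edges `N i` of type `τ i` replace the risers. -/
def overBy (D : MultiKnotoidDiagram) (V : Fin n → Edge) (τ : Fin n → Label)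
    (N : Fin n → Set Edge) (e f : Edge) : Prop :=
  e.Crosses f ∧ ((e ∈ restEdges D V ∧ f ∈ restEdges D V ∧ D.passesOver e f) ∨
    (∃ i, τ i = Label.o ∧ e ∈ N i ∧ f ∈ restEdges D V) ∨
    (∃ i, τ i = Label.u ∧ f ∈ N i ∧ e ∈ restEdges D V))

/-- The edges of the braidoid diagram: the edges that are not risers, and the stubs. -/
def braidEdges (D : MultiKnotoidDiagram) (V : Fin n → Edge) (c d : ℝ) : Set Edge :=
  restEdges D V ∪ ⋃ i, stubsOf V c d i

namespace Fingers

theorem mem_iff (F : Fingers D D' V τ c d ε Finset.univ) {e : Edge} :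
    e ∈ D'.edges ↔ e ∈ restEdges D V ∨ ∃ i, e ∈ fingerOf V c d ε i := by
  rw [F.mem_edges]
  simp only [Finset.mem_univ, true_and, forall_true_left, restEdges, Set.mem_ofPred_eq]

theorem mem_finger (F : Fingers D D' V τ c d ε Finset.univ) {e : Edge} {i : Fin n}
    (he : e ∈ fingerOf V c d ε i) : e ∈ D'.edges := F.mem_iff.2 (Or.inr ⟨i, he⟩)

theorem not_crosses (F : Fingers D D' V τ c d ε Finset.univ) (ht : Thin D n c d ε) {i j : Fin n}
    {e f : Edge} (he : e ∈ fingerOf V c d ε i) (hf : f ∈ fingerOf V c d ε j) : ¬ e.Crosses f := by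
  by_cases hij : i = j
  · subst hij
    exact not_crosses_of_pure (F.mem_finger he) (F.mem_finger hf)
      (F.pure i (Finset.mem_univ _) e he) (F.pure i (Finset.mem_univ _) f hf)
  · rintro ⟨-, z, hz, hz'⟩
    exact ht.not_both hij he hf (oseg_subset_seg hz) (oseg_subset_seg hz')

theorem passesOver_iff (F : Fingers D D' V τ c d ε Finset.univ) (ht : Thin D n c d ε) (e f : Edge) :
    D'.passesOver e f ↔ overBy D V τ (fingerOf V c d ε) e f := by
  constructor
  · intro h
    obtain ⟨he, hf, hc⟩ := D'.isCurveSystem.passesOver_crosses e f h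
    refine ⟨hc, ?_⟩
    rcases F.mem_iff.1 he with he | ⟨i, he⟩ <;> rcases F.mem_iff.1 hf with hf | ⟨j, hf⟩
    · exact Or.inl ⟨he, hf, (F.rest e he.1 f hf.1 (fun i _ => he.2 i) (fun i _ => hf.2 i)).1 h⟩
    · refine Or.inr (Or.inr ⟨j, ?_, hf, he⟩)
      cases hτ : τ j
      · have := F.pure j (Finset.mem_univ _) f hf
        rw [hτ] at this
        exact (this e h).elim
      · rfl
    · refine Or.inr (Or.inl ⟨i, ?_, he, hf⟩)
      cases hτ : τ i
      · rfl
      · have := F.pure i (Finset.mem_univ _) e he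
        rw [hτ] at this
        exact (this f h).elim
    · exact (F.not_crosses ht he hf hc).elim
  · rintro ⟨hc, ⟨he, hf, h⟩ | ⟨i, hτ, he, hf⟩ | ⟨i, hτ, hf, he⟩⟩
    · exact (F.rest e he.1 f hf.1 (fun i _ => he.2 i) (fun i _ => hf.2 i)).2 h
    · have := (pure_iff (F.mem_finger he)).1 (F.pure i (Finset.mem_univ _) e he) f
        (F.mem_iff.2 (Or.inl hf)) hc
      rwa [hτ] at this
    · have := (pure_iff (F.mem_finger hf)).1 (F.pure i (Finset.mem_univ _) f hf) e
        (F.mem_iff.2 (Or.inl he)) hc.symm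
      rwa [hτ] at this

end Fingers

theorem arc_notMem (ht : Thin D n c d ε) {i : Fin n} {e : Edge}
    (he : e ∈ joiningArc (endX c d i) ε) : e ∉ braidEdges D V c d := by
  have hpos := ht.pos
  have hm : endX c d i + ε ∈ Set.Icc (endX c d i) (endX c d i + ε) := ⟨by linarith, le_rfl⟩
  obtain ⟨s, hs, hsx⟩ : ∃ s, (s = e.1 ∨ s = e.2) ∧ s.1 = endX c d i + ε := by
    rcases he with rfl | rfl | rfl
    · exact ⟨_, Or.inr rfl, rfl⟩
    · exact ⟨_, Or.inr rfl, rfl⟩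
    · exact ⟨_, Or.inl rfl, rfl⟩
  rintro (he' | he')
  · have := ht.sep i s (Or.inl ⟨e, he'.1, hs⟩) (hsx ▸ hm)
    linarith
  · obtain ⟨j, hj⟩ := Set.mem_iUnion.1 he'
    have hsj : s.1 = endX c d j := by
      rcases hj with rfl | rfl <;> rcases hs with rfl | rfl <;> rfl
    by_cases hij : i = j
    · subst hij
      linarith
    · exact ht.disjoint hij (hsj ▸ hsx ▸ hm) (ht.endX_mem j)

namespace Fingers

theorem mem_iff_braid (F : Fingers D D' V τ c d ε Finset.univ) {e : Edge} :
    e ∈ D'.edges ↔ e ∈ braidEdges D V c d ∨ ∃ i : Fin n, e ∈ joiningArc (endX c d i) ε := by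
  rw [F.mem_iff]
  constructor
  · rintro (h | ⟨i, h | h⟩)
    · exact Or.inl (Or.inl h)
    · exact Or.inl (Or.inr (Set.mem_iUnion.2 ⟨i, h⟩))
    · exact Or.inr ⟨i, h⟩
  · rintro ((h | h) | ⟨i, h⟩)
    · exact Or.inl h
    · obtain ⟨i, hi⟩ := Set.mem_iUnion.1 h
      exact Or.inr ⟨i, Or.inl hi⟩
    · exact Or.inr ⟨i, Or.inr h⟩

theorem mem_of_braid (F : Fingers D D' V τ c d ε Finset.univ) {e : Edge}
    (he : e ∈ braidEdges D V c d) : e ∈ D'.edges := F.mem_iff_braid.2 (Or.inl he)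

/-- The strands start at the leg and at the top ends: an edge whose start is not the end of another
strand edge starts at the end of a joining arc, or at the leg. -/
theorem braid_init (F : Fingers D D' V τ c d ε Finset.univ)
    (ht : Thin D n c d ε) :
    {p | (∃ e ∈ braidEdges D V c d, e.1 = p) ∧ ¬ ∃ e ∈ braidEdges D V c d, e.2 = p} =
      {D.leg} ∪ Set.range fun i : Fin n => ((endX c d i, 0) : Pt) := by
  have hD' := D'.isCurveSystem
  have harc : ∀ {e : Edge} {i : Fin n}, e ∈ joiningArc (endX c d i) ε → e ∈ D'.edges :=
    fun {e i} he => F.mem_iff_braid.2 (Or.inr ⟨i, he⟩)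
  ext p
  constructor
  · rintro ⟨⟨e, he, rfl⟩, hno⟩
    by_cases hl : e.1 = D.leg
    · exact Or.inl hl
    obtain ⟨f, hf, hfe⟩ := exists_in_edge (fst_mem_verts (F.mem_of_braid he))
      (by rw [F.leg_eq]; exact hl)
    rcases F.mem_iff_braid.1 hf with hf | ⟨i, hf⟩
    · exact (hno ⟨f, hf, hfe⟩).elim
    · rcases hf with rfl | rfl | rfl
      · have h2 : ((endX c d i + ε, 1 + ε), (endX c d i + ε, -ε)) ∈ joiningArc (endX c d i) ε :=
          Or.inr (Or.inl rfl)
        have := hD'.out_unique e (F.mem_of_braid he) _ (harc h2) hfe.symm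
        exact (arc_notMem ht (this ▸ h2) he).elim
      · have h2 : ((endX c d i + ε, -ε), (endX c d i, 0)) ∈ joiningArc (endX c d i) ε :=
          Or.inr (Or.inr rfl)
        have := hD'.out_unique e (F.mem_of_braid he) _ (harc h2) hfe.symm
        exact (arc_notMem ht (this ▸ h2) he).elim
      · exact Or.inr ⟨i, hfe⟩
  · rintro (rfl | ⟨i, rfl⟩)
    · have hne : ∀ e ∈ D'.edges, e.2 ≠ D.leg := fun e he => F.leg_eq ▸ ne_leg he
      refine ⟨?_, fun ⟨e, he, h'⟩ => hne e (F.mem_of_braid he) h'⟩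
      obtain ⟨e, he, hel⟩ := D'.exists_leg_edge
      rw [F.leg_eq] at hel
      rcases F.mem_iff_braid.1 he with he | ⟨i, he⟩
      · exact ⟨e, he, hel⟩
      · exfalso
        rcases he with rfl | rfl | rfl
        · exact hne ((endX c d i, (V i).1.2), (endX c d i, 1))
            (F.mem_finger (i := i) (Or.inl (Or.inl rfl))) hel
        · exact hne ((endX c d i, 1), (endX c d i + ε, 1 + ε)) (harc (Or.inl rfl)) hel
        · exact hne ((endX c d i + ε, 1 + ε), (endX c d i + ε, -ε))
            (harc (Or.inr (Or.inl rfl))) hel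
    · refine ⟨⟨((endX c d i, 0), (endX c d i, (V i).2.2)),
        Or.inr (Set.mem_iUnion.2 ⟨i, Or.inr rfl⟩), rfl⟩, ?_⟩
      rintro ⟨f, hf, hfe⟩
      have h2 : ((endX c d i + ε, -ε), (endX c d i, 0)) ∈ joiningArc (endX c d i) ε :=
        Or.inr (Or.inr rfl)
      have := hD'.in_unique f (F.mem_of_braid hf) _ (harc h2) hfe
      exact arc_notMem ht (this ▸ h2) hf

theorem braid_term (F : Fingers D D' V τ c d ε Finset.univ)
    (ht : Thin D n c d ε) :
    {p | (∃ e ∈ braidEdges D V c d, e.2 = p) ∧ ¬ ∃ e ∈ braidEdges D V c d, e.1 = p} =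
      {D.head} ∪ Set.range fun i : Fin n => ((endX c d i, 1) : Pt) := by
  have hD' := D'.isCurveSystem
  have harc : ∀ {e : Edge} {i : Fin n}, e ∈ joiningArc (endX c d i) ε → e ∈ D'.edges :=
    fun {e i} he => F.mem_iff_braid.2 (Or.inr ⟨i, he⟩)
  ext p
  constructor
  · rintro ⟨⟨e, he, rfl⟩, hno⟩
    by_cases hl : e.2 = D.head
    · exact Or.inl hl
    obtain ⟨f, hf, hfe⟩ := exists_out_edge (snd_mem_verts (F.mem_of_braid he))
      (by rw [F.head_eq]; exact hl)
    rcases F.mem_iff_braid.1 hf with hf | ⟨i, hf⟩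
    · exact (hno ⟨f, hf, hfe⟩).elim
    · rcases hf with rfl | rfl | rfl
      · exact Or.inr ⟨i, hfe⟩
      · have h2 : ((endX c d i, 1), (endX c d i + ε, 1 + ε)) ∈ joiningArc (endX c d i) ε :=
          Or.inl rfl
        have := hD'.in_unique e (F.mem_of_braid he) _ (harc h2) hfe.symm
        exact (arc_notMem ht (this ▸ h2) he).elim
      · have h2 : ((endX c d i + ε, 1 + ε), (endX c d i + ε, -ε)) ∈ joiningArc (endX c d i) ε :=
          Or.inr (Or.inl rfl)
        have := hD'.in_unique e (F.mem_of_braid he) _ (harc h2) hfe.symm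
        exact (arc_notMem ht (this ▸ h2) he).elim
  · rintro (rfl | ⟨i, rfl⟩)
    · have hne : ∀ e ∈ D'.edges, e.1 ≠ D.head := fun e he => F.head_eq ▸ ne_head he
      refine ⟨?_, fun ⟨e, he, h'⟩ => hne e (F.mem_of_braid he) h'⟩
      obtain ⟨e, he, hel⟩ := D'.exists_head_edge
      rw [F.head_eq] at hel
      rcases F.mem_iff_braid.1 he with he | ⟨i, he⟩
      · exact ⟨e, he, hel⟩
      · exfalso
        rcases he with rfl | rfl | rfl
        · exact hne ((endX c d i + ε, 1 + ε), (endX c d i + ε, -ε))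
            (harc (Or.inr (Or.inl rfl))) hel
        · exact hne ((endX c d i + ε, -ε), (endX c d i, 0)) (harc (Or.inr (Or.inr rfl))) hel
        · exact hne ((endX c d i, 0), (endX c d i, (V i).2.2))
            (F.mem_finger (i := i) (Or.inl (Or.inr rfl))) hel
    · refine ⟨⟨((endX c d i, (V i).1.2), (endX c d i, 1)),
        Or.inr (Set.mem_iUnion.2 ⟨i, Or.inl rfl⟩), rfl⟩, ?_⟩
      rintro ⟨f, hf, hfe⟩
      have h2 : ((endX c d i, 1), (endX c d i + ε, 1 + ε)) ∈ joiningArc (endX c d i) ε :=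
        Or.inl rfl
      have := hD'.out_unique f (F.mem_of_braid hf) _ (harc h2) hfe
      exact arc_notMem ht (this ▸ h2) hf

/-- The over/under-data of the strands do not depend on `ε`. -/
theorem overBy_stubs_iff (F : Fingers D D' V τ c d ε Finset.univ)
    (ht : Thin D n c d ε) (e f : Edge) : overBy D V τ (stubsOf V c d) e f ↔
      e ∈ braidEdges D V c d ∧ f ∈ braidEdges D V c d ∧ D'.passesOver e f := by
  have hst : ∀ {e : Edge} {i : Fin n}, e ∈ stubsOf V c d i → e ∈ braidEdges D V c d :=
    fun he => Or.inr (Set.mem_iUnion.2 ⟨_, he⟩)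
  have hfi : ∀ {e : Edge} {i : Fin n}, e ∈ fingerOf V c d ε i → e ∈ braidEdges D V c d →
      e ∈ stubsOf V c d i := by
    intro e i he he'
    rcases he with he | he
    · exact he
    · exact (arc_notMem ht he he').elim
  rw [F.passesOver_iff ht]
  constructor
  · rintro ⟨hc, ⟨he, hf, ho⟩ | ⟨i, hτ, he, hf⟩ | ⟨i, hτ, hf, he⟩⟩
    · exact ⟨Or.inl he, Or.inl hf, hc, Or.inl ⟨he, hf, ho⟩⟩
    · exact ⟨hst he, Or.inl hf, hc, Or.inr (Or.inl ⟨i, hτ, Or.inl he, hf⟩)⟩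
    · exact ⟨Or.inl he, hst hf, hc, Or.inr (Or.inr ⟨i, hτ, Or.inl hf, he⟩)⟩
  · rintro ⟨heB, hfB, hc, ⟨he, hf, ho⟩ | ⟨i, hτ, he, hf⟩ | ⟨i, hτ, hf, he⟩⟩
    · exact ⟨hc, Or.inl ⟨he, hf, ho⟩⟩
    · exact ⟨hc, Or.inr (Or.inl ⟨i, hτ, hfi he heB, hf⟩)⟩
    · exact ⟨hc, Or.inr (Or.inr ⟨i, hτ, hfi hf hfB, he⟩)⟩

end Fingers

/-- The labeled braidoid diagram of a framed diagram: the risers are removed, and their ends are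
joined vertically to the bottom and top ends, over or under the other edges as the label
prescribes. -/
def IsFramed.braid (h : IsFramed D V τ c d)
    (hcs : IsCurveSystem (braidEdges D V c d)
      ({D.leg} ∪ Set.range fun i : Fin n => ((endX c d i, 0) : Pt))
      ({D.head} ∪ Set.range fun i : Fin n => ((endX c d i, 1) : Pt))
      (overBy D V τ (stubsOf V c d))) : LabeledBraidoidDiagram where
  edges := braidEdges D V c d
  leg := D.leg
  head := D.head
  passesOver := overBy D V τ (stubsOf V c d)
  n := n
  firstEnd := c
  spacing := d
  spacing_pos := h.pos
  isCurveSystem := hcs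
  mem_square := by
    intro e he p hp
    have hsq : ∀ s ∈ verts D.edges, s ∈ Set.Icc (0 : ℝ) 1 ×ˢ Set.Icc (0 : ℝ) 1 := fun s hs =>
      Set.prod_mono Set.Ioo_subset_Icc_self Set.Ioo_subset_Icc_self (h.square s hs)
    rcases he with he | he
    · exact hsq p ⟨e, he.1, hp⟩
    · obtain ⟨i, hi⟩ := Set.mem_iUnion.1 he
      have h1 := hsq _ (fst_mem_verts (h.riser i).mem)
      have h2 := hsq _ (snd_mem_verts (h.riser i).mem)
      have hx : endX c d i ∈ Set.Icc (0 : ℝ) 1 := h.fst i ▸ h1.1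
      rcases hi with rfl | rfl <;> rcases hp with rfl | rfl
      · exact ⟨hx, h1.2⟩
      · exact ⟨hx, zero_le_one, le_rfl⟩
      · exact ⟨hx, le_rfl, zero_le_one⟩
      · exact ⟨hx, h2.2⟩
  descending := by
    rintro e (he | he)
    · exact h.descending e he.1 he.2
    · obtain ⟨i, hi⟩ := Set.mem_iUnion.1 he
      rcases hi with rfl | rfl
      · exact (h.square _ (fst_mem_verts (h.riser i).mem)).2.2
      · exact (h.square _ (snd_mem_verts (h.riser i).mem)).2.1
  leg_not_aligned i := h.fst i ▸ (h.riser i).leg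
  head_not_aligned i := h.fst i ▸ (h.riser i).head
  label := τ

theorem Fingers.eq_closure (F : Fingers D D' V τ c d ε Finset.univ) (h : IsFramed D V τ c d)
    (ht : Thin D n c d ε) (hcs) : D'.toDiagramData = (h.braid hcs).closure ε := by
  have hst : ∀ {e : Edge} {i : Fin n}, e ∈ stubsOf V c d i → e ∈ fingerOf V c d ε i := Or.inl
  have harc : ∀ {e : Edge} {i : Fin n}, e ∈ joiningArc (endX c d i) ε → e ∈ fingerOf V c d ε i :=
    Or.inr
  have hrest : ∀ {e f : Edge} {i : Fin n}, e ∈ fingerOf V c d ε i → f ∈ braidEdges D V c d →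
      (e.Crosses f ∨ f.Crosses e) → f ∈ restEdges D V := by
    intro e f i he hf hc
    rcases hf with hf | hf
    · exact hf
    · obtain ⟨j, hj⟩ := Set.mem_iUnion.1 hf
      rcases hc with hc | hc
      · exact (F.not_crosses ht he (hst hj) hc).elim
      · exact (F.not_crosses ht (hst hj) he hc).elim
  apply DiagramData.ext
  · ext e
    rw [F.mem_iff_braid]
    change _ ↔ e ∈ braidEdges D V c d ∪ ⋃ i : Fin n, joiningArc (endX c d i) ε
    rw [Set.mem_union, Set.mem_iUnion]
  · exact F.leg_eq
  · exact F.head_eq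
  · funext e f
    apply propext
    rw [F.passesOver_iff ht]
    change _ ↔ overBy D V τ (stubsOf V c d) e f ∨ (e.Crosses f ∧
      ((∃ i : Fin n, τ i = Label.o ∧ e ∈ joiningArc (endX c d i) ε ∧ f ∈ braidEdges D V c d) ∨
       (∃ i : Fin n, τ i = Label.u ∧ f ∈ joiningArc (endX c d i) ε ∧ e ∈ braidEdges D V c d)))
    constructor
    · rintro ⟨hc, ⟨he, hf, ho⟩ | ⟨i, hτ, he | he, hf⟩ | ⟨i, hτ, hf | hf, he⟩⟩
      · exact Or.inl ⟨hc, Or.inl ⟨he, hf, ho⟩⟩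
      · exact Or.inl ⟨hc, Or.inr (Or.inl ⟨i, hτ, he, hf⟩)⟩
      · exact Or.inr ⟨hc, Or.inl ⟨i, hτ, he, Or.inl hf⟩⟩
      · exact Or.inl ⟨hc, Or.inr (Or.inr ⟨i, hτ, hf, he⟩)⟩
      · exact Or.inr ⟨hc, Or.inr ⟨i, hτ, hf, Or.inl he⟩⟩
    · rintro (⟨hc, ⟨he, hf, ho⟩ | ⟨i, hτ, he, hf⟩ | ⟨i, hτ, hf, he⟩⟩ |
        ⟨hc, ⟨i, hτ, he, hf⟩ | ⟨i, hτ, hf, he⟩⟩)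
      · exact ⟨hc, Or.inl ⟨he, hf, ho⟩⟩
      · exact ⟨hc, Or.inr (Or.inl ⟨i, hτ, hst he, hf⟩)⟩
      · exact ⟨hc, Or.inr (Or.inr ⟨i, hτ, hst hf, he⟩)⟩
      · exact ⟨hc, Or.inr (Or.inl ⟨i, hτ, harc he, hrest (harc he) hf (Or.inl hc)⟩)⟩
      · exact ⟨hc, Or.inr (Or.inr ⟨i, hτ, harc hf, hrest (harc hf) he (Or.inr hc)⟩)⟩

/-- A framed diagram is isotopic to the closures of a labeled braidoid diagram. -/
theorem IsFramed.exists_closure (h : IsFramed D V τ c d) :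
    ∃ B : LabeledBraidoidDiagram, ∀ᶠ ε in 𝓝[>] (0 : ℝ),
      ∃ D' : MultiKnotoidDiagram, D'.toDiagramData = B.closure ε ∧ Isotopic D D' := by
  have hev := eventually_thin D n c h.pos
  obtain ⟨ε₀, ht₀⟩ := hev.exists
  obtain ⟨D₀, F₀⟩ := exists_fingers h ht₀ Finset.univ
  have hcs := D₀.isCurveSystem.restrict (fun e he => F₀.mem_of_braid he)
    (F₀.overBy_stubs_iff ht₀) (F₀.braid_init ht₀) (F₀.braid_term ht₀)
  refine ⟨h.braid hcs, hev.mono fun ε ht => ?_⟩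
  obtain ⟨D', F⟩ := exists_fingers h ht Finset.univ
  exact ⟨D', F.eq_closure h ht hcs, F.isotopic⟩

theorem exists_isFramed (K : MultiKnotoidDiagram) :
    ∃ (D : MultiKnotoidDiagram) (n : ℕ) (V : Fin n → Edge) (τ : Fin n → Label) (c d : ℝ),
      Isotopic K D ∧ IsFramed D V τ c d := by
  obtain ⟨D, n, V, c, d, iso, hS, hV, hd, hx, hsq⟩ := exists_equidistant_square K
  choose τ hτ using fun i => hS.riser (hV.mem i) (hV.vertical i)
  refine ⟨D, n, V, τ, c, d, iso, hτ, fun e he hne => ?_, hd, hx, hsq⟩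
  rcases hS e he with ⟨-, h2⟩ | ⟨σ, hσ⟩
  · exact h2.resolve_left fun h => h
  · obtain ⟨i, hi⟩ := hV.surj e he hσ.vertical
    exact (hne i hi.symm).elim

end Frame

end PLKnotoid

theorem theorem1 (K : PLKnotoid.MultiKnotoidDiagram) :
    ∃ B : PLKnotoid.LabeledBraidoidDiagram, ∀ᶠ ε in 𝓝[>] (0 : ℝ),
      ∃ D : PLKnotoid.MultiKnotoidDiagram,
        D.toDiagramData = B.closure ε ∧ PLKnotoid.MultiKnotoidDiagram.Isotopic K D := by
  obtain ⟨D, n, V, τ, c, d, iso, h⟩ := PLKnotoid.exists_isFramed K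
  obtain ⟨B, hB⟩ := h.exists_closure
  refine ⟨B, hB.mono ?_⟩
  rintro ε ⟨D', hD', iso'⟩
  exact ⟨D', hD', iso.trans iso'⟩
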